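/- Fix an integer $d\ge 1$. An instance of the min-min expectation binary selection problem consists of an integer $n\ge 1$, nonnegative rational values $l_0<l_1<\dots<l_{d-1}$, and $2n$ random variables $Y_{i,s}$ ($1\le i\le n$, $s\in\{0,1\}$) with values in $\{l_0,\dots,l_{d-1}\}$, where each $Y_{i,s}$ is specified by the rational probabilities $\Pr(Y_{i,s}\ge l_j)$, $1\le j\le d-1$. All rationals are given as ratios of integers in binary, and $N$ is the total number of bits of the instance. The task is to choose $\chi:\{1,\dots,n\}\to\{0,1\}$ so as to minimize $\mathbb E[\min_{1\le i\le n} Y_{i,\chi(i)}]$, the selected variables being independent. In the min-min expectation subset selection problem one is given $n$ such random variables $Y_i$ and an integer $k$ with $1\le k\le n$, and has to choose a set $S\subseteq\{1,\dots,n\}$ with $|S|=k$ so as to minimize $\mathbb E[\min_{i\in S}Y_i]$, the selected variables again being independent. Theorem. (a) The min-min expectation binary selection problem with $d$ possible values has a fully polynomial-time approximation scheme: there is an algorithm which, given an instance and a rational $\varepsilon>0$ (also given as a ratio of integers in binary), outputs a selection whose expected minimum is at most $1+\varepsilon$ times the optimum, in time (bit operations; logarithmic cost on a random access machine) polynomial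 in the length of the input and $1/\varepsilon$. Moreover, for $\varepsilon\le 1$ the same algorithm performs $O\bigl(n(nN/\varepsilon)^{d-1}\bigr)$ elementary steps (array accesses, comparisons and integer arithmetic operations), with a constant depending only on $d$. (b) The min-min expectation subset selection problem with $d$ possible values also has a fully polynomial-time approximation scheme. -/

import Mathlib

open MeasureTheory

namespace MinExp

/-! ### A random access machine with structured control

The memory consists of arrays of natural numbers; a fixed program mentions only finitely many
arrays.  A run is charged in two ways: by the number of elementary steps (uniform cost), and by
the number of binary digits handled by these steps (logarithmic cost). -/

/-- The memory: `σ a i` is the entry with index `i` of the array `a`. -/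
abbrev Mem : Type := ℕ → ℕ → ℕ

/-- Elementary operations on natural numbers (truncated subtraction, division with remainder,
and comparisons with value `0` or `1`). -/
inductive Op : Type
  | add | sub | mul | div | mod | lt | eq

/-- The value of an elementary operation. -/
def Op.eval : Op → ℕ → ℕ → ℕ
  | .add, x, y => x + y
  | .sub, x, y => x - y
  | .mul, x, y => x * y
  | .div, x, y => x / y
  | .mod, x, y => x % y
  | .lt, x, y => if x < y then 1 else 0
  | .eq, x, y => if x = y then 1 else 0

/-- Arithmetic expressions: constants, array reads (the address is again an expression), and
elementary operations. -/
inductive Exp : Type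
  | lit (x : ℕ)
  | read (a : ℕ) (idx : Exp)
  | bin (o : Op) (e₁ e₂ : Exp)

/-- The number of binary digits of a natural number (one digit for `0`). -/
def digits (x : ℕ) : ℕ := max 1 (Nat.size x)

/-- The value of an expression. -/
def Exp.eval (σ : Mem) : Exp → ℕ
  | .lit x => x
  | .read a idx => σ a (idx.eval σ)
  | .bin o e₁ e₂ => o.eval (e₁.eval σ) (e₂.eval σ)

/-- The number of elementary steps needed to evaluate an expression: one for each node. -/
def Exp.steps : Exp → ℕ
  | .lit _ => 1
  | .read _ idx => idx.steps + 1
  | .bin _ e₁ e₂ => e₁.steps + e₂.steps + 1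

/-- The logarithmic cost of evaluating an expression: the total number of binary digits of
all constants, addresses, operands and results that occur. -/
def Exp.bits (σ : Mem) : Exp → ℕ
  | .lit x => digits x
  | .read a idx => idx.bits σ + digits (σ a (idx.eval σ))
  | .bin o e₁ e₂ => e₁.bits σ + e₂.bits σ + digits (o.eval (e₁.eval σ) (e₂.eval σ))

/-- Programs. -/
inductive Cmd : Type
  | skip
  | write (a : ℕ) (idx e : Exp)
  | seq (c₁ c₂ : Cmd)
  | ite (e : Exp) (c₁ c₂ : Cmd)
  | loop (e : Exp) (c : Cmd)

/-- The memory after the entry `i` of the array `a` has been overwritten by `v`. -/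
def Mem.set (σ : Mem) (a i v : ℕ) : Mem :=
  fun a' i' => if a' = a ∧ i' = i then v else σ a' i'

/-- `Exec c σ σ' t b`: started in memory `σ`, the program `c` halts in memory `σ'` after `t`
elementary steps, with logarithmic cost `b`.  A condition holds if its value is not `0`;
`loop e c` repeats `c` as long as `e` holds. -/
inductive Exec : Cmd → Mem → Mem → ℕ → ℕ → Prop
  | skip (σ : Mem) : Exec .skip σ σ 1 1
  | write (a : ℕ) (idx e : Exp) (σ : Mem) :
      Exec (.write a idx e) σ (σ.set a (idx.eval σ) (e.eval σ))
        (idx.steps + e.steps + 1) (idx.bits σ + e.bits σ + 1)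
  | seq {c₁ c₂ : Cmd} {σ σ' σ'' : Mem} {t₁ b₁ t₂ b₂ : ℕ}
      (h₁ : Exec c₁ σ σ' t₁ b₁) (h₂ : Exec c₂ σ' σ'' t₂ b₂) :
      Exec (.seq c₁ c₂) σ σ'' (t₁ + t₂) (b₁ + b₂)
  | ite_true {e : Exp} {c₁ c₂ : Cmd} {σ σ' : Mem} {t b : ℕ}
      (he : e.eval σ ≠ 0) (h : Exec c₁ σ σ' t b) :
      Exec (.ite e c₁ c₂) σ σ' (e.steps + t + 1) (e.bits σ + b + 1)
  | ite_false {e : Exp} {c₁ c₂ : Cmd} {σ σ' : Mem} {t b : ℕ}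
      (he : e.eval σ = 0) (h : Exec c₂ σ σ' t b) :
      Exec (.ite e c₁ c₂) σ σ' (e.steps + t + 1) (e.bits σ + b + 1)
  | loop_done {e : Exp} {c : Cmd} {σ : Mem} (he : e.eval σ = 0) :
      Exec (.loop e c) σ σ (e.steps + 1) (e.bits σ + 1)
  | loop_next {e : Exp} {c : Cmd} {σ σ' σ'' : Mem} {t₁ b₁ t₂ b₂ : ℕ}
      (he : e.eval σ ≠ 0) (h₁ : Exec c σ σ' t₁ b₁) (h₂ : Exec (.loop e c) σ' σ'' t₂ b₂) :
      Exec (.loop e c) σ σ'' (e.steps + t₁ + t₂ + 1) (e.bits σ + b₁ + b₂ + 1)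

/-- The initial memory for an input list: the list is stored in array `0`, all else is `0`. -/
def inputMem (L : List ℕ) : Mem := fun a i => if a = 0 then L.getD i 0 else 0

/-- The list `L` stands at the beginning of array `1`, the output array. -/
def HasOutput (σ : Mem) (L : List ℕ) : Prop :=
  ∀ (i : ℕ) (h : i < L.length), σ 1 i = L[i]

/-! ### Numbers in the input -/

/-- A nonnegative number, specified as a ratio of integers (not necessarily in lowest terms). -/
structure Ratio where
  num : ℕ
  den : ℕ
  den_pos : 0 < den

/-- The number specified by a ratio. -/
noncomputable def Ratio.val (r : Ratio) : ℝ := (r.num : ℝ) / (r.den : ℝ)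

/-- A ratio is listed as its numerator followed by its denominator. -/
def Ratio.encode (r : Ratio) : List ℕ := [r.num, r.den]

/-! ### Minimization problems and approximation schemes -/

/-- A minimization problem: instances and their encodings as lists of integers, the feasible
solutions of an instance and their encodings, and the cost of a solution. -/
structure MinProblem where
  Inst : Type
  encode : Inst → List ℕ
  Sol : Inst → Type
  encodeSol : (I : Inst) → Sol I → List ℕ
  cost : (I : Inst) → Sol I → ℝ

/-- The number of bits required to specify the instance. -/
def MinProblem.size (P : MinProblem) (I : P.Inst) : ℕ := ((P.encode I).map digits).sum

/-- The input of an approximation scheme: the accuracy and the instance. -/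
def MinProblem.input (P : MinProblem) (I : P.Inst) (ε : Ratio) : List ℕ :=
  ε.encode ++ P.encode I

/-- The number of bits of the whole input. -/
def MinProblem.inputSize (P : MinProblem) (I : P.Inst) (ε : Ratio) : ℕ :=
  ((P.input I ε).map digits).sum

/-- The program `c` is a fully polynomial time approximation scheme for `P`: on every instance
and for every rational `ε > 0` it halts with a feasible solution whose cost is at most `1 + ε`
times the cost of any feasible solution, and its logarithmic cost is bounded by a polynomial in
the length of the input and `1 / ε`. -/
def IsFPTAS (P : MinProblem) (c : Cmd) : Prop :=
  ∃ C : ℕ, ∀ (I : P.Inst) (ε : Ratio), 0 < ε.val →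
    ∃ (σ : Mem) (t b : ℕ) (s : P.Sol I),
      Exec c (inputMem (P.input I ε)) σ t b ∧
      HasOutput σ (P.encodeSol I s) ∧
      (∀ s' : P.Sol I, P.cost I s ≤ (1 + ε.val) * P.cost I s') ∧
      (b : ℝ) ≤ C * ((P.inputSize I ε : ℝ) + 1 / ε.val) ^ C

/-! ### The random variables -/

/-- The distribution of a random variable `Y` with values among `l₀ < l₁ < ⋯ < l_{d-1}`, as it
is specified in the input: `tail j` is the probability of `Y ≥ l_{j+1}`, for `j + 1 = 1, …, d-1`. -/
structure TailDist (d : ℕ) where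
  tail : Fin (d - 1) → Ratio
  le_one : ∀ j, (tail j).val ≤ 1
  anti : Antitone fun j => (tail j).val

/-- The probability of `Y ≥ l_j`, for `0 ≤ j < d`; it is `1` for `j = 0`.  (For `j = d` the
value is `0`, no value being larger than `l_{d-1}`.) -/
noncomputable def TailDist.prGE {d : ℕ} (Y : TailDist d) (j : ℕ) : ℝ :=
  if j = 0 then 1 else if h : j - 1 < d - 1 then (Y.tail ⟨j - 1, h⟩).val else 0

/-- The law of `Y`: it has an atom of weight `Pr(Y ≥ l_j) - Pr(Y ≥ l_{j+1})` at `l_j`. -/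
noncomputable def TailDist.law {d : ℕ} (l : Fin d → Ratio) (Y : TailDist d) : Measure ℝ :=
  ∑ j : Fin d, ENNReal.ofReal (Y.prGE j - Y.prGE (j + 1)) • Measure.dirac (l j).val

/-- The encoding of a random variable: the numbers `Pr(Y ≥ l_j)`, `1 ≤ j ≤ d-1`, followed by the
integer `0` as an end mark. -/
def TailDist.encode {d : ℕ} (Y : TailDist d) : List ℕ :=
  (List.finRange (d - 1)).flatMap (fun j => (Y.tail j).encode) ++ [0]

/-- The expected value of the minimum of independent random variables `Y i`. -/
noncomputable def expMin {d : ℕ} (l : Fin d → Ratio) {ι : Type} [Fintype ι]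
    (Y : ι → TailDist d) : ℝ :=
  ∫ y : ι → ℝ, ⨅ i, y i ∂(Measure.pi fun i => (Y i).law l)

/-! ### The two selection problems -/

/-- An instance of the binary selection problem: the possible values `l₀ < ⋯ < l_{d-1}` (which
are nonnegative), and `n` pairs of random variables `Y i 0`, `Y i 1`. -/
structure BinaryInstance (d : ℕ) where
  n : ℕ
  n_pos : 0 < n
  l : Fin d → Ratio
  l_strictMono : StrictMono fun j => (l j).val
  Y : Fin n → Fin 2 → TailDist d

/-- The encoding of an instance of the binary selection problem. -/
def BinaryInstance.encode {d : ℕ} (I : BinaryInstance d) : List ℕ :=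
  [I.n] ++ (List.finRange d).flatMap (fun j => (I.l j).encode) ++
    (List.finRange I.n).flatMap (fun i => (I.Y i 0).encode ++ (I.Y i 1).encode)

/-- The min-min expectation binary selection problem with `d` possible values: choose
`χ : {1, …, n} → {0, 1}` so as to minimize the expectation of the minimum of the `Y i (χ i)`. -/
noncomputable def minMinBinary (d : ℕ) : MinProblem where
  Inst := BinaryInstance d
  encode := BinaryInstance.encode
  Sol I := Fin I.n → Fin 2
  encodeSol _ χ := List.ofFn fun i => (χ i : ℕ)
  cost I χ := expMin I.l fun i => I.Y i (χ i)

/-- An instance of the subset selection problem: the possible values `l₀ < ⋯ < l_{d-1}` (which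
are nonnegative), `n` random variables `Y i`, and the number `k` of variables to be chosen. -/
structure SubsetInstance (d : ℕ) where
  n : ℕ
  k : ℕ
  k_pos : 0 < k
  k_le : k ≤ n
  l : Fin d → Ratio
  l_strictMono : StrictMono fun j => (l j).val
  Y : Fin n → TailDist d

/-- The encoding of an instance of the subset selection problem. -/
def SubsetInstance.encode {d : ℕ} (I : SubsetInstance d) : List ℕ :=
  [I.n, I.k] ++ (List.finRange d).flatMap (fun j => (I.l j).encode) ++
    (List.finRange I.n).flatMap (fun i => (I.Y i).encode)

/-- The min-min expectation subset selection problem with `d` possible values: choose a set `S`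
of `k` indices so as to minimize the expectation of the minimum of the `Y i`, `i ∈ S`.  A set is
output as its indicator sequence. -/
noncomputable def minMinSubset (d : ℕ) : MinProblem where
  Inst := SubsetInstance d
  encode := SubsetInstance.encode
  Sol I := {S : Finset (Fin I.n) // S.card = I.k}
  encodeSol _ S := List.ofFn fun i => if i ∈ S.1 then 1 else 0
  cost I S := expMin I.l fun i : {i // i ∈ S.1} => I.Y i.1

end MinExp

/-!
Since the values are among `l₀ < ⋯ < l_{d-1}`, the expected minimum of independent variables `Y_i`
equals `l₀ + ∑ j, (l_{j+1} - l_j) ∏ i, Pr(Y_i ≥ l_{j+1})` (`expMin_eq`). So only `d - 1` products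
of probabilities matter. With `m = 2 n (⌊1 / ε⌋ + 1)`, every nonzero probability is rounded up to
a power of `m / (m + 1)`; a product of `n` of them changes at most by the factor
`(1 + 1 / m) ^ n ≤ 1 + ε` (`pow_le_one_add`, `Data.rounding`), and therefore a selection of least rounded cost is a
`(1 + ε)`-approximation (`Data.approx`).

A rounded product is determined by its exponent. A nonzero probability with an `s`-digit
denominator has a weight (the exponent of its rounding) of at most `m s`, so the exponents are
bounded by the sum `W ≤ m N` of all weights; the exponent `W + 1` stands for a product that is
zero, and exponents are added with saturation. The exponents of the `d - 1` products are the
digits of a code to the base `W + 2`. A dynamic program computes, for each number `i` of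
decisions, which codes can be reached, and stores a predecessor for each of them; with `n` layers
of `(W + 2) ^ (d - 1) = O((n N / ε) ^ (d - 1))` codes this is the claimed number of steps. The
rounded costs of the codes are compared as integers, after multiplication by `(m + 1) ^ W` and by
the denominators of the `l_j`.

Subset selection is the same problem with the decisions whether or not to select a variable, where
all probabilities are `1` if it is not selected, and with the number of selected variables as an
additional digit of the code. One program serves both; a `Layout` tells where its parameters stand
in the input, and `Represents` relates the parameters to the instance.

The program is verified with a program logic (`Runs`, `wp`, `Runs.loop`) that bounds the number of
steps. The logarithmic cost comes for free: if all entries of the memory stay below `2 ^ M`,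
evaluating an expression with `s` nodes costs at most `2 (M + 1) s²`, so a run of `t` steps costs
at most `2 (M + 1) t²`. It remains to bound the values written (`Data.Fits`); the largest of them
are powers of `m + 1` whose exponents are of the order of `W`, so their lengths are polynomial.
-/

namespace MinExp

/-! ### Determinism of the machine -/

theorem Exec.det {c : Cmd} {σ σ₁ σ₂ : Mem} {t₁ b₁ t₂ b₂ : ℕ} (h₁ : Exec c σ σ₁ t₁ b₁)
    (h₂ : Exec c σ σ₂ t₂ b₂) : σ₁ = σ₂ ∧ t₁ = t₂ ∧ b₁ = b₂ := by
  induction h₁ generalizing σ₂ t₂ b₂ with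
  | skip σ => cases h₂; exact ⟨rfl, rfl, rfl⟩
  | write a idx e σ => cases h₂; exact ⟨rfl, rfl, rfl⟩
  | seq _ _ ih₁ ih₂ =>
    cases h₂ with
    | seq k₁ k₂ =>
      obtain ⟨rfl, rfl, rfl⟩ := ih₁ k₁
      obtain ⟨rfl, rfl, rfl⟩ := ih₂ k₂
      exact ⟨rfl, rfl, rfl⟩
  | ite_true he _ ih =>
    cases h₂ with
    | ite_true _ k => obtain ⟨rfl, rfl, rfl⟩ := ih k; exact ⟨rfl, rfl, rfl⟩
    | ite_false he' _ => exact absurd he' he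
  | ite_false he _ ih =>
    cases h₂ with
    | ite_true he' _ => exact absurd he he'
    | ite_false _ k => obtain ⟨rfl, rfl, rfl⟩ := ih k; exact ⟨rfl, rfl, rfl⟩
  | loop_done he =>
    cases h₂ with
    | loop_done _ => exact ⟨rfl, rfl, rfl⟩
    | loop_next he' _ _ => exact absurd he he'
  | loop_next he _ _ ih₁ ih₂ =>
    cases h₂ with
    | loop_done he' => exact absurd he' he
    | loop_next _ k₁ k₂ =>
      obtain ⟨rfl, rfl, rfl⟩ := ih₁ k₁
      obtain ⟨rfl, rfl, rfl⟩ := ih₂ k₂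
      exact ⟨rfl, rfl, rfl⟩

/-! ### Arrays that a program leaves alone -/

/-- The arrays that occur as targets of assignments in a program. -/
def Cmd.writes : Cmd → List ℕ
  | .skip => []
  | .write a _ _ => [a]
  | .seq c₁ c₂ => c₁.writes ++ c₂.writes
  | .ite _ c₁ c₂ => c₁.writes ++ c₂.writes
  | .loop _ c => c.writes

/-- A run changes only the arrays that are targets of assignments. -/
theorem Exec.frame {c : Cmd} {σ σ' : Mem} {t b : ℕ} (h : Exec c σ σ' t b) :
    ∀ a, a ∉ c.writes → σ' a = σ a := by
  induction h with
  | skip σ => intros; rfl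
  | write a idx e σ =>
    intro a' ha
    have : a' ≠ a := by simpa [Cmd.writes] using ha
    funext i
    simp [Mem.set, this]
  | seq _ _ ih₁ ih₂ =>
    intro a ha
    simp only [Cmd.writes, List.mem_append, not_or] at ha
    rw [ih₂ a ha.2, ih₁ a ha.1]
  | ite_true _ _ ih =>
    intro a ha
    simp only [Cmd.writes, List.mem_append, not_or] at ha
    exact ih a ha.1
  | ite_false _ _ ih =>
    intro a ha
    simp only [Cmd.writes, List.mem_append, not_or] at ha
    exact ih a ha.2
  | loop_done _ => intros; rfl
  | loop_next _ _ _ ih₁ ih₂ => intro a ha; rw [ih₂ a ha, ih₁ a ha]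

/-! ### Logarithmic cost -/

/-- The largest constant in an expression. -/
def Exp.maxLit : Exp → ℕ
  | .lit x => x
  | .read _ idx => idx.maxLit
  | .bin _ e₁ e₂ => max e₁.maxLit e₂.maxLit

/-- The largest constant in a program. -/
def Cmd.maxLit : Cmd → ℕ
  | .skip => 0
  | .write _ idx e => max idx.maxLit e.maxLit
  | .seq c₁ c₂ => max c₁.maxLit c₂.maxLit
  | .ite e c₁ c₂ => max e.maxLit (max c₁.maxLit c₂.maxLit)
  | .loop e c => max e.maxLit c.maxLit

/-- All entries of the memory are at most `2 ^ M`. -/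
def Bdd (M : ℕ) (σ : Mem) : Prop := ∀ a i, σ a i ≤ 2 ^ M

theorem Exp.steps_pos (e : Exp) : 1 ≤ e.steps := by
  cases e <;> simp [Exp.steps]

theorem Op.eval_le_two_pow (o : Op) {x y k l : ℕ} (hx : x ≤ 2 ^ k) (hy : y ≤ 2 ^ l) :
    o.eval x y ≤ 2 ^ (k + l + 1) := by
  have hk : 2 ^ k ≤ 2 ^ (k + l + 1) := Nat.pow_le_pow_right (by norm_num) (by omega)
  have h1 : 1 ≤ 2 ^ (k + l + 1) := Nat.one_le_two_pow
  cases o with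
  | add =>
    have h2 : 2 ^ k ≤ 2 ^ (k + l) := Nat.pow_le_pow_right (by norm_num) (by omega)
    have h3 : 2 ^ l ≤ 2 ^ (k + l) := Nat.pow_le_pow_right (by norm_num) (by omega)
    simp only [Op.eval]
    rw [pow_succ]
    omega
  | sub => simp only [Op.eval]; omega
  | mul =>
    simp only [Op.eval]
    calc x * y ≤ 2 ^ k * 2 ^ l := Nat.mul_le_mul hx hy
      _ = 2 ^ (k + l) := by rw [pow_add]
      _ ≤ _ := Nat.pow_le_pow_right (by norm_num) (by omega)
  | div => exact (Nat.div_le_self _ _).trans (hx.trans hk)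
  | mod => exact (Nat.mod_le _ _).trans (hx.trans hk)
  | lt => simp only [Op.eval]; split <;> omega
  | eq => simp only [Op.eval]; split <;> omega

/-- Since an expression multiplies at most as often as it has nodes, its value is not much longer
than the entries of the memory. -/
theorem Exp.eval_le_two_pow {M : ℕ} {σ : Mem} (hσ : Bdd M σ) (e : Exp) (he : e.maxLit ≤ 2 ^ M) :
    e.eval σ ≤ 2 ^ ((M + 1) * e.steps) := by
  induction e with
  | lit x => exact he.trans (Nat.pow_le_pow_right (by norm_num) (by simp [Exp.steps]))
  | read a idx _ =>
    exact (hσ _ _).trans (Nat.pow_le_pow_right (by norm_num) (by simp only [Exp.steps]; nlinarith))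
  | bin o e₁ e₂ ih₁ ih₂ =>
    simp only [Exp.maxLit, max_le_iff] at he
    refine (o.eval_le_two_pow (ih₁ he.1) (ih₂ he.2)).trans
      (Nat.pow_le_pow_right (by norm_num) ?_)
    simp only [Exp.steps]
    nlinarith

theorem digits_le_of_le_two_pow {x k : ℕ} (hk : 1 ≤ k) (h : x ≤ 2 ^ k) : digits x ≤ 2 * k := by
  have : Nat.size x ≤ k + 1 := by
    rw [Nat.size_le]
    calc x ≤ 2 ^ k := h
      _ < 2 ^ (k + 1) := Nat.pow_lt_pow_right (by norm_num) (by omega)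
  simp only [digits]
  omega

theorem Exp.bits_le {M : ℕ} {σ : Mem} (hσ : Bdd M σ) (e : Exp) (he : e.maxLit ≤ 2 ^ M) :
    e.bits σ ≤ 2 * (M + 1) * e.steps ^ 2 := by
  have key : ∀ e : Exp, e.maxLit ≤ 2 ^ M → digits (e.eval σ) ≤ 2 * ((M + 1) * e.steps) := by
    intro e he
    refine digits_le_of_le_two_pow ?_ (e.eval_le_two_pow hσ he)
    have := e.steps_pos
    nlinarith
  induction e with
  | lit x => simpa [Exp.bits, Exp.steps, Exp.eval] using key (.lit x) he
  | read a idx ih =>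
    have h1 := ih he
    have h2 := key (.read a idx) he
    simp only [Exp.eval, Exp.steps, Exp.bits] at h1 h2 ⊢
    have := idx.steps_pos
    nlinarith
  | bin o e₁ e₂ ih₁ ih₂ =>
    have h3 := key (.bin o e₁ e₂) he
    simp only [Exp.maxLit, max_le_iff] at he
    have h1 := ih₁ he.1
    have h2 := ih₂ he.2
    have p1 := e₁.steps_pos
    have p2 := e₂.steps_pos
    simp only [Exp.eval, Exp.steps, Exp.bits] at h1 h2 h3 ⊢
    have : e₁.steps ^ 2 + e₂.steps ^ 2 + (e₁.steps + e₂.steps + 1)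
        ≤ (e₁.steps + e₂.steps + 1) ^ 2 := by nlinarith
    calc _ ≤ 2 * (M + 1) * (e₁.steps ^ 2 + e₂.steps ^ 2 + (e₁.steps + e₂.steps + 1)) := by
          linarith
      _ ≤ _ := Nat.mul_le_mul_left _ this

/-! ### Rules for verifying programs -/

theorem sum_three_sq_add_one_le (x y z : ℕ) :
    x ^ 2 + y ^ 2 + z ^ 2 + 1 ≤ (x + y + z + 1) ^ 2 := by
  nlinarith [Nat.zero_le (x * y), Nat.zero_le (x * z), Nat.zero_le (y * z)]

/-- Started in `σ`, the program `c` halts within `T` steps in a memory satisfying `Q`.  Moreover,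
if `σ` is bounded by `2 ^ M`, then so is the final memory, and the logarithmic cost of the run is
at most `2 (M + 1) t²`, where `t` is the number of steps. -/
def Runs (M : ℕ) (c : Cmd) (σ : Mem) (T : ℕ) (Q : Mem → Prop) : Prop :=
  Bdd M σ → ∃ σ' t b, Exec c σ σ' t b ∧ t ≤ T ∧
    (c.maxLit ≤ 2 ^ M → b ≤ 2 * (M + 1) * t ^ 2) ∧ Bdd M σ' ∧ Q σ'

theorem Runs.weaken {M : ℕ} {c : Cmd} {σ : Mem} {T T' : ℕ} {Q Q' : Mem → Prop}
    (h : Runs M c σ T Q) (hT : T ≤ T')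
    (hQ : ∀ σ', (∀ a, a ∉ c.writes → σ' a = σ a) → Q σ' → Q' σ') : Runs M c σ T' Q' := by
  intro hσ
  obtain ⟨σ', t, b, he, ht, hb, hB, q⟩ := h hσ
  exact ⟨σ', t, b, he, ht.trans hT, hb, hB, hQ _ he.frame q⟩

theorem Runs.seq {M : ℕ} {c₁ c₂ : Cmd} {σ : Mem} {T₁ T₂ : ℕ} {P Q : Mem → Prop}
    (h₁ : Runs M c₁ σ T₁ P)
    (h₂ : ∀ σ', (∀ a, a ∉ c₁.writes → σ' a = σ a) → P σ' → Runs M c₂ σ' T₂ Q) :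
    Runs M (.seq c₁ c₂) σ (T₁ + T₂) Q := by
  intro hσ
  obtain ⟨σ', t₁, b₁, he₁, ht₁, hb₁, hB₁, q₁⟩ := h₁ hσ
  obtain ⟨σ'', t₂, b₂, he₂, ht₂, hb₂, hB₂, q₂⟩ := h₂ σ' he₁.frame q₁ hB₁
  refine ⟨σ'', _, _, he₁.seq he₂, by omega, fun hl => ?_, hB₂, q₂⟩
  simp only [Cmd.maxLit, max_le_iff] at hl
  have h1 := hb₁ hl.1
  have h2 := hb₂ hl.2
  calc b₁ + b₂ ≤ 2 * (M + 1) * (t₁ ^ 2 + t₂ ^ 2) := by linarith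
    _ ≤ _ := Nat.mul_le_mul_left _ (by nlinarith)

/-- An upper bound for the number of steps of a program without loops. -/
def Cmd.cost : Cmd → ℕ
  | .skip => 1
  | .write _ idx e => idx.steps + e.steps + 1
  | .seq c₁ c₂ => c₁.cost + c₂.cost
  | .ite e c₁ c₂ => e.steps + (c₁.cost + c₂.cost) + 1
  | .loop _ _ => 0

/-- The weakest precondition of a program without loops: `Q` holds afterwards, and all values
that are written are at most `2 ^ M`. -/
def wp (M : ℕ) : Cmd → (Mem → Prop) → Mem → Prop
  | .skip, Q, σ => Q σ
  | .write a idx e, Q, σ => e.eval σ ≤ 2 ^ M ∧ Q (σ.set a (idx.eval σ) (e.eval σ))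
  | .seq c₁ c₂, Q, σ => wp M c₁ (wp M c₂ Q) σ
  | .ite e c₁ c₂, Q, σ => (e.eval σ ≠ 0 → wp M c₁ Q σ) ∧ (e.eval σ = 0 → wp M c₂ Q σ)
  | .loop _ _, _, _ => False

theorem Runs.of_wp {M : ℕ} {c : Cmd} {σ : Mem} {Q : Mem → Prop} (h : wp M c Q σ) :
    Runs M c σ c.cost Q := by
  induction c generalizing σ Q with
  | skip =>
    exact fun hσ => ⟨σ, 1, 1, .skip σ, le_rfl, fun _ => by nlinarith, hσ, h⟩
  | write a idx e =>
    intro hσ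
    refine ⟨_, _, _, .write a idx e σ, le_rfl, fun hl => ?_, ?_, h.2⟩
    · simp only [Cmd.maxLit, max_le_iff] at hl
      have h1 := idx.bits_le hσ hl.1
      have h2 := e.bits_le hσ hl.2
      have := sum_three_sq_add_one_le idx.steps e.steps 0
      calc _ ≤ 2 * (M + 1) * (idx.steps ^ 2 + e.steps ^ 2 + 0 ^ 2 + 1) := by nlinarith
        _ ≤ _ := Nat.mul_le_mul_left _ this
    · intro a' i'
      simp only [Mem.set]
      split
      · exact h.1
      · exact hσ _ _
  | seq c₁ c₂ ih₁ ih₂ => exact (ih₁ h).seq fun σ' _ h' => ih₂ h'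
  | ite e c₁ c₂ ih₁ ih₂ =>
    intro hσ
    have aux : ∀ {b t : ℕ}, e.maxLit ≤ 2 ^ M → b ≤ 2 * (M + 1) * t ^ 2 →
        e.bits σ + b + 1 ≤ 2 * (M + 1) * (e.steps + t + 1) ^ 2 := by
      intro b t hl hb
      have h1 := e.bits_le hσ hl
      have := sum_three_sq_add_one_le e.steps t 0
      calc _ ≤ 2 * (M + 1) * (e.steps ^ 2 + t ^ 2 + 0 ^ 2 + 1) := by nlinarith
        _ ≤ _ := Nat.mul_le_mul_left _ this
    by_cases he : e.eval σ = 0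
    · obtain ⟨σ', t, b, hx, ht, hb, hB, q⟩ := ih₂ (h.2 he) hσ
      refine ⟨σ', _, _, .ite_false he hx, by simp only [Cmd.cost]; omega, fun hl => ?_, hB, q⟩
      simp only [Cmd.maxLit, max_le_iff] at hl
      exact aux hl.1 (hb hl.2.2)
    · obtain ⟨σ', t, b, hx, ht, hb, hB, q⟩ := ih₁ (h.1 he) hσ
      refine ⟨σ', _, _, .ite_true he hx, by simp only [Cmd.cost]; omega, fun hl => ?_, hB, q⟩
      simp only [Cmd.maxLit, max_le_iff] at hl
      exact aux hl.1 (hb hl.2.1)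
  | loop e c _ => exact h.elim

theorem Runs.of_wp_of_bdd {M : ℕ} {c : Cmd} {σ : Mem} {Q : Mem → Prop}
    (h : Bdd M σ → wp M c Q σ) : Runs M c σ c.cost Q :=
  fun hσ => Runs.of_wp (h hσ) hσ

/-- The rule for a loop whose body is executed exactly `K` times, with invariant `Inv`. -/
theorem Runs.loop {M : ℕ} {e : Exp} {c : Cmd} {σ : Mem} (Inv : ℕ → Mem → Prop) (K : ℕ)
    (Tb : ℕ → ℕ) (h0 : Inv 0 σ)
    (hs : ∀ k < K, ∀ σ', (∀ a, a ∉ c.writes → σ' a = σ a) → Inv k σ' →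
      e.eval σ' ≠ 0 ∧ Runs M c σ' (Tb k) (Inv (k + 1)))
    (hK : ∀ σ', (∀ a, a ∉ c.writes → σ' a = σ a) → Inv K σ' → e.eval σ' = 0) :
    Runs M (.loop e c) σ (∑ k ∈ Finset.range K, (Tb k + (e.steps + 1)) + (e.steps + 1))
      (Inv K) := by
  induction K generalizing σ Inv Tb with
  | zero =>
    intro hσ
    refine ⟨σ, _, _, .loop_done (hK σ (fun _ _ => rfl) h0), by simp, fun hl => ?_, hσ, h0⟩
    simp only [Cmd.maxLit, max_le_iff] at hl
    have h1 := e.bits_le hσ hl.1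
    have := sum_three_sq_add_one_le e.steps 0 0
    calc _ ≤ 2 * (M + 1) * (e.steps ^ 2 + 0 ^ 2 + 0 ^ 2 + 1) := by nlinarith
      _ ≤ _ := Nat.mul_le_mul_left _ this
  | succ K ih =>
    intro hσ
    obtain ⟨he, hr⟩ := hs 0 (by omega) σ (fun _ _ => rfl) h0
    obtain ⟨σ₁, t₁, b₁, hx₁, ht₁, hb₁, hB₁, q₁⟩ := hr hσ
    have hf := hx₁.frame
    obtain ⟨σ₂, t₂, b₂, hx₂, ht₂, hb₂, hB₂, q₂⟩ :=
      ih (σ := σ₁) (fun k => Inv (k + 1)) (fun k => Tb (k + 1)) q₁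
        (fun k hk σ' hσ' => hs (k + 1) (by omega) σ'
          fun a ha => (hσ' a ha).trans (hf a ha))
        (fun σ' hσ' => hK σ' fun a ha => (hσ' a ha).trans (hf a ha)) hB₁
    refine ⟨σ₂, _, _, .loop_next he hx₁ hx₂, ?_, fun hl => ?_, hB₂, q₂⟩
    · rw [Finset.sum_range_succ']
      omega
    · have hl' := hl
      simp only [Cmd.maxLit, max_le_iff] at hl
      have h1 := e.bits_le hσ hl.1
      have h2 := hb₁ hl.2
      have h3 := hb₂ hl'
      have := sum_three_sq_add_one_le e.steps t₁ t₂
      calc _ ≤ 2 * (M + 1) * (e.steps ^ 2 + t₁ ^ 2 + t₂ ^ 2 + 1) := by nlinarith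
        _ ≤ _ := Nat.mul_le_mul_left _ this

/-! ### Abbreviations for expressions and memories -/

instance : Add Exp := ⟨.bin .add⟩
instance : Sub Exp := ⟨.bin .sub⟩
instance : Mul Exp := ⟨.bin .mul⟩
instance : Div Exp := ⟨.bin .div⟩
instance : Mod Exp := ⟨.bin .mod⟩
instance (x : ℕ) : OfNat Exp x := ⟨.lit x⟩

/-- The entry `0` of the array `a`, used as a variable. -/
def Exp.var (a : ℕ) : Exp := .read a 0

/-- The value is `1` if `x < y`, and `0` otherwise. -/
def Exp.less (x y : Exp) : Exp := .bin .lt x y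

/-- The value is `1` if `x = y`, and `0` otherwise. -/
def Exp.same (x y : Exp) : Exp := .bin .eq x y

/-- Assignment to the variable `a`. -/
def Cmd.assign (a : ℕ) (e : Exp) : Cmd := .write a 0 e

/-- The sum of the first `k` of the given expressions. -/
def Exp.sum (k : ℕ) (e : ℕ → Exp) : Exp :=
  match k with
  | 0 => 0
  | k + 1 => Exp.sum k e + e k

/-- The product of the first `k` of the given expressions. -/
def Exp.prod (k : ℕ) (e : ℕ → Exp) : Exp :=
  match k with
  | 0 => 1
  | k + 1 => Exp.prod k e * e k

section eval

variable (σ : Mem) (x y : Exp)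

@[simp] theorem Exp.eval_add : (x + y).eval σ = x.eval σ + y.eval σ := rfl
@[simp] theorem Exp.eval_sub : (x - y).eval σ = x.eval σ - y.eval σ := rfl
@[simp] theorem Exp.eval_mul : (x * y).eval σ = x.eval σ * y.eval σ := rfl
@[simp] theorem Exp.eval_div : (x / y).eval σ = x.eval σ / y.eval σ := rfl
@[simp] theorem Exp.eval_mod : (x % y).eval σ = x.eval σ % y.eval σ := rfl
@[simp] theorem Exp.eval_lit (k : ℕ) : (Exp.lit k).eval σ = k := rfl
@[simp] theorem Exp.eval_ofNat (k : ℕ) : (ofNat(k) : Exp).eval σ = OfNat.ofNat k := rfl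
@[simp] theorem Exp.eval_read (a : ℕ) : (Exp.read a x).eval σ = σ a (x.eval σ) := rfl
@[simp] theorem Exp.eval_var (a : ℕ) : (Exp.var a).eval σ = σ a 0 := rfl
@[simp] theorem Exp.eval_less : (Exp.less x y).eval σ = if x.eval σ < y.eval σ then 1 else 0 := rfl
@[simp] theorem Exp.eval_same : (Exp.same x y).eval σ = if x.eval σ = y.eval σ then 1 else 0 := rfl

@[simp] theorem Exp.eval_sum (k : ℕ) (e : ℕ → Exp) :
    (Exp.sum k e).eval σ = ∑ j ∈ Finset.range k, (e j).eval σ := by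
  induction k with
  | zero => rfl
  | succ k ih => rw [Finset.sum_range_succ, ← ih]; rfl

@[simp] theorem Exp.eval_prod (k : ℕ) (e : ℕ → Exp) :
    (Exp.prod k e).eval σ = ∏ j ∈ Finset.range k, (e j).eval σ := by
  induction k with
  | zero => rfl
  | succ k ih => rw [Finset.prod_range_succ, ← ih]; rfl

@[simp] theorem Mem.set_same (a i v : ℕ) : σ.set a i v a = Function.update (σ a) i v := by
  funext j
  simp [Mem.set, Function.update_apply]

theorem Mem.set_ne {a a' : ℕ} (h : a' ≠ a) (i v : ℕ) : σ.set a i v a' = σ a' := by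
  funext j
  simp [Mem.set, h]

end eval

@[simp] theorem Cmd.writes_assign (a : ℕ) (e : Exp) : (Cmd.assign a e).writes = [a] := rfl

@[simp] theorem wp_skip (M : ℕ) (Q : Mem → Prop) (σ : Mem) : wp M .skip Q σ ↔ Q σ := Iff.rfl

@[simp] theorem wp_write (M a : ℕ) (i e : Exp) (Q : Mem → Prop) (σ : Mem) :
    wp M (.write a i e) Q σ ↔ e.eval σ ≤ 2 ^ M ∧ Q (σ.set a (i.eval σ) (e.eval σ)) := Iff.rfl

@[simp] theorem wp_assign (M a : ℕ) (e : Exp) (Q : Mem → Prop) (σ : Mem) :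
    wp M (.assign a e) Q σ ↔ e.eval σ ≤ 2 ^ M ∧ Q (σ.set a 0 (e.eval σ)) := Iff.rfl

@[simp] theorem wp_seq (M : ℕ) (c₁ c₂ : Cmd) (Q : Mem → Prop) (σ : Mem) :
    wp M (.seq c₁ c₂) Q σ ↔ wp M c₁ (wp M c₂ Q) σ := Iff.rfl

@[simp] theorem wp_ite (M : ℕ) (e : Exp) (c₁ c₂ : Cmd) (Q : Mem → Prop) (σ : Mem) :
    wp M (.ite e c₁ c₂) Q σ ↔
      (e.eval σ ≠ 0 → wp M c₁ Q σ) ∧ (e.eval σ = 0 → wp M c₂ Q σ) := Iff.rfl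

/-! ### Variables and arrays of the program

`rN`: number of decisions; `rM`: the number `m`; `rX`, `rK`, `rV`, `rC`: loop counters; `rA`, `rB`,
`rW`: search for a weight; `aNum`, `aWt`: numerators and weights; `rSum`: sum of all weights; `aG`,
`aH`: powers of `m` and `m + 1`; `rBase`, `rSize`: base and number of the codes; `aT`: table of the
dynamic program; `rBest`, `rVal`: best code so far, plus `1`, and its cost; `rY`, `rI`: traceback. -/

notation "rN" => (2 : ℕ)
notation "rM" => (3 : ℕ)
notation "rX" => (4 : ℕ)
notation "rA" => (5 : ℕ)
notation "rB" => (6 : ℕ)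
notation "rW" => (7 : ℕ)
notation "aNum" => (8 : ℕ)
notation "aWt" => (9 : ℕ)
notation "rSum" => (10 : ℕ)
notation "rK" => (11 : ℕ)
notation "aG" => (12 : ℕ)
notation "aH" => (13 : ℕ)
notation "rBase" => (14 : ℕ)
notation "rSize" => (15 : ℕ)
notation "aT" => (16 : ℕ)
notation "rV" => (17 : ℕ)
notation "rC" => (18 : ℕ)
notation "rBest" => (19 : ℕ)
notation "rVal" => (20 : ℕ)
notation "rY" => (21 : ℕ)
notation "rI" => (22 : ℕ)

/-! ### Reachability and predecessors -/

/-- The table of the dynamic program after the nodes below `N` have been processed. Nodes are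
natural numbers, and `g s x` is the node reached from `x` by the decision `s`. The entry of a node
is `0` if the node has not been reached; otherwise it is `2 x + s + 1`, where `x` is a predecessor
and `s` the decision leading from it. Only the root `0` may have an arbitrary nonzero entry. -/
structure DPTable (N : ℕ) (g : ℕ → ℕ → ℕ) (T : ℕ → ℕ) : Prop where
  zero : T 0 ≠ 0
  step : ∀ x < N, T x ≠ 0 → ∀ s < 2, T (g s x) ≠ 0
  pred : ∀ y ≠ 0, T y ≠ 0 → T ((T y - 1) / 2) ≠ 0 ∧ g ((T y - 1) % 2) ((T y - 1) / 2) = y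

theorem DPTable.update {N : ℕ} {g : ℕ → ℕ → ℕ} {T : ℕ → ℕ} (hg : ∀ s x, x < g s x)
    (h : DPTable N g T) (hN : T N ≠ 0) :
    DPTable (N + 1) g (Function.update (Function.update T (g 0 N) (2 * N + 1)) (g 1 N)
      (2 * N + 2)) := by
  set T' := Function.update (Function.update T (g 0 N) (2 * N + 1)) (g 1 N) (2 * N + 2) with hT'
  have hT : ∀ y, T' y = if y = g 1 N then 2 * N + 2 else if y = g 0 N then 2 * N + 1 else T y := by
    intro y
    simp only [hT', Function.update_apply]
  have mono : ∀ y, T y ≠ 0 → T' y ≠ 0 := by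
    intro y hy
    rw [hT]
    split_ifs <;> first | exact hy | omega
  have h0 := hg 0 N
  have h1 := hg 1 N
  refine ⟨mono 0 h.zero, ?_, ?_⟩
  · intro x hx hTx s hs
    rcases Nat.lt_succ_iff_lt_or_eq.1 hx with hx | rfl
    · have : T x ≠ 0 := by
        rw [hT, if_neg (by omega), if_neg (by omega)] at hTx
        exact hTx
      exact mono _ (h.step x hx this s hs)
    · rw [hT]
      interval_cases s <;> split_ifs with e1 e2 <;> omega
  · intro y hy hTy
    by_cases e1 : y = g 1 N
    · have e2 : T' y = 2 * N + 2 := by rw [hT, if_pos e1]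
      have e3 : (2 * N + 2 - 1) / 2 = N := by omega
      have e4 : (2 * N + 2 - 1) % 2 = 1 := by omega
      rw [e2, e3, e4]
      exact ⟨mono _ hN, e1.symm⟩
    · by_cases e0 : y = g 0 N
      · have e2 : T' y = 2 * N + 1 := by rw [hT, if_neg e1, if_pos e0]
        have e3 : (2 * N + 1 - 1) / 2 = N := by omega
        have e4 : (2 * N + 1 - 1) % 2 = 0 := by omega
        rw [e2, e3, e4]
        exact ⟨mono _ hN, e0.symm⟩
      · have e2 : T' y = T y := by rw [hT, if_neg e1, if_neg e0]
        rw [e2] at hTy ⊢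
        obtain ⟨p1, p2⟩ := h.pred y hy hTy
        exact ⟨mono _ p1, p2⟩

theorem DPTable.succ {N : ℕ} {g : ℕ → ℕ → ℕ} {T : ℕ → ℕ} (h : DPTable N g T) (hN : T N = 0) :
    DPTable (N + 1) g T := by
  refine ⟨h.zero, ?_, h.pred⟩
  intro x hx hTx
  rcases Nat.lt_succ_iff_lt_or_eq.1 hx with hx | rfl
  · exact h.step x hx hTx
  · exact absurd hN hTx

/-- Processing of the node stored in `rV`: if it has been reached, its two successors are marked.
A node is the number `i * S + c` of a layer `i` and a code `c < S`. -/
def dpBody (tr : ℕ → Exp) : Cmd :=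
  .seq
    (.ite (.read aT (.var rV))
      (.seq
        (.write aT ((.var rV / .var rSize + 1) * .var rSize + tr 0) (2 * .var rV + 1))
        (.write aT ((.var rV / .var rSize + 1) * .var rSize + tr 1) (2 * .var rV + 2)))
      .skip)
    (.assign rV (.var rV + 1))

/-- All nodes below layer `n` are processed in increasing order. -/
def dpCmd (tr : ℕ → Exp) : Cmd :=
  .loop (.less (.var rV) (.var rN * .var rSize)) (dpBody tr)

/-- The successor of the node `x` under the decision `s`: the next layer, with code `f s x`. -/
def nodeStep (S : ℕ) (f : ℕ → ℕ → ℕ) (s x : ℕ) : ℕ := (x / S + 1) * S + f s x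

theorem lt_nodeStep {S : ℕ} (hS : 0 < S) (f : ℕ → ℕ → ℕ) (s x : ℕ) : x < nodeStep S f s x := by
  have := Nat.lt_div_mul_add hS (a := x)
  simp only [nodeStep, add_mul, one_mul]
  omega

theorem dpCmd_runs {M : ℕ} {tr : ℕ → Exp} {σ : Mem} {n S : ℕ} (f : ℕ → ℕ → ℕ)
    (hn : σ rN 0 = n) (hS : σ rSize 0 = S) (hS0 : 0 < S) (hV : σ rV 0 = 0)
    (hT : ∀ y, σ aT y = if y = 0 then 1 else 0)
    (hf : ∀ σ' : Mem, (∀ a, a ∉ [aT, rV] → σ' a = σ a) →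
      σ' rV 0 < n * S → ∀ s < 2, (tr s).eval σ' = f s (σ' rV 0))
    (hM : 2 * (n * S) + 2 ≤ 2 ^ M) :
    Runs M (dpCmd tr) σ (n * S * ((dpBody tr).cost + 9) + 9)
      (fun σ' => DPTable (n * S) (nodeStep S f) (σ' aT)) := by
  have key := Runs.loop (M := M) (e := .less (.var rV) (.var rN * .var rSize)) (c := dpBody tr)
    (σ := σ) (fun k σ' => σ' rV 0 = k ∧ DPTable k (nodeStep S f) (σ' aT)) (n * S)
    (fun _ => (dpBody tr).cost) ?_ ?_ ?_
  · refine key.weaken ?_ fun _ _ h => h.2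
    simp only [Finset.sum_const, Finset.card_range, smul_eq_mul]
    exact Nat.le_refl _
  · refine ⟨hV, ?_, fun x hx => absurd hx (Nat.not_lt_zero _), ?_⟩
    · simp [hT]
    · intro y hy h
      simp [hT, hy] at h
  · intro k hk σ' hfr ⟨h1, h2⟩
    have hfr' : ∀ a, a ∉ [aT, rV] → σ' a = σ a := by
      intro a ha
      apply hfr
      simpa [dpBody, Cmd.writes] using ha
    have hn' : σ' rN 0 = n := by rw [hfr' rN (by simp), hn]
    have hS' : σ' rSize 0 = S := by rw [hfr' rSize (by simp), hS]
    refine ⟨by simp [h1, hn', hS', hk], Runs.of_wp ?_⟩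
    have t0 : (tr 0).eval σ' = f 0 k := by rw [hf σ' hfr' (by rwa [h1]) 0 (by norm_num), h1]
    have t1 : ∀ i v, (tr 1).eval (σ'.set aT i v) = f 1 k := by
      intro i v
      have hV' : (σ'.set aT i v) rV 0 = k := by rw [Mem.set_ne _ (by norm_num), h1]
      rw [hf _ ?_ (by rwa [hV']) 1 (by norm_num), hV']
      intro a ha
      rw [Mem.set_ne _ (by rintro rfl; simp at ha)]
      exact hfr' a ha
    simp only [dpBody, wp_seq, wp_ite, wp_write, wp_assign, wp_skip, Exp.eval_read, Exp.eval_var,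
      Exp.eval_add, Exp.eval_mul, Exp.eval_div, Exp.eval_ofNat, t0, t1, h1, hS']
    refine ⟨fun hk0 => ?_, fun hk0 => ?_⟩
    · simp only [Mem.set_same, Mem.set_ne, ne_eq, Nat.reduceEqDiff, not_false_eq_true, h1, hS',
        Function.update_self]
      refine ⟨by omega, by omega, by omega, trivial, ?_⟩
      exact h2.update (lt_nodeStep hS0 f) hk0
    · simp only [Mem.set_same, Mem.set_ne, ne_eq, Nat.reduceEqDiff, not_false_eq_true,
        Function.update_self]
      exact ⟨by omega, trivial, h2.succ hk0⟩
  · intro σ' hfr ⟨h1, _⟩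
    have hfr' : ∀ a, a ∉ [aT, rV] → σ' a = σ a := by
      intro a ha
      apply hfr
      simpa [dpBody, Cmd.writes] using ha
    simp [h1, hfr' rN (by simp), hfr' rSize (by simp), hn, hS]

/-! ### Search for the best code -/

/-- The code in `rC` replaces the best one found so far, if its node in the last layer has been
reached, it satisfies `good`, and it is cheaper. `rBest` holds the best code plus `1`. -/
def scanBody (good cost : Exp) : Cmd :=
  .seq
    (.ite (.read aT (.var rN * .var rSize + .var rC) * good *
        (.same (.var rBest) 0 + .less cost (.var rVal)))
      (.seq (.assign rBest (.var rC + 1)) (.assign rVal cost))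
      .skip)
    (.assign rC (.var rC + 1))

/-- Search for the cheapest admissible code in the last layer. -/
def scanCmd (good cost : Exp) : Cmd :=
  .loop (.less (.var rC) (.var rSize)) (scanBody good cost)

/-- `b` is the successor of a minimizer of `cost` among the `c < k` that satisfy `good`, or `0` if
there is none. -/
def IsBest (good : ℕ → Prop) (cost : ℕ → ℕ) (k b : ℕ) : Prop :=
  (b = 0 ∧ ∀ c < k, ¬ good c) ∨
    ∃ c₀ < k, b = c₀ + 1 ∧ good c₀ ∧ ∀ c < k, good c → cost c₀ ≤ cost c

theorem scanCmd_runs {M : ℕ} {good cost : Exp} {σ : Mem} {n S : ℕ} (gd cst : ℕ → ℕ)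
    (hn : σ rN 0 = n) (hS : σ rSize 0 = S) (hC : σ rC 0 = 0) (hB : σ rBest 0 = 0)
    (hgd : ∀ σ' : Mem, (∀ a, a ∉ [rC, rBest, rVal] → σ' a = σ a) → good.eval σ' = gd (σ' rC 0))
    (hcst : ∀ σ' : Mem, (∀ a, a ∉ [rC, rBest, rVal] → σ' a = σ a) → cost.eval σ' = cst (σ' rC 0))
    (hM : S ≤ 2 ^ M) (hM' : ∀ c < S, cst c ≤ 2 ^ M) :
    Runs M (scanCmd good cost) σ (S * ((scanBody good cost).cost + 6) + 6)
      (fun σ' => IsBest (fun c => σ aT (n * S + c) ≠ 0 ∧ gd c ≠ 0) cst S (σ' rBest 0)) := by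
  have key := Runs.loop (M := M) (e := .less (.var rC) (.var rSize)) (c := scanBody good cost)
    (σ := σ) (fun k σ' => σ' rC 0 = k ∧
      IsBest (fun c => σ aT (n * S + c) ≠ 0 ∧ gd c ≠ 0) cst k (σ' rBest 0) ∧
      (σ' rBest 0 ≠ 0 → σ' rVal 0 = cst (σ' rBest 0 - 1))) S
    (fun _ => (scanBody good cost).cost) ?_ ?_ ?_
  · refine key.weaken ?_ fun _ _ h => h.2.1
    simp only [Finset.sum_const, Finset.card_range, smul_eq_mul]
    exact Nat.le_refl _
  · exact ⟨hC, Or.inl ⟨hB, fun c hc => absurd hc (Nat.not_lt_zero _)⟩, fun h => absurd hB h⟩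
  · intro k hk σ' hfr ⟨h1, h2, h3⟩
    have hfr' : ∀ a, a ∉ [rC, rBest, rVal] → σ' a = σ a := by
      intro a ha
      apply hfr
      simp only [List.mem_cons, List.not_mem_nil, or_false, not_or] at ha
      simp [scanBody, Cmd.writes, ha]
    have hn' : σ' rN 0 = n := by rw [hfr' rN (by simp), hn]
    have hS' : σ' rSize 0 = S := by rw [hfr' rSize (by simp), hS]
    have hT' : σ' aT = σ aT := hfr' aT (by simp)
    refine ⟨by simp [h1, hS', hk], Runs.of_wp ?_⟩
    have t0 : good.eval σ' = gd k := by rw [hgd σ' hfr', h1]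
    have t1 : cost.eval σ' = cst k := by rw [hcst σ' hfr', h1]
    have t2 : ∀ i v, cost.eval (σ'.set rBest i v) = cst k := by
      intro i v
      rw [hcst, Mem.set_ne _ (by norm_num), h1]
      intro a ha
      rw [Mem.set_ne _ (by rintro rfl; simp at ha)]
      exact hfr' a ha
    simp only [scanBody, wp_seq, wp_ite, wp_assign, wp_skip, Exp.eval_read, Exp.eval_var,
      Exp.eval_add, Exp.eval_mul, Exp.eval_same, Exp.eval_less, Exp.eval_ofNat, t0, t1, t2, h1,
      hS', hn', hT', Mem.set_same, Mem.set_ne, ne_eq, Nat.reduceEqDiff, not_false_eq_true,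
      Function.update_self]
    refine ⟨fun hk0 => ?_, fun hk0 => ?_⟩
    · refine ⟨by omega, hM' k hk, by omega, trivial, ?_, fun _ => rfl⟩
      simp only [mul_eq_zero, not_or] at hk0
      obtain ⟨⟨hk1, hk2⟩, hk3⟩ := hk0
      refine Or.inr ⟨k, by omega, rfl, ⟨hk1, hk2⟩, fun c hc hgc => ?_⟩
      rcases Nat.lt_succ_iff_lt_or_eq.1 hc with hc | rfl
      · rcases h2 with ⟨_, h2⟩ | ⟨c₀, _, hb, _, h2⟩
        · exact absurd hgc (h2 c hc)
        · have h4 := h3 (by omega)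
          simp only [hb] at hk3
          rw [hb, Nat.add_sub_cancel] at h4
          have h5 : cst k < σ' rVal 0 := by
            by_contra h
            simp [h] at hk3
          exact (h5.trans_eq h4).le.trans (h2 c hc hgc)
      · exact le_rfl
    · refine ⟨by omega, trivial, ?_, h3⟩
      rcases h2 with ⟨hb, h2⟩ | ⟨c₀, hc₀, hb, hg₀, h2⟩
      · refine Or.inl ⟨hb, fun c hc hgc => ?_⟩
        rcases Nat.lt_succ_iff_lt_or_eq.1 hc with hc | rfl
        · exact h2 c hc hgc
        · simp [hb, hgc.1, hgc.2] at hk0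
      · refine Or.inr ⟨c₀, by omega, hb, hg₀, fun c hc hgc => ?_⟩
        rcases Nat.lt_succ_iff_lt_or_eq.1 hc with hc | rfl
        · exact h2 c hc hgc
        · have h4 := h3 (by omega)
          rw [hb, Nat.add_sub_cancel] at h4
          simpa [hb, hgc.1, hgc.2, h4] using hk0
  · intro σ' hfr ⟨h1, _⟩
    have hS' : σ' rSize = σ rSize := by
      apply hfr
      simp [scanBody, Cmd.writes]
    simp [h1, hS', hS]

/-! ### Traceback -/

/-- One step back from the node in `rY`, recording the decision that led to it. -/
def traceBody : Cmd :=
  .seq (.assign rI (.var rI - 1))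
    (.seq (.write 1 (.var rI) ((.read aT (.var rY) - 1) % 2))
      (.assign rY ((.read aT (.var rY) - 1) / 2)))

/-- Recovery of the decisions that lead to the node in `rY`. -/
def traceCmd : Cmd := .loop (.var rI) traceBody

theorem traceCmd_runs {M : ℕ} {σ : Mem} {n : ℕ} (hI : σ rI 0 = n) (hM : n ≤ 2 ^ M) :
    Runs M traceCmd σ (n * (traceBody.cost + 3) + 3)
      (fun σ' => ∀ j < n, σ' 1 (n - 1 - j) =
        (σ aT ((fun y => (σ aT y - 1) / 2)^[j] (σ rY 0)) - 1) % 2) := by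
  have key := Runs.loop (M := M) (e := .var rI) (c := traceBody)
    (σ := σ) (fun k σ' => σ' rI 0 = n - k ∧ σ' rY 0 = (fun y => (σ aT y - 1) / 2)^[k] (σ rY 0) ∧
      ∀ j < k, σ' 1 (n - 1 - j) =
        (σ aT ((fun y => (σ aT y - 1) / 2)^[j] (σ rY 0)) - 1) % 2) n
    (fun _ => traceBody.cost) ?_ ?_ ?_
  · refine key.weaken ?_ fun _ _ h => h.2.2
    simp only [Finset.sum_const, Finset.card_range, smul_eq_mul]
    exact Nat.le_refl _
  · exact ⟨hI, rfl, fun c hc => absurd hc (Nat.not_lt_zero _)⟩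
  · intro k hk σ' hfr ⟨h1, h2, h3⟩
    have hT' : σ' aT = σ aT := hfr aT (by simp [traceBody, Cmd.writes])
    refine ⟨by rw [Exp.eval_var]; omega, Runs.of_wp_of_bdd fun hB => ?_⟩
    have hB' := hB aT (σ' rY 0)
    rw [hT', h2] at hB'
    simp only [traceBody, wp_seq, wp_write, wp_assign, Exp.eval_read, Exp.eval_var,
      Exp.eval_sub, Exp.eval_div, Exp.eval_mod, Exp.eval_ofNat, h1,
      h2, hT', Mem.set_same, Mem.set_ne, ne_eq, Nat.reduceEqDiff, not_false_eq_true,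
      Function.update_self, OfNat.one_ne_ofNat,
      OfNat.ofNat_ne_one]
    refine ⟨by omega, by omega, by omega, by omega, ?_, fun j hj => ?_⟩
    · rw [Function.iterate_succ_apply']
    · rw [Function.update_apply]
      rcases Nat.lt_succ_iff_lt_or_eq.1 hj with hj | rfl
      · rw [if_neg (by omega), h3 j hj]
      · rw [if_pos (by omega)]
  · intro σ' hfr ⟨h1, _⟩
    simp [h1]

/-! ### Tables of powers -/

/-- The next entry of the tables of powers of `m` and `m + 1`. -/
def tableBody : Cmd :=
  .seq (.write aG (.var rK + 1) (.read aG (.var rK) * .var rM))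
    (.seq (.write aH (.var rK + 1) (.read aH (.var rK) * (.var rM + 1)))
      (.assign rK (.var rK + 1)))

/-- Tables of the powers of `m` and `m + 1` with exponents up to the sum of all weights. The entry
of `aG` just above remains `0`, which makes it the value of an impossible product. -/
def tableCmd : Cmd := .loop (.less (.var rK) (.var rSum)) tableBody

theorem tableCmd_runs {M : ℕ} {σ : Mem} {m W : ℕ} (hm : σ rM 0 = m) (hW : σ rSum 0 = W)
    (hK : σ rK 0 = 0) (hG : ∀ s, σ aG s = if s = 0 then 1 else 0)
    (hH : ∀ s, σ aH s = if s = 0 then 1 else 0)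
    (hM : (m + 1) ^ W ≤ 2 ^ M) (hM' : W ≤ 2 ^ M) :
    Runs M tableCmd σ (W * (tableBody.cost + 6) + 6)
      (fun σ' => (∀ s, σ' aG s = if s ≤ W then m ^ s else 0) ∧
        ∀ s, σ' aH s = if s ≤ W then (m + 1) ^ s else 0) := by
  have key := Runs.loop (M := M) (e := .less (.var rK) (.var rSum)) (c := tableBody)
    (σ := σ) (fun k σ' => σ' rK 0 = k ∧ (∀ s, σ' aG s = if s ≤ k then m ^ s else 0) ∧
        ∀ s, σ' aH s = if s ≤ k then (m + 1) ^ s else 0) W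
    (fun _ => tableBody.cost) ?_ ?_ ?_
  · refine key.weaken ?_ fun _ _ h => h.2
    simp only [Finset.sum_const, Finset.card_range, smul_eq_mul]
    exact Nat.le_refl _
  · refine ⟨hK, fun s => ?_, fun s => ?_⟩
    · rw [hG]; rcases s with _ | s <;> simp
    · rw [hH]; rcases s with _ | s <;> simp
  · intro k hk σ' hfr ⟨h1, h2, h3⟩
    have hm' : σ' rM 0 = m := by rw [hfr rM (by simp [tableBody, Cmd.writes]), hm]
    have hW' : σ' rSum 0 = W := by rw [hfr rSum (by simp [tableBody, Cmd.writes]), hW]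
    refine ⟨by simp [h1, hW', hk], Runs.of_wp ?_⟩
    have b1 : (m + 1) ^ (k + 1) ≤ 2 ^ M := (Nat.pow_le_pow_right (by omega) hk).trans hM
    have b2 : m ^ (k + 1) ≤ 2 ^ M := (Nat.pow_le_pow_left (by omega) _).trans b1
    simp only [tableBody, wp_seq, wp_write, wp_assign, Exp.eval_read, Exp.eval_var,
      Exp.eval_add, Exp.eval_mul, Exp.eval_ofNat, h1, h2, h3, hm', le_refl, if_true,
      Mem.set_same, Mem.set_ne, ne_eq, Nat.reduceEqDiff, not_false_eq_true,
      Function.update_self, ← pow_succ]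
    refine ⟨b2, b1, by omega, trivial, fun s => ?_, fun s => ?_⟩
    · rw [Function.update_apply]
      split_ifs with e1 e2 e2
      · rw [e1]
      · omega
      · rw [h2, if_pos (by omega)]
      · rw [h2, if_neg (by omega)]
    · rw [Function.update_apply]
      split_ifs with e1 e2 e2
      · rw [e1]
      · omega
      · rw [h3, if_pos (by omega)]
      · rw [h3, if_neg (by omega)]
  · intro σ' hfr ⟨h1, _⟩
    simp [h1, hfr rSum (by simp [tableBody, Cmd.writes]), hW]

/-! ### Rounded logarithms -/

/-- The largest `w` with `num / den ≤ (m / (m + 1)) ^ w`, written so that the junk value for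
`num = 0` is `0` and agrees with what the search loop computes. -/
noncomputable def weight (m num den : ℕ) : ℕ :=
  sInf {w | ¬ (num * (m + 1) ^ (w + 1) ≠ 0 ∧ num * (m + 1) ^ (w + 1) ≤ den * m ^ (w + 1))}

/-- Bernoulli's inequality, in the form `2 ^ k ≤ (1 + 1 / m) ^ (m k)`. -/
theorem two_pow_mul_pow_le {m : ℕ} (hm : 0 < m) (k : ℕ) :
    2 ^ k * m ^ (m * k) ≤ (m + 1) ^ (m * k) := by
  have h : 2 * m ^ m ≤ (m + 1) ^ m := by
    obtain ⟨m, rfl⟩ := Nat.exists_eq_add_of_le' hm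
    have := pow_add_mul_le_add_pow (a := m + 1) (b := 1) (by simp) (by simp) (m + 1)
    rw [Nat.add_sub_cancel, mul_one] at this
    calc 2 * (m + 1) ^ (m + 1) = (m + 1) ^ (m + 1) + (m + 1) * (m + 1) ^ m := by ring
      _ ≤ _ := by simpa using this
  calc 2 ^ k * m ^ (m * k) = (2 * m ^ m) ^ k := by rw [mul_pow, pow_mul]
    _ ≤ ((m + 1) ^ m) ^ k := Nat.pow_le_pow_left h k
    _ = _ := by rw [pow_mul]

/-- The search for the weight stops after at most `m` steps for each digit of the denominator. -/
theorem weight_aux {m : ℕ} (hm : 0 < m) (num den : ℕ) :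
    ¬ (num * (m + 1) ^ (m * den.size + 1) ≠ 0 ∧
      num * (m + 1) ^ (m * den.size + 1) ≤ den * m ^ (m * den.size + 1)) := by
  rintro ⟨h0, h⟩
  have h1 : 1 ≤ num := Nat.one_le_iff_ne_zero.2 fun h => by simp [h] at h0
  have h2 : den < 2 ^ den.size := Nat.lt_size_self den
  have h3 := two_pow_mul_pow_le hm den.size
  have h4 : 0 < m ^ (m * den.size) := by positivity
  have : den * m ^ (m * den.size + 1) < num * (m + 1) ^ (m * den.size + 1) :=
    calc den * m ^ (m * den.size + 1) = (den * m ^ (m * den.size)) * m := by ring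
      _ ≤ (2 ^ den.size * m ^ (m * den.size)) * m := by gcongr
      _ ≤ (m + 1) ^ (m * den.size) * m := by gcongr
      _ < (m + 1) ^ (m * den.size) * (m + 1) := by
        apply Nat.mul_lt_mul_of_pos_left <;> [skip; positivity]
        exact Nat.lt_succ_self m
      _ = 1 * (m + 1) ^ (m * den.size + 1) := by ring
      _ ≤ _ := by gcongr
  omega

theorem weight_le {m : ℕ} (hm : 0 < m) (num den : ℕ) : weight m num den ≤ m * den.size :=
  Nat.sInf_le (weight_aux hm num den)

theorem weight_not {m : ℕ} (hm : 0 < m) (num den : ℕ) :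
    ¬ (num * (m + 1) ^ (weight m num den + 1) ≠ 0 ∧
      num * (m + 1) ^ (weight m num den + 1) ≤ den * m ^ (weight m num den + 1)) :=
  Nat.sInf_mem (s := {w | ¬ (num * (m + 1) ^ (w + 1) ≠ 0 ∧
    num * (m + 1) ^ (w + 1) ≤ den * m ^ (w + 1))}) ⟨_, weight_aux hm num den⟩

theorem of_lt_weight {m num den k : ℕ} (h : k < weight m num den) :
    num * (m + 1) ^ (k + 1) ≠ 0 ∧ num * (m + 1) ^ (k + 1) ≤ den * m ^ (k + 1) := by
  have := Nat.notMem_of_lt_sInf h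
  simpa only [Set.mem_ofPred_eq, not_not] using this

/-- One step of the search for a weight. -/
def searchBody : Cmd :=
  .seq (.assign rA (.var rA * (.var rM + 1)))
    (.seq (.assign rB (.var rB * .var rM)) (.assign rW (.var rW + 1)))

/-- Preparation of the search for the weight number `rX`. -/
def weightPre (num den : Exp) : Cmd :=
  .seq (.write aNum (.var rX) num)
    (.seq (.assign rA (.read aNum (.var rX) * (.var rM + 1)))
      (.seq (.assign rB (den * .var rM)) (.assign rW 0)))

/-- Search for a weight. The factor `rA` in the condition stops the search if the numerator is `0`.
-/
def searchCmd : Cmd := .loop (.less (.var rA) (.var rB + 1) * .var rA) searchBody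

/-- The weight found is stored and added to the sum of all weights. -/
def weightPost : Cmd :=
  .seq (.write aWt (.var rX) (.var rW))
    (.seq (.assign rSum (.var rSum + .var rW)) (.assign rX (.var rX + 1)))

/-- Computation of the weight number `rX`. -/
def weightBody (num den : Exp) : Cmd :=
  .seq (weightPre num den) (.seq searchCmd weightPost)

/-- Computation of the weights of the `2 n D` input probabilities. -/
def weightCmd (D : ℕ) (num den : Exp) : Cmd :=
  .loop (.less (.var rX) (.var rN * .lit (2 * D))) (weightBody num den)

theorem searchCmd_runs {M : ℕ} {σ : Mem} {m num den w : ℕ} (hm : σ rM 0 = m)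
    (hw : weight m num den = w)
    (hA : σ rA 0 = num * (m + 1)) (hB : σ rB 0 = den * m) (hW : σ rW 0 = 0)
    (hM₁ : num * (m + 1) ^ (w + 1) ≤ 2 ^ M) (hM₂ : den * m ^ (w + 1) ≤ 2 ^ M)
    (hM₃ : w ≤ 2 ^ M) (hm0 : 0 < m) :
    Runs M searchCmd σ (w * (searchBody.cost + 11) + 11) (fun σ' => σ' rW 0 = w) := by
  have key := Runs.loop (M := M) (e := .less (.var rA) (.var rB + 1) * .var rA) (c := searchBody)
    (σ := σ) (fun k σ' => σ' rW 0 = k ∧ σ' rA 0 = num * (m + 1) ^ (k + 1) ∧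
      σ' rB 0 = den * m ^ (k + 1)) w (fun _ => searchBody.cost) ?_ ?_ ?_
  · refine key.weaken ?_ fun _ _ h => h.1
    simp only [Finset.sum_const, Finset.card_range, smul_eq_mul]
    exact Nat.le_refl _
  · exact ⟨hW, by simpa using hA, by simpa using hB⟩
  · intro k hk σ' hfr ⟨h1, h2, h3⟩
    have hm' : σ' rM 0 = m := by rw [hfr rM (by simp [searchBody, Cmd.writes]), hm]
    have hcond := of_lt_weight (hw ▸ hk)
    refine ⟨?_, Runs.of_wp ?_⟩
    · simp only [Exp.eval_mul, Exp.eval_less, Exp.eval_add, Exp.eval_var, Exp.eval_ofNat, h2, h3]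
      rw [if_pos (by omega), one_mul]
      exact hcond.1
    · have b1 : num * (m + 1) ^ (k + 1) * (m + 1) ≤ 2 ^ M := by
        rw [mul_assoc, ← pow_succ]
        exact (Nat.mul_le_mul_left _ (Nat.pow_le_pow_right (by omega) (by omega))).trans hM₁
      have b2 : den * m ^ (k + 1) * m ≤ 2 ^ M := by
        rw [mul_assoc, ← pow_succ]
        exact (Nat.mul_le_mul_left _ (Nat.pow_le_pow_right hm0 (by omega))).trans hM₂
      simp only [searchBody, wp_seq, wp_assign, Exp.eval_var,
        Exp.eval_add, Exp.eval_mul, Exp.eval_ofNat, h1, h2, h3, hm',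
        Mem.set_same, Mem.set_ne, ne_eq, Nat.reduceEqDiff, not_false_eq_true,
        Function.update_self]
      refine ⟨b1, b2, by omega, trivial, by ring, by ring⟩
  · intro σ' hfr ⟨h1, h2, h3⟩
    have hcond := weight_not hm0 num den
    rw [hw, not_and] at hcond
    simp only [Exp.eval_mul, Exp.eval_less, Exp.eval_add, Exp.eval_var, Exp.eval_ofNat, h2, h3]
    by_cases h : num * (m + 1) ^ (w + 1) = 0
    · rw [h, mul_zero]
    · have := hcond h
      rw [if_neg (by omega), zero_mul]

theorem weightCmd_runs {M D : ℕ} {numE denE : Exp} {σ : Mem} {n m : ℕ} (num den : ℕ → ℕ)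
    (hn : σ rN 0 = n) (hm : σ rM 0 = m) (hm0 : 0 < m)
    (hX : σ rX 0 = 0) (hS : σ rSum 0 = 0)
    (hnum : ∀ σ' : Mem, (∀ a, a ∉ [rX, rA, rB, rW, aNum, aWt, rSum] → σ' a = σ a) →
      σ' rX 0 < 2 * n * D → numE.eval σ' = num (σ' rX 0))
    (hden : ∀ σ' : Mem, (∀ a, a ∉ [rX, rA, rB, rW, aNum, aWt, rSum] → σ' a = σ a) →
      σ' rX 0 < 2 * n * D → denE.eval σ' = den (σ' rX 0))
    (hM₁ : ∀ x < 2 * n * D, num x * (m + 1) ^ (weight m (num x) (den x) + 1) ≤ 2 ^ M)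
    (hM₂ : ∀ x < 2 * n * D, den x * m ^ (weight m (num x) (den x) + 1) ≤ 2 ^ M)
    (hM₃ : ∑ x ∈ Finset.range (2 * n * D), weight m (num x) (den x) ≤ 2 ^ M)
    (hM₄ : 2 * n * D ≤ 2 ^ M) :
    Runs M (weightCmd D numE denE) σ
      (2 * n * D * ((weightPre numE denE).cost + weightPost.cost + 19) +
        (∑ x ∈ Finset.range (2 * n * D), weight m (num x) (den x)) * (searchBody.cost + 11) + 8)
      (fun σ' => (∀ x < 2 * n * D, σ' aNum x = num x) ∧
        (∀ x < 2 * n * D, σ' aWt x = weight m (num x) (den x)) ∧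
        σ' rSum 0 = ∑ x ∈ Finset.range (2 * n * D), weight m (num x) (den x)) := by
  have hwr : ∀ a, a ∉ [rX, rA, rB, rW, aNum, aWt, rSum] → a ∉ (weightBody numE denE).writes := by
    intro a ha
    simp only [List.mem_cons, List.not_mem_nil, or_false, not_or] at ha
    simp [weightBody, weightPre, weightPost, searchCmd, searchBody, Cmd.writes, ha]
  set wt : ℕ → ℕ := fun x => weight m (num x) (den x) with hwt
  -- The total time of the inner loops is proportional to the sum of the weights.
  have key := Runs.loop (M := M) (e := .less (.var rX) (.var rN * .lit (2 * D)))
    (c := weightBody numE denE) (σ := σ) (fun k σ' => σ' rX 0 = k ∧ (∀ x < k, σ' aNum x = num x) ∧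
        (∀ x < k, σ' aWt x = wt x) ∧ σ' rSum 0 = ∑ x ∈ Finset.range k, wt x) (2 * n * D)
    (fun k => (weightPre numE denE).cost +
      ((wt k * (searchBody.cost + 11) + 11) + weightPost.cost)) ?_ ?_ ?_
  · refine key.weaken ?_ fun _ _ h => h.2
    simp only [Finset.sum_add_distrib, Finset.sum_const, Finset.card_range, smul_eq_mul,
      ← Finset.sum_mul]
    have e : (Exp.less (.var rX) (.var rN * .lit (2 * D))).steps = 7 := rfl
    rw [e]
    exact le_of_eq (by ring)
  · exact ⟨hX, fun x hx => absurd hx (Nat.not_lt_zero _), fun x hx => absurd hx (Nat.not_lt_zero _),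
      hS⟩
  · intro k hk σ' hfr ⟨h1, h2, h3, h4⟩
    have hfr' : ∀ a, a ∉ [rX, rA, rB, rW, aNum, aWt, rSum] → σ' a = σ a :=
      fun a ha => hfr a (hwr a ha)
    have hm' : σ' rM 0 = m := by rw [hfr' rM (by simp), hm]
    have hn' : σ' rN 0 = n := by rw [hfr' rN (by simp), hn]
    have hwk : wt k ≤ 2 ^ M :=
      (Finset.single_le_sum (fun _ _ => Nat.zero_le _) (Finset.mem_range.2 hk)).trans hM₃
    have hwk' : num k ≤ num k * (m + 1) ^ (wt k) := Nat.le_mul_of_pos_right _ (by positivity)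
    have hwk2 : num k * (m + 1) ≤ num k * (m + 1) ^ (wt k + 1) := by
      rw [pow_succ']
      exact Nat.mul_le_mul_left _ (Nat.le_mul_of_pos_right _ (by positivity))
    have hwk3 : den k * m ≤ den k * m ^ (wt k + 1) := by
      rw [pow_succ']
      exact Nat.mul_le_mul_left _ (Nat.le_mul_of_pos_right _ (by positivity))
    refine ⟨?_, ?_⟩
    · simp only [Exp.eval_less, Exp.eval_var, Exp.eval_mul, Exp.eval_lit, h1, hn']
      rw [if_pos (by linarith)]
      exact one_ne_zero
    refine Runs.seq (P := fun σ₁ => σ₁ rX 0 = k ∧ (∀ x < k + 1, σ₁ aNum x = num x) ∧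
        (∀ x < k, σ₁ aWt x = wt x) ∧ σ₁ rSum 0 = ∑ x ∈ Finset.range k, wt x ∧
        σ₁ rA 0 = num k * (m + 1) ∧ σ₁ rB 0 = den k * m ∧ σ₁ rW 0 = 0 ∧ σ₁ rM 0 = m)
      (Runs.of_wp ?_) ?_
    · have t0 : numE.eval σ' = num k := by rw [hnum σ' hfr' (by rwa [h1]), h1]
      have t1 : ∀ i v i' v', denE.eval ((σ'.set aNum i v).set rA i' v') = den k := by
        intro i v i' v'
        have hr : ((σ'.set aNum i v).set rA i' v') rX 0 = k := by
          rw [Mem.set_ne _ (by norm_num), Mem.set_ne _ (by norm_num), h1]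
        rw [hden _ _ (by rwa [hr]), hr]
        intro a ha
        rw [Mem.set_ne _ (by rintro rfl; simp at ha), Mem.set_ne _ (by rintro rfl; simp at ha)]
        exact hfr' a ha
      simp only [weightPre, wp_seq, wp_assign, wp_write, Exp.eval_var, Exp.eval_read,
        Exp.eval_add, Exp.eval_mul, Exp.eval_ofNat, h1, h4, hm', t0, t1,
        Mem.set_same, Mem.set_ne, ne_eq, Nat.reduceEqDiff, not_false_eq_true,
        Function.update_self]
      refine ⟨by nlinarith [hM₁ k hk], by linarith [hM₁ k hk], by linarith [hM₂ k hk],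
        Nat.zero_le _, trivial, fun x hx => ?_, h3, trivial, trivial, trivial, trivial, trivial⟩
      rw [Function.update_apply]
      split_ifs with e
      · rw [e]
      · exact h2 x (by omega)
    · rintro σ₁ _ ⟨p1, p2, p3, p4, p5, p6, p7, p8⟩
      refine Runs.seq (searchCmd_runs (w := wt k) p8 rfl p5 p6 p7 (hM₁ k hk) (hM₂ k hk)
        hwk hm0) ?_
      intro σ₂ hfr₂ q
      have hfr₂' : ∀ a, a ∉ [rA, rB, rW] → σ₂ a = σ₁ a := by
        intro a ha
        apply hfr₂
        simpa [searchCmd, searchBody, Cmd.writes] using ha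
      refine Runs.of_wp ?_
      have hsum : ∑ x ∈ Finset.range (k + 1), wt x ≤ 2 ^ M :=
        (Finset.sum_le_sum_of_subset (Finset.range_mono hk)).trans hM₃
      rw [Finset.sum_range_succ] at hsum
      simp only [weightPost, wp_seq, wp_assign, wp_write, Exp.eval_var,
        Exp.eval_add, Exp.eval_ofNat, p1, p4, q, hfr₂' rX (by simp), hfr₂' rSum (by simp),
        hfr₂' aNum (by simp), hfr₂' aWt (by simp),
        Mem.set_same, Mem.set_ne, ne_eq, Nat.reduceEqDiff, not_false_eq_true,
        Function.update_self]
      refine ⟨hwk, hsum, by omega, trivial, p2, fun x hx => ?_, ?_⟩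
      · rw [Function.update_apply]
        split_ifs with e
        · rw [e]
        · exact p3 x (by omega)
      · rw [Finset.sum_range_succ]
  · intro σ' hfr ⟨h1, _⟩
    have hn' : σ' rN 0 = n := by rw [hfr rN (hwr _ (by simp)), hn]
    simp only [Exp.eval_less, Exp.eval_var, Exp.eval_mul, Exp.eval_lit, h1, hn']
    rw [if_neg (by linarith)]

/-! ### Digits -/

/-- The `j`-th digit of `c` in base `B`. -/
def digit (B c j : ℕ) : ℕ := c / B ^ j % B

/-- The number with the `D` digits `f 0, …, f (D - 1)` in base `B`, least significant first. -/
def ofDigits (B D : ℕ) (f : ℕ → ℕ) : ℕ := ∑ j ∈ Finset.range D, f j * B ^ j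

theorem ofDigits_lt {B : ℕ} (f : ℕ → ℕ) (hf : ∀ j, f j < B) (D : ℕ) : ofDigits B D f < B ^ D := by
  induction D with
  | zero => simp [ofDigits]
  | succ D ih =>
    rw [ofDigits, Finset.sum_range_succ, ← ofDigits]
    calc ofDigits B D f + f D * B ^ D < B ^ D + f D * B ^ D := by omega
      _ = (f D + 1) * B ^ D := by ring
      _ ≤ B * B ^ D := Nat.mul_le_mul_right _ (hf D)
      _ = B ^ (D + 1) := by ring

theorem digit_ofDigits {B : ℕ} (f : ℕ → ℕ) (hf : ∀ j, f j < B) {D j : ℕ} (hj : j < D) :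
    digit B (ofDigits B D f) j = f j := by
  have hB : 0 < B := (Nat.zero_le _).trans_lt (hf 0)
  induction D with
  | zero => omega
  | succ D ih =>
    rw [ofDigits, Finset.sum_range_succ, ← ofDigits, digit]
    rcases Nat.lt_succ_iff_lt_or_eq.1 hj with hj | rfl
    · obtain ⟨k, rfl⟩ := Nat.exists_eq_add_of_lt hj
      have : f (j + k + 1) * B ^ (j + k + 1) = B ^ j * (B * (f (j + k + 1) * B ^ k)) := by ring
      rw [this, Nat.add_mul_div_left _ _ (by positivity), Nat.add_mul_mod_self_left]
      exact ih hj
    · rw [Nat.add_mul_div_right _ _ (by positivity), Nat.div_eq_of_lt (ofDigits_lt f hf j),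
        zero_add, Nat.mod_eq_of_lt (hf j)]

/-! ### The data of the dynamic program -/

/-- The numbers handled by the dynamic program. There are `n` decisions between `0` and `1`, and `D`
products; the decision `s` in place `i` contributes the factor `num x / den x` to the product number
`j`, where `x = (2 i + s) D + j`. It also adds `inc s` to a counter, which must end up at `tgt` and
is cut off at `cap`. The products have the integer coefficients `coef j` in the objective. -/
structure Data where
  (n D m cap tgt : ℕ)
  (num den inc coef : ℕ → ℕ)

namespace Data

variable (I : Data)

/-- The rounded logarithm of the factor `x`, to the base `m / (m + 1)`. -/
noncomputable def wt (x : ℕ) : ℕ := weight I.m (I.num x) (I.den x)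

/-- The sum of all weights: an upper bound for every exponent that belongs to a nonzero product. -/
noncomputable def W : ℕ := ∑ x ∈ Finset.range (2 * I.n * I.D), I.wt x

/-- The number of codes. The exponents range up to `W + 1`, the last value meaning a zero product.
-/
noncomputable def S : ℕ := (I.cap + 1) * (I.W + 2) ^ I.D

/-- The weight of a factor in the saturating addition of exponents: a zero factor leads beyond `W`.
-/
noncomputable def wz (x : ℕ) : ℕ := I.wt x + (if I.num x = 0 then 1 else 0) * (I.W + 2)

/-- The exponent number `j` of a code. -/
noncomputable def dig (c j : ℕ) : ℕ := digit (I.W + 2) (c / (I.cap + 1)) j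

/-- The code reached from the node `y` by the decision `s`. -/
noncomputable def trans (s y : ℕ) : ℕ :=
  min (y % I.S % (I.cap + 1) + I.inc s) I.cap + (I.cap + 1) *
    ofDigits (I.W + 2) I.D
      (fun j => min (I.dig (y % I.S) j + I.wz ((2 * (y / I.S) + s) * I.D + j)) (I.W + 1))

/-- The counter after the first `i` decisions of `χ`, cut off at `cap`. -/
def count (χ : ℕ → ℕ) (i : ℕ) : ℕ := min (∑ k ∈ Finset.range i, I.inc (χ k)) I.cap

/-- The exponent of the rounded product number `j` after the first `i` decisions of `χ`. -/
noncomputable def expo (χ : ℕ → ℕ) (i j : ℕ) : ℕ :=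
  min (∑ k ∈ Finset.range i, I.wz ((2 * k + χ k) * I.D + j)) (I.W + 1)

/-- The code of the counter and the exponents after the first `i` decisions of `χ`. -/
noncomputable def code (χ : ℕ → ℕ) (i : ℕ) : ℕ :=
  I.count χ i + (I.cap + 1) * ofDigits (I.W + 2) I.D (I.expo χ i)

/-- The table of powers of `m`; the entry `0` for `s = W + 1` represents a zero product. -/
noncomputable def gpow (s : ℕ) : ℕ := if s ≤ I.W then I.m ^ s else 0

/-- The table of powers of `m + 1`. -/
noncomputable def hpow (s : ℕ) : ℕ := if s ≤ I.W then (I.m + 1) ^ s else 0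

/-- The rounded cost of a code, scaled by `(m + 1) ^ W` so that it is an integer. -/
noncomputable def codeCost (c : ℕ) : ℕ :=
  ∑ j ∈ Finset.range I.D, I.coef j * (I.gpow (I.dig c j) * I.hpow (I.W - I.dig c j))

/-- The scaled rounded cost of the decisions `χ`. -/
noncomputable def selCost (χ : ℕ → ℕ) : ℕ :=
  ∑ j ∈ Finset.range I.D,
    I.coef j * (I.gpow (I.expo χ I.n j) * I.hpow (I.W - I.expo χ I.n j))

theorem S_pos : 0 < I.S := by
  have : 0 < (I.W + 2) ^ I.D := by positivity
  exact Nat.mul_pos (Nat.succ_pos _) this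

variable {I}

theorem add_mul_ofDigits_lt {a : ℕ} (ha : a ≤ I.cap) {f : ℕ → ℕ} (hf : ∀ j, f j ≤ I.W + 1) :
    a + (I.cap + 1) * ofDigits (I.W + 2) I.D f < I.S := by
  have h := ofDigits_lt f (B := I.W + 2) (fun j => Nat.lt_succ_of_le (hf j)) I.D
  calc a + (I.cap + 1) * ofDigits (I.W + 2) I.D f
      < (I.cap + 1) + (I.cap + 1) * ofDigits (I.W + 2) I.D f := by omega
    _ = (I.cap + 1) * (ofDigits (I.W + 2) I.D f + 1) := by ring
    _ ≤ _ := Nat.mul_le_mul_left _ h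

theorem dig_add_mul_ofDigits {a : ℕ} (ha : a ≤ I.cap) {f : ℕ → ℕ} (hf : ∀ j, f j ≤ I.W + 1)
    {j : ℕ} (hj : j < I.D) :
    I.dig (a + (I.cap + 1) * ofDigits (I.W + 2) I.D f) j = f j := by
  rw [dig, Nat.add_mul_div_left _ _ (Nat.succ_pos _), Nat.div_eq_of_lt (Nat.lt_succ_of_le ha),
    zero_add]
  exact digit_ofDigits f (fun j => Nat.lt_succ_of_le (hf j)) hj

theorem trans_lt (s y : ℕ) : I.trans s y < I.S :=
  add_mul_ofDigits_lt (min_le_right _ _) fun _ => min_le_right _ _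

theorem code_lt (χ : ℕ → ℕ) (i : ℕ) : I.code χ i < I.S :=
  add_mul_ofDigits_lt (min_le_right _ _) fun _ => min_le_right _ _

theorem dig_code (χ : ℕ → ℕ) (i : ℕ) {j : ℕ} (hj : j < I.D) :
    I.dig (I.code χ i) j = I.expo χ i j :=
  dig_add_mul_ofDigits (min_le_right _ _) (fun _ => min_le_right _ _) hj

theorem code_mod (χ : ℕ → ℕ) (i : ℕ) : I.code χ i % (I.cap + 1) = I.count χ i := by
  rw [code, Nat.add_mul_mod_self_left, Nat.mod_eq_of_lt]
  exact Nat.lt_succ_of_le (min_le_right _ _)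

theorem codeCost_code (χ : ℕ → ℕ) : I.codeCost (I.code χ I.n) = I.selCost χ := by
  refine Finset.sum_congr rfl fun j hj => ?_
  rw [dig_code χ I.n (Finset.mem_range.1 hj)]

/-- The saturating additions performed along a path amount to a single cut-off at the end. -/
theorem nodeStep_code (χ : ℕ → ℕ) (i : ℕ) :
    nodeStep I.S I.trans (χ i) (i * I.S + I.code χ i) = (i + 1) * I.S + I.code χ (i + 1) := by
  have h := I.code_lt χ i
  have h1 : (i * I.S + I.code χ i) / I.S = i := by
    rw [mul_comm, Nat.mul_add_div I.S_pos, Nat.div_eq_of_lt h, add_zero]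
  have h2 : (i * I.S + I.code χ i) % I.S = I.code χ i := by
    rw [mul_comm, Nat.mul_add_mod, Nat.mod_eq_of_lt h]
  rw [nodeStep, h1]
  congr 1
  rw [trans, h1, h2, code_mod, code]
  have e1 : min (I.count χ i + I.inc (χ i)) I.cap = I.count χ (i + 1) := by
    simp only [count]
    rw [Finset.sum_range_succ]
    omega
  rw [e1]
  congr 2
  refine Finset.sum_congr rfl fun j hj => ?_
  beta_reduce
  rw [← code, dig_code χ i (Finset.mem_range.1 hj)]
  congr 1
  simp only [expo]
  rw [Finset.sum_range_succ]
  omega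

theorem code_zero (χ : ℕ → ℕ) : I.code χ 0 = 0 := by
  simp [code, count, expo, ofDigits]

/-- Every sequence of decisions is represented in the table. -/
theorem reach {T : ℕ → ℕ} (hT : DPTable (I.n * I.S) (nodeStep I.S I.trans) T) {χ : ℕ → ℕ}
    (hχ : ∀ i, χ i < 2) {i : ℕ} (hi : i ≤ I.n) : T (i * I.S + I.code χ i) ≠ 0 := by
  induction i with
  | zero => simpa [code_zero] using hT.zero
  | succ i ih =>
    rw [← nodeStep_code]
    refine hT.step _ ?_ (ih (by omega)) _ (hχ i)
    calc i * I.S + I.code χ i < i * I.S + I.S := Nat.add_lt_add_left (code_lt χ i) _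
      _ = (i + 1) * I.S := by ring
      _ ≤ _ := Nat.mul_le_mul_right _ hi

theorem nodeStep_div (s x : ℕ) : nodeStep I.S I.trans s x / I.S = x / I.S + 1 := by
  rw [nodeStep, mul_comm, Nat.mul_add_div I.S_pos, Nat.div_eq_of_lt (trans_lt s x), add_zero]

/-- Following the predecessors from a reached node `c` of the last layer yields decisions with code
`c`. -/
theorem traceback {T : ℕ → ℕ} (hT : DPTable (I.n * I.S) (nodeStep I.S I.trans) T) {c : ℕ}
    (hc : c < I.S) (hTc : T (I.n * I.S + c) ≠ 0) :
    I.code (fun i => (T ((fun y => (T y - 1) / 2)^[I.n - 1 - i] (I.n * I.S + c)) - 1) % 2) I.n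
      = c := by
  set walk : ℕ → ℕ := fun k => (fun y => (T y - 1) / 2)^[k] (I.n * I.S + c) with hwalk
  have hsucc : ∀ k, walk (k + 1) = (T (walk k) - 1) / 2 := fun k =>
    Function.iterate_succ_apply' _ _ _
  have h : ∀ k ≤ I.n, T (walk k) ≠ 0 ∧ walk k / I.S = I.n - k := by
    intro k
    induction k with
    | zero =>
      intro _
      refine ⟨hTc, ?_⟩
      change (I.n * I.S + c) / I.S = _
      rw [mul_comm, Nat.mul_add_div I.S_pos, Nat.div_eq_of_lt hc, add_zero, Nat.sub_zero]
    | succ k ih =>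
      intro hk
      obtain ⟨h1, h2⟩ := ih (by omega)
      have h0 : walk k ≠ 0 := by
        intro h0
        rw [h0, Nat.zero_div] at h2
        omega
      obtain ⟨p1, p2⟩ := hT.pred _ h0 h1
      rw [← hsucc] at p1 p2
      refine ⟨p1, ?_⟩
      have := congrArg (· / I.S) p2
      simp only [nodeStep_div] at this
      omega
  have hend : walk I.n = 0 := by
    by_contra h0
    obtain ⟨h1, h2⟩ := h I.n le_rfl
    have := congrArg (· / I.S) (hT.pred _ h0 h1).2
    simp only [nodeStep_div] at this
    rw [h2, Nat.sub_self] at this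
    exact absurd this (Nat.succ_ne_zero _)
  set χ : ℕ → ℕ := fun i => (T (walk (I.n - 1 - i)) - 1) % 2 with hχ
  have key : ∀ i ≤ I.n, i * I.S + I.code χ i = walk (I.n - i) := by
    intro i
    induction i with
    | zero =>
      intro _
      simp [code_zero, hend]
    | succ i ih =>
      intro hi
      obtain ⟨h1, h2⟩ := h (I.n - (i + 1)) (by omega)
      have h0 : walk (I.n - (i + 1)) ≠ 0 := by
        intro h0
        rw [h0, Nat.zero_div] at h2
        omega
      have p := (hT.pred _ h0 h1).2
      rw [← hsucc, show I.n - (i + 1) + 1 = I.n - i by omega, ← ih (by omega)] at p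
      rw [← nodeStep_code, ← p, hχ]
      simp only [show I.n - 1 - i = I.n - (i + 1) by omega]
  have := key I.n le_rfl
  rw [Nat.sub_self] at this
  exact Nat.add_left_cancel this

end Data

/-! ### The program -/

/-- The problem-dependent parts of the program: how `Data` are to be read off the input. The
expressions `num` and `den` refer to the variable `rX`. -/
structure Layout where
  (D : ℕ)
  (n num den cap tgt : Exp)
  (inc coef : ℕ → Exp)

/-- On the input `inp`, the expressions of `L` have the values `I`. -/
structure Layout.Reads (L : Layout) (I : Data) (inp : ℕ → ℕ) : Prop where
  D : L.D = I.D
  n : ∀ σ : Mem, σ 0 = inp → L.n.eval σ = I.n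
  m : I.m = 2 * I.n * (inp 1 / inp 0 + 1)
  num : ∀ σ : Mem, σ 0 = inp → σ rX 0 < 2 * I.n * I.D → L.num.eval σ = I.num (σ rX 0)
  den : ∀ σ : Mem, σ 0 = inp → σ rX 0 < 2 * I.n * I.D → L.den.eval σ = I.den (σ rX 0)
  cap : ∀ σ : Mem, σ 0 = inp → L.cap.eval σ = I.cap
  tgt : ∀ σ : Mem, σ 0 = inp → L.tgt.eval σ = I.tgt
  inc : ∀ σ : Mem, σ 0 = inp → ∀ s < 2, (L.inc s).eval σ = I.inc s
  coef : ∀ σ : Mem, σ 0 = inp → ∀ j < I.D, (L.coef j).eval σ = I.coef j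

namespace Layout

variable (L : Layout)

/-- The minimum of two numbers, by truncated subtraction. -/
def minE (x y : Exp) : Exp := x - (x - y)

@[simp] theorem eval_minE (σ : Mem) (x y : Exp) :
    (minE x y).eval σ = min (x.eval σ) (y.eval σ) := by
  simp only [minE, Exp.eval_sub]
  omega

/-- The exponent number `j` of the code `c`. -/
def digE (c : Exp) (j : ℕ) : Exp :=
  c / (L.cap + 1) / Exp.prod j (fun _ => .var rBase) % .var rBase

/-- The code reached from the node in `rV` by the decision `s`. -/
def transE (s : ℕ) : Exp :=
  minE (.var rV % .var rSize % (L.cap + 1) + L.inc s) L.cap +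
    (L.cap + 1) * Exp.sum L.D fun j =>
      minE (L.digE (.var rV % .var rSize) j +
        (.read aWt ((2 * (.var rV / .var rSize) + .lit s) * .lit L.D + .lit j) +
          .same (.read aNum ((2 * (.var rV / .var rSize) + .lit s) * .lit L.D + .lit j)) 0 *
            .var rBase)) (.var rBase - 1) *
        Exp.prod j (fun _ => .var rBase)

/-- The rounded cost of the code in `rC`. -/
def costE : Exp :=
  Exp.sum L.D fun j => L.coef j *
    (.read aG (L.digE (.var rC) j) * .read aH (.var rSum - L.digE (.var rC) j))

/-- Whether the counter in the code in `rC` has the required value. -/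
def goodE : Exp := .same (.var rC % (L.cap + 1)) L.tgt

/-- The number of decisions, and the denominator `m` of the rounding parameter:
`m = 2 n (⌊1 / ε⌋ + 1)`. -/
def initCmd : Cmd :=
  .seq (.assign rN L.n) (.assign rM (2 * .var rN * (.read 0 1 / .read 0 0 + 1)))

/-- The zeroth powers. -/
def tableInit : Cmd := .seq (.assign aG 1) (.assign aH 1)

/-- The base, the number of codes, and the root of the table. -/
def dpInit : Cmd :=
  .seq (.assign rBase (.var rSum + 2))
    (.seq (.assign rSize ((L.cap + 1) * Exp.prod L.D (fun _ => .var rBase))) (.assign aT 1))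

/-- Start of the traceback at the best code of the last layer. -/
def traceInit : Cmd :=
  .seq (.assign rY (.var rN * .var rSize + (.var rBest - 1))) (.assign rI (.var rN))

/-- The approximation scheme. -/
def program : Cmd :=
  .seq L.initCmd (.seq (weightCmd L.D L.num L.den) (.seq tableInit (.seq tableCmd (.seq L.dpInit
    (.seq (dpCmd L.transE) (.seq (scanCmd L.goodE L.costE) (.seq traceInit traceCmd)))))))

end Layout

/-- All numbers that the program writes on the data `I` are at most `2 ^ M`. -/
structure Data.Fits (I : Data) (M Z : ℕ) : Prop where
  m_pos : 0 < I.m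
  one_le : 1 ≤ Z
  num_le : ∀ x < 2 * I.n * I.D, I.num x ≤ Z
  den_le : ∀ x < 2 * I.n * I.D, I.den x ≤ Z
  coef_le : ∑ j ∈ Finset.range I.D, I.coef j ≤ Z
  pow_le : Z * ((I.m + 1) ^ (I.W + 1) * (I.m + 1) ^ (I.W + 1)) ≤ 2 ^ M
  size_le : 2 * ((I.n + 2) * I.S) + 2 ≤ 2 ^ M
  len_le : 2 * I.n * I.D ≤ 2 ^ M

theorem Data.Fits.pow_le' {I : Data} {M Z z a : ℕ} (h : I.Fits M Z) (hz : z ≤ Z)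
    (ha : a ≤ (I.m + 1) ^ (I.W + 1)) : z * a ≤ 2 ^ M := by
  refine le_trans ?_ h.pow_le
  refine Nat.mul_le_mul hz (ha.trans (Nat.le_mul_of_pos_right _ (by positivity)))

theorem Data.Fits.le_pow {I : Data} {M Z a : ℕ} (h : I.Fits M Z)
    (ha : a ≤ (I.m + 1) ^ (I.W + 1)) : a ≤ 2 ^ M := by
  simpa using h.pow_le' h.one_le ha

theorem Data.Fits.W_add_two_le {I : Data} {M Z : ℕ} (h : I.Fits M Z) : I.W + 2 ≤ 2 ^ M := by
  apply h.le_pow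
  calc I.W + 2 = I.W + 1 + 1 := rfl
    _ ≤ 2 ^ (I.W + 1) := Nat.succ_le_of_lt Nat.lt_two_pow_self
    _ ≤ _ := Nat.pow_le_pow_left (Nat.succ_le_succ h.m_pos) _

theorem Data.codeCost_le (I : Data) (c : ℕ) : I.codeCost c ≤
    (∑ j ∈ Finset.range I.D, I.coef j) * ((I.m + 1) ^ (I.W + 1) * (I.m + 1) ^ (I.W + 1)) := by
  rw [codeCost, Finset.sum_mul]
  refine Finset.sum_le_sum fun j _ => Nat.mul_le_mul_left _ (Nat.mul_le_mul ?_ ?_)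
  · rw [gpow]
    split_ifs with h
    · exact (Nat.pow_le_pow_left (Nat.le_succ _) _).trans
        (Nat.pow_le_pow_right (Nat.succ_pos _) (by omega))
    · exact Nat.zero_le _
  · rw [hpow, if_pos (Nat.sub_le _ _)]
    exact Nat.pow_le_pow_right (Nat.succ_pos _) (by omega)

theorem Layout.eval_digE {L : Layout} {I : Data} {inp : ℕ → ℕ} (hL : L.Reads I inp) {σ : Mem}
    (h0 : σ 0 = inp) (hB : σ rBase 0 = I.W + 2) (e : Exp) (j : ℕ) :
    (L.digE e j).eval σ = I.dig (e.eval σ) j := by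
  simp [digE, Data.dig, digit, hL.cap σ h0, hB]

theorem Layout.eval_transE {L : Layout} {I : Data} {inp : ℕ → ℕ} (hL : L.Reads I inp) {σ : Mem}
    (h0 : σ 0 = inp) (hB : σ rBase 0 = I.W + 2) (hS : σ rSize 0 = I.S)
    (hNum : ∀ x < 2 * I.n * I.D, σ aNum x = I.num x)
    (hWt : ∀ x < 2 * I.n * I.D, σ aWt x = I.wt x)
    {s : ℕ} (hs : s < 2) (hV : σ rV 0 < I.n * I.S) :
    (L.transE s).eval σ = I.trans s (σ rV 0) := by
  have key : ∀ j ∈ Finset.range I.D,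
      (2 * (σ rV 0 / I.S) + s) * I.D + j < 2 * I.n * I.D := by
    intro j hj
    have hj := Finset.mem_range.1 hj
    have h1 : σ rV 0 / I.S < I.n := Nat.div_lt_of_lt_mul (by rwa [mul_comm])
    calc (2 * (σ rV 0 / I.S) + s) * I.D + j < (2 * (σ rV 0 / I.S) + s + 1) * I.D := by
          rw [add_mul _ 1]; omega
      _ ≤ _ := Nat.mul_le_mul_right _ (by omega)
  simp only [transE, Exp.eval_add, eval_minE, Exp.eval_mul, Exp.eval_mod, Exp.eval_var,
    Exp.eval_ofNat, hL.cap σ h0, hL.inc σ h0 s hs, Exp.eval_sum, hL.D, hS, Data.trans, ofDigits]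
  congr 2
  refine Finset.sum_congr rfl fun j hj => ?_
  simp only [eval_digE hL h0 hB, Exp.eval_mod, Exp.eval_var, Exp.eval_read, Exp.eval_mul,
    Exp.eval_add, Exp.eval_div, Exp.eval_ofNat, Exp.eval_lit, Exp.eval_same, Exp.eval_sub,
    Exp.eval_prod, hB, hS, hNum _ (key j hj), hWt _ (key j hj), Data.wz, Finset.prod_const,
    Finset.card_range]
  rfl

theorem Layout.eval_costE {L : Layout} {I : Data} {inp : ℕ → ℕ} (hL : L.Reads I inp) {σ : Mem}
    (h0 : σ 0 = inp) (hB : σ rBase 0 = I.W + 2) (hW : σ rSum 0 = I.W)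
    (hG : ∀ s, σ aG s = I.gpow s) (hH : ∀ s, σ aH s = I.hpow s) :
    L.costE.eval σ = I.codeCost (σ rC 0) := by
  simp only [costE, Exp.eval_sum, hL.D, Data.codeCost]
  refine Finset.sum_congr rfl fun j hj => ?_
  simp only [Exp.eval_mul, hL.coef σ h0 j (Finset.mem_range.1 hj), Exp.eval_read,
    eval_digE hL h0 hB, hG, hH, Exp.eval_sub, Exp.eval_var, hW]

/-- The program finds decisions of least rounded cost among those whose counter reaches `tgt`. -/
theorem Layout.program_runs (L : Layout) {I : Data} {l : List ℕ} {M Z : ℕ}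
    (hL : L.Reads I (fun i => l.getD i 0)) (hF : I.Fits M Z)
    (hex : ∃ χ : ℕ → ℕ, (∀ i, χ i < 2) ∧ I.count χ I.n = I.tgt) :
    Runs M L.program (inputMem l)
      (L.initCmd.cost +
        ((2 * I.n * I.D * ((weightPre L.num L.den).cost + weightPost.cost + 19) +
          I.W * (searchBody.cost + 11) + 8) +
        (tableInit.cost + ((I.W * (tableBody.cost + 6) + 6) +
        (L.dpInit.cost + ((I.n * I.S * ((dpBody L.transE).cost + 9) + 9) +
        ((I.S * ((scanBody L.goodE L.costE).cost + 6) + 6) +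
        (traceInit.cost + (I.n * (traceBody.cost + 3) + 3)))))))))
      (fun σ' => ∃ χ : ℕ → ℕ, (∀ i, χ i < 2) ∧ (∀ i < I.n, σ' 1 i = χ i) ∧
        I.count χ I.n = I.tgt ∧ ∀ χ' : ℕ → ℕ, (∀ i, χ' i < 2) → I.count χ' I.n = I.tgt →
          I.selCost χ ≤ I.selCost χ') := by
  obtain ⟨χ₀, hχ₀, hχ₀'⟩ := hex
  set inp : ℕ → ℕ := fun i => l.getD i 0 with hinp
  have hi0 : inputMem l 0 = inp := by funext i; simp [inputMem, hinp]
  have hi : ∀ a, a ≠ 0 → inputMem l a = fun _ => 0 := by intro a ha; funext i; simp [inputMem, ha]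
  have hS1 : I.S ≤ 2 ^ M := by have := hF.size_le; nlinarith
  have hn1 : I.n ≤ 2 ^ M := by have := hF.size_le; have := I.S_pos; nlinarith
  rw [program, hL.D]
  refine Runs.seq (P := fun σ => σ rN 0 = I.n ∧ σ rM 0 = I.m) (Runs.of_wp ?_) ?_
  · simp only [initCmd, wp_seq, wp_assign, Exp.eval_var, Exp.eval_read, Exp.eval_mul,
      Exp.eval_add, Exp.eval_div, Exp.eval_ofNat, hL.n _ hi0, Mem.set_same, Mem.set_ne, ne_eq,
      Nat.reduceEqDiff, not_false_eq_true, OfNat.zero_ne_ofNat, Function.update_self, hi0]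
    rw [← hL.m]
    refine ⟨hn1, hF.le_pow ?_, trivial, rfl⟩
    calc I.m ≤ I.m + 1 := Nat.le_succ _
      _ ≤ _ := Nat.le_self_pow (by omega) _
  -- From here on, `fᵢ` tells which arrays have not changed, and the other facts describe the memory
  -- after the part of the program that has been run.
  intro σ₁ f₁ ⟨hN₁, hM₁⟩
  replace f₁ : ∀ a, a ∉ [rN, rM] → σ₁ a = inputMem l a := f₁
  have h0₁ : σ₁ 0 = inp := by rw [f₁ 0 (by simp), hi0]
  refine Runs.seq (weightCmd_runs (D := I.D) I.num I.den hN₁ hM₁ hF.m_pos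
    (by rw [f₁ rX (by simp), hi rX (by simp)]) (by rw [f₁ rSum (by simp), hi rSum (by simp)])
    (fun σ' hσ' => hL.num σ' (by rw [hσ' 0 (by simp), h0₁]))
    (fun σ' hσ' => hL.den σ' (by rw [hσ' 0 (by simp), h0₁]))
    ?_ ?_ ?_ ?_) ?_
  · intro x hx
    refine hF.pow_le' (hF.num_le x hx) (Nat.pow_le_pow_right (Nat.succ_pos _) ?_)
    exact Nat.succ_le_succ (Finset.single_le_sum (f := I.wt) (fun _ _ => Nat.zero_le _)
      (Finset.mem_range.2 hx))
  · intro x hx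
    refine hF.pow_le' (hF.den_le x hx) ((Nat.pow_le_pow_left (Nat.le_succ _) _).trans
      (Nat.pow_le_pow_right (Nat.succ_pos _) ?_))
    exact Nat.succ_le_succ (Finset.single_le_sum (f := I.wt) (fun _ _ => Nat.zero_le _)
      (Finset.mem_range.2 hx))
  · have := hF.W_add_two_le
    change I.W ≤ _
    omega
  · exact hF.len_le
  change ∀ σ' : Mem, _ → (_ ∧ (∀ x < 2 * I.n * I.D, σ' aWt x = I.wt x) ∧ σ' rSum 0 = I.W) → _
  intro σ₂ f₂ ⟨hNum₂, hWt₂, hW₂⟩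
  replace f₂ : ∀ a, a ∉ [rX, rA, rB, rW, aNum, aWt, rSum] → σ₂ a = σ₁ a := by
    intro a ha
    apply f₂
    simp only [List.mem_cons, List.not_mem_nil, or_false, not_or] at ha
    simp [weightCmd, weightBody, weightPre, weightPost, searchCmd, searchBody, Cmd.writes, ha]
  have h0₂ : σ₂ 0 = inp := by rw [f₂ 0 (by simp), h0₁]
  have hz₂ : ∀ a, 11 ≤ a → σ₂ a = fun _ => 0 := by
    intro a ha
    rw [f₂ a (by simp; omega), f₁ a (by simp; omega), hi a (by omega)]
  refine Runs.seq (P := fun σ => (∀ s, σ aG s = if s = 0 then 1 else 0) ∧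
    (∀ s, σ aH s = if s = 0 then 1 else 0)) (Runs.of_wp ?_) ?_
  · simp only [tableInit, wp_seq, wp_assign, Exp.eval_ofNat, Mem.set_same, Mem.set_ne, ne_eq,
      Nat.reduceEqDiff, not_false_eq_true, hz₂ aG (by norm_num), hz₂ aH (by norm_num),
      Function.update_apply]
    exact ⟨Nat.one_le_two_pow, Nat.one_le_two_pow, fun s => trivial, fun s => trivial⟩
  intro σ₃ f₃ ⟨hG₃, hH₃⟩
  replace f₃ : ∀ a, a ∉ [aG, aH] → σ₃ a = σ₂ a := f₃
  have hM₃ : σ₃ rM 0 = I.m := by rw [f₃ rM (by simp), f₂ rM (by simp), hM₁]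
  have hW₃ : σ₃ rSum 0 = I.W := by rw [f₃ rSum (by simp), hW₂]
  refine Runs.seq (tableCmd_runs hM₃ hW₃ (by rw [f₃ rK (by simp), hz₂ rK (by norm_num)])
    hG₃ hH₃ (hF.le_pow (Nat.pow_le_pow_right (Nat.succ_pos _) (by omega)))
    (by have := hF.W_add_two_le; omega)) ?_
  intro σ₄ f₄ ⟨hG₄, hH₄⟩
  replace f₄ : ∀ a, a ∉ [aG, aH, rK] → σ₄ a = σ₂ a := by
    intro a ha
    simp only [List.mem_cons, List.not_mem_nil, or_false, not_or] at ha
    rw [f₄ a (by simp [tableCmd, tableBody, Cmd.writes, ha]), f₃ a (by simp [ha])]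
  have h0₄ : σ₄ 0 = inp := by rw [f₄ 0 (by simp), h0₂]
  have hW₄ : σ₄ rSum 0 = I.W := by rw [f₄ rSum (by simp), hW₂]
  have hz₄ : ∀ a, 14 ≤ a → σ₄ a = fun _ => 0 := by
    intro a ha
    rw [f₄ a (by simp; omega), hz₂ a (by omega)]
  refine Runs.seq (P := fun σ => σ rBase 0 = I.W + 2 ∧ σ rSize 0 = I.S ∧
    ∀ y, σ aT y = if y = 0 then 1 else 0) (Runs.of_wp ?_) ?_
  · have hcap : ∀ v, L.cap.eval (σ₄.set rBase 0 v) = I.cap := fun v =>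
      hL.cap _ (by rw [Mem.set_ne _ (by norm_num), h0₄])
    simp only [dpInit, wp_seq, wp_assign, Exp.eval_ofNat, Exp.eval_add, Exp.eval_mul,
      Exp.eval_var, Exp.eval_prod, hW₄, hcap, Finset.prod_const, Finset.card_range, hL.D,
      Mem.set_same, Mem.set_ne, ne_eq, Nat.reduceEqDiff, not_false_eq_true,
      hz₄ aT (by norm_num), Function.update_apply, if_true]
    exact ⟨hF.W_add_two_le, hS1, Nat.one_le_two_pow, trivial, rfl, fun _ => trivial⟩
  intro σ₅ f₅ ⟨hB₅, hS₅, hT₅⟩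
  replace f₅ : ∀ a, a ∉ [rBase, rSize, aT] → σ₅ a = σ₄ a := f₅
  have h0₅ : σ₅ 0 = inp := by rw [f₅ 0 (by simp), h0₄]
  have hN₅ : σ₅ rN 0 = I.n := by
    rw [f₅ rN (by simp), f₄ rN (by simp), f₂ rN (by simp), hN₁]
  have hNum₅ : ∀ x < 2 * I.n * I.D, σ₅ aNum x = I.num x := by
    rwa [f₅ aNum (by simp), f₄ aNum (by simp)]
  have hWt₅ : ∀ x < 2 * I.n * I.D, σ₅ aWt x = I.wt x := by
    rwa [f₅ aWt (by simp), f₄ aWt (by simp)]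
  refine Runs.seq (dpCmd_runs I.trans hN₅ hS₅ I.S_pos
    (by rw [f₅ rV (by simp), hz₄ rV (by norm_num)]) hT₅ (fun σ' hσ' hV s hs => ?_)
    (by have := hF.size_le; nlinarith)) ?_
  · refine Layout.eval_transE hL (by rw [hσ' 0 (by simp), h0₅])
      (by rw [hσ' rBase (by simp), hB₅]) (by rw [hσ' rSize (by simp), hS₅]) ?_ ?_ hs hV
    · rwa [hσ' aNum (by simp)]
    · rwa [hσ' aWt (by simp)]
  intro σ₆ f₆ hT₆
  replace f₆ : ∀ a, a ∉ [aT, rV] → σ₆ a = σ₅ a := by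
    intro a ha
    apply f₆
    simpa [dpCmd, dpBody, Cmd.writes] using ha
  have h0₆ : σ₆ 0 = inp := by rw [f₆ 0 (by simp), h0₅]
  have hN₆ : σ₆ rN 0 = I.n := by rw [f₆ rN (by simp), hN₅]
  have hS₆ : σ₆ rSize 0 = I.S := by rw [f₆ rSize (by simp), hS₅]
  have hB₆ : σ₆ rBase 0 = I.W + 2 := by rw [f₆ rBase (by simp), hB₅]
  have hW₆ : σ₆ rSum 0 = I.W := by rw [f₆ rSum (by simp), f₅ rSum (by simp), hW₄]
  have hG₆ : ∀ s, σ₆ aG s = I.gpow s := by rwa [f₆ aG (by simp), f₅ aG (by simp)]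
  have hH₆ : ∀ s, σ₆ aH s = I.hpow s := by rwa [f₆ aH (by simp), f₅ aH (by simp)]
  refine Runs.seq (scanCmd_runs (fun c => if c % (I.cap + 1) = I.tgt then 1 else 0) I.codeCost
    hN₆ hS₆ (by rw [f₆ rC (by simp), f₅ rC (by simp), hz₄ rC (by norm_num)])
    (by rw [f₆ rBest (by simp), f₅ rBest (by simp), hz₄ rBest (by norm_num)])
    (fun σ' hσ' => ?_) (fun σ' hσ' => ?_) hS1 fun c _ => ?_) ?_
  · have h0' : σ' 0 = inp := by rw [hσ' 0 (by simp), h0₆]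
    simp [goodE, hL.cap σ' h0', hL.tgt σ' h0']
  · refine Layout.eval_costE hL (by rw [hσ' 0 (by simp), h0₆])
      (by rw [hσ' rBase (by simp), hB₆]) (by rw [hσ' rSum (by simp), hW₆]) ?_ ?_
    · rwa [hσ' aG (by simp)]
    · rwa [hσ' aH (by simp)]
  · exact (I.codeCost_le c).trans ((Nat.mul_le_mul_right _ hF.coef_le).trans hF.pow_le)
  intro σ₇ f₇ hbest
  replace f₇ : ∀ a, a ∉ [rC, rBest, rVal] → σ₇ a = σ₆ a := by
    intro a ha
    apply f₇
    simp only [List.mem_cons, List.not_mem_nil, or_false, not_or] at ha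
    simp [scanCmd, scanBody, Cmd.writes, ha]
  have hN₇ : σ₇ rN 0 = I.n := by rw [f₇ rN (by simp), hN₆]
  have hS₇ : σ₇ rSize 0 = I.S := by rw [f₇ rSize (by simp), hS₆]
  have hT₇ : σ₇ aT = σ₆ aT := f₇ aT (by simp)
  have hgood : ∀ χ : ℕ → ℕ, (∀ i, χ i < 2) → I.count χ I.n = I.tgt →
      σ₆ aT (I.n * I.S + I.code χ I.n) ≠ 0 ∧
        (if I.code χ I.n % (I.cap + 1) = I.tgt then 1 else 0) ≠ 0 := by
    intro χ hχ hχ'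
    refine ⟨Data.reach hT₆ hχ le_rfl, ?_⟩
    rw [if_pos (by rw [Data.code_mod, hχ'])]
    exact one_ne_zero
  -- Some selection is admissible, so the search cannot fail.
  rcases hbest with ⟨_, hbest⟩ | ⟨c₀, hc₀, hb, ⟨hg₁, hg₂⟩, hopt⟩
  · exact absurd (hgood χ₀ hχ₀ hχ₀') (hbest _ (Data.code_lt _ _))
  refine Runs.seq (P := fun σ => σ rY 0 = I.n * I.S + c₀ ∧ σ rI 0 = I.n) (Runs.of_wp ?_) ?_
  · simp only [traceInit, wp_seq, wp_assign, Exp.eval_ofNat, Exp.eval_add, Exp.eval_mul,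
      Exp.eval_sub, Exp.eval_var, hN₇, hS₇, hb, Nat.add_sub_cancel,
      Mem.set_same, Mem.set_ne, ne_eq, Nat.reduceEqDiff, not_false_eq_true,
      Function.update_self]
    refine ⟨?_, hn1, trivial, trivial⟩
    have := hF.size_le
    nlinarith
  intro σ₈ f₈ ⟨hY₈, hI₈⟩
  replace f₈ : ∀ a, a ∉ [rY, rI] → σ₈ a = σ₇ a := f₈
  have hT₈ : σ₈ aT = σ₆ aT := by rw [f₈ aT (by simp), hT₇]
  refine (traceCmd_runs hI₈ hn1).weaken le_rfl ?_
  intro σ₉ _ hout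
  rw [hT₈, hY₈] at hout
  have htb := Data.traceback hT₆ hc₀ hg₁
  set χ : ℕ → ℕ := fun i =>
    (σ₆ aT ((fun y => (σ₆ aT y - 1) / 2)^[I.n - 1 - i] (I.n * I.S + c₀)) - 1) % 2 with hχ
  refine ⟨χ, fun i => Nat.mod_lt _ (by norm_num), fun i hi => ?_, ?_, fun χ' hχ' hc' => ?_⟩
  · have := hout (I.n - 1 - i) (by omega)
    rwa [show I.n - 1 - (I.n - 1 - i) = i by omega] at this
  · rw [← Data.code_mod, htb]
    by_contra h
    exact hg₂ (if_neg h)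
  · rw [← Data.codeCost_code, ← Data.codeCost_code, htb]
    exact hopt _ (Data.code_lt _ _) (hgood χ' hχ' hc')

/-- The previous result with a single constant `K`, which depends only on the program. -/
theorem Layout.exists_program_runs (L : Layout) : ∃ K : ℕ, ∀ (I : Data) (l : List ℕ) (M Z : ℕ),
    L.Reads I (fun i => l.getD i 0) → I.Fits M Z →
    (∃ χ : ℕ → ℕ, (∀ i, χ i < 2) ∧ I.count χ I.n = I.tgt) →
    Runs M L.program (inputMem l) (K * (1 + 2 * I.n * I.D + I.W + I.n * I.S + I.S + I.n))
      (fun σ' => ∃ χ : ℕ → ℕ, (∀ i, χ i < 2) ∧ (∀ i < I.n, σ' 1 i = χ i) ∧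
        I.count χ I.n = I.tgt ∧ ∀ χ' : ℕ → ℕ, (∀ i, χ' i < 2) → I.count χ' I.n = I.tgt →
          I.selCost χ ≤ I.selCost χ') := by
  refine ⟨L.initCmd.cost + ((weightPre L.num L.den).cost + weightPost.cost + 19) +
    (searchBody.cost + 11) + 8 + tableInit.cost + (tableBody.cost + 6) + 6 + L.dpInit.cost +
    ((dpBody L.transE).cost + 9) + 9 + ((scanBody L.goodE L.costE).cost + 6) + 6 +
    traceInit.cost + (traceBody.cost + 3) + 3, fun I l M Z hL hF hex => ?_⟩
  refine (L.program_runs hL hF hex).weaken ?_ fun _ _ h => h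
  -- Each term is a constant of the program times one of the summands of `U`.
  set U := 1 + 2 * I.n * I.D + I.W + I.n * I.S + I.S + I.n with hU
  have h1 : 1 ≤ U := by omega
  have hX : 2 * I.n * I.D ≤ U := by omega
  have hW : I.W ≤ U := by omega
  have hnS : I.n * I.S ≤ U := by omega
  have hS : I.S ≤ U := by omega
  have hn : I.n ≤ U := by omega
  generalize U = U at *
  generalize I.n * I.S = nS at *
  generalize 2 * I.n * I.D = X at *
  have c1 : ∀ c : ℕ, c ≤ c * U := fun c => Nat.le_mul_of_pos_right c h1
  have c2 : ∀ c : ℕ, X * c ≤ c * U := fun c => by rw [mul_comm]; exact Nat.mul_le_mul_left c hX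
  have c3 : ∀ c : ℕ, I.W * c ≤ c * U := fun c => by rw [mul_comm]; exact Nat.mul_le_mul_left c hW
  have c4 : ∀ c : ℕ, nS * c ≤ c * U := fun c => by rw [mul_comm]; exact Nat.mul_le_mul_left c hnS
  have c5 : ∀ c : ℕ, I.S * c ≤ c * U := fun c => by rw [mul_comm]; exact Nat.mul_le_mul_left c hS
  have c6 : ∀ c : ℕ, I.n * c ≤ c * U := fun c => by rw [mul_comm]; exact Nat.mul_le_mul_left c hn
  have := c1 L.initCmd.cost
  have := c2 ((weightPre L.num L.den).cost + weightPost.cost + 19)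
  have := c3 (searchBody.cost + 11)
  have := c1 8
  have := c1 tableInit.cost
  have := c3 (tableBody.cost + 6)
  have := c1 6
  have := c1 L.dpInit.cost
  have := c4 ((dpBody L.transE).cost + 9)
  have := c1 9
  have := c5 ((scanBody L.goodE L.costE).cost + 6)
  have := c1 traceInit.cost
  have := c6 (traceBody.cost + 3)
  have := c1 3
  simp only [add_mul _ _ U] at *
  omega

/-! ### The expected minimum -/

theorem Ratio.val_nonneg (r : Ratio) : 0 ≤ r.val := by
  unfold Ratio.val
  positivity

namespace TailDist

variable {d : ℕ} (Y : TailDist d)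

theorem prGE_zero : Y.prGE 0 = 1 := if_pos rfl

theorem prGE_succ {j : ℕ} (hj : j < d - 1) : Y.prGE (j + 1) = (Y.tail ⟨j, hj⟩).val := by
  simp [prGE, hj]

theorem prGE_of_le {j : ℕ} (hd : 1 ≤ d) (hj : d ≤ j) : Y.prGE j = 0 := by
  rw [prGE, if_neg (by omega), dif_neg (by omega)]

theorem prGE_nonneg (j : ℕ) : 0 ≤ Y.prGE j := by
  unfold prGE
  split_ifs
  exacts [zero_le_one, Ratio.val_nonneg _, le_rfl]

theorem prGE_succ_le (j : ℕ) : Y.prGE (j + 1) ≤ Y.prGE j := by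
  by_cases hj : j < d - 1
  · rw [Y.prGE_succ hj]
    rcases j with _ | j
    · rw [prGE_zero]
      exact Y.le_one _
    · rw [Y.prGE_succ (by omega)]
      exact Y.anti (show (⟨j, by omega⟩ : Fin (d - 1)) ≤ ⟨j + 1, hj⟩ by simp)
  · have : Y.prGE (j + 1) = 0 := by
      rw [prGE, if_neg (by omega), dif_neg (by omega)]
    rw [this]
    exact Y.prGE_nonneg j

/-- A telescoping sum. -/
theorem sum_tail_eq (q : ℕ → ℝ) {a d : ℕ} (h : a ≤ d) :
    ∑ k ∈ Finset.range d, (if a ≤ k then q k - q (k + 1) else 0) = q a - q d := by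
  induction d, h using Nat.le_induction with
  | base =>
    rw [sub_self]
    refine Finset.sum_eq_zero fun k hk => if_neg ?_
    exact not_le.2 (Finset.mem_range.1 hk)
  | succ d hd ih =>
    rw [Finset.sum_range_succ, ih, if_pos hd]
    ring

theorem integral_law (l : Fin d → Ratio) (g : ℝ → ℝ) :
    ∫ y, g y ∂(Y.law l) = ∑ j : Fin d, (Y.prGE j - Y.prGE (j + 1)) * g (l j).val := by
  rw [law, integral_finsetSum_measure]
  · refine Finset.sum_congr rfl fun j _ => ?_
    rw [integral_smul_measure, integral_dirac, smul_eq_mul,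
      ENNReal.toReal_ofReal (sub_nonneg.2 (Y.prGE_succ_le j))]
  · intro j _
    exact (integrable_dirac (by simp)).smul_measure ENNReal.ofReal_ne_top

theorem isProbabilityMeasure_law (hd : 1 ≤ d) (l : Fin d → Ratio) :
    IsProbabilityMeasure (Y.law l) := by
  constructor
  rw [law, Measure.finsetSum_apply]
  simp only [Measure.smul_apply, measure_univ, smul_eq_mul, mul_one]
  rw [← ENNReal.ofReal_sum_of_nonneg fun j _ => sub_nonneg.2 (Y.prGE_succ_le _),
    Finset.sum_fin_eq_sum_range]
  have := sum_tail_eq Y.prGE (Nat.zero_le d)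
  simp only [Nat.zero_le, if_true, Y.prGE_zero, Y.prGE_of_le hd le_rfl, sub_zero] at this
  rw [Finset.sum_congr rfl (g := fun k => Y.prGE k - Y.prGE (k + 1))
    fun k hk => dif_pos (Finset.mem_range.1 hk), this, ENNReal.ofReal_one]

theorem ae_law (l : Fin d → Ratio) : ∀ᵐ y ∂(Y.law l), ∃ j, y = (l j).val := by
  rw [ae_iff, law, Measure.finsetSum_apply]
  refine Finset.sum_eq_zero fun j _ => ?_
  rw [Measure.smul_apply, Measure.dirac_apply, Set.indicator_of_notMem, smul_zero]
  simp only [Set.mem_ofPred_eq, not_not]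
  exact ⟨j, rfl⟩

theorem integral_indicator_law (hd : 1 ≤ d) {l : Fin d → Ratio}
    (hl : StrictMono fun j => (l j).val) (a : Fin d) :
    ∫ y, (Set.Ici (l a).val).indicator 1 y ∂(Y.law l) = Y.prGE a := by
  rw [integral_law, Finset.sum_fin_eq_sum_range]
  have := sum_tail_eq Y.prGE a.2.le
  rw [Y.prGE_of_le hd le_rfl, sub_zero] at this
  rw [← this]
  refine Finset.sum_congr rfl fun k hk => ?_
  rw [dif_pos (Finset.mem_range.1 hk), Set.indicator_apply]
  simp only [Set.mem_Ici, hl.le_iff_le (a := a), Fin.le_def, Pi.one_apply]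
  split_ifs <;> simp

end TailDist

/-- The value `l_j`, as a function on the natural numbers. -/
noncomputable def level {d : ℕ} (l : Fin d → Ratio) (j : ℕ) : ℝ :=
  if h : j < d then (l ⟨j, h⟩).val else 0

theorem level_zero_nonneg {d : ℕ} (l : Fin d → Ratio) : 0 ≤ level l 0 := by
  unfold level
  split_ifs
  exacts [Ratio.val_nonneg _, le_rfl]

/-- The expected minimum is a combination of the products of the tail probabilities, because
`min y = l₀ + ∑ (l_{j+1} - l_j) · [all y_i ≥ l_{j+1}]` for values `y_i` among the `l_j`. -/
theorem expMin_eq {d : ℕ} (hd : 1 ≤ d) {l : Fin d → Ratio} (hl : StrictMono fun j => (l j).val)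
    {ι : Type} [Fintype ι] [Nonempty ι] (Y : ι → TailDist d) :
    expMin l Y = level l 0 + ∑ j ∈ Finset.range (d - 1),
      (level l (j + 1) - level l j) * ∏ i, (Y i).prGE (j + 1) := by
  have hp : ∀ i, IsProbabilityMeasure ((Y i).law l) := fun i => (Y i).isProbabilityMeasure_law hd l
  set h : ℕ → ℝ → ℝ := fun j => (Set.Ici (level l (j + 1))).indicator 1 with hh
  have hint : ∀ j i, Integrable (h j) ((Y i).law l) := fun j i =>
    (integrable_const (1 : ℝ)).indicator measurableSet_Ici
  have hprod : ∀ j, Integrable (fun y : ι → ℝ => ∏ i, h j (y i))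
      (Measure.pi fun i => (Y i).law l) := fun j =>
    Integrable.fintype_prod (f := fun _ => h j) fun i => hint j i
  have hae : ∀ᵐ y ∂(Measure.pi fun i => (Y i).law l), (⨅ i, y i) = level l 0 +
      ∑ j ∈ Finset.range (d - 1), (level l (j + 1) - level l j) * ∏ i, h j (y i) := by
    have h1 : ∀ᵐ y ∂(Measure.pi fun i => (Y i).law l), ∀ i, ∃ j, y i = (l j).val := by
      rw [ae_all_iff]
      intro i
      exact (Measure.tendsto_eval_ae_ae (μ := fun i => (Y i).law l) (i := i)).eventually
        ((Y i).ae_law l)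
    filter_upwards [h1] with y hy
    choose a ha using hy
    obtain ⟨i₀, hi₀⟩ := exists_eq_ciInf_of_finite (f := y)
    have hmin : ∀ i, a i₀ ≤ a i := by
      intro i
      have : y i₀ ≤ y i := hi₀ ▸ ciInf_le (Set.finite_range y).bddBelow i
      rw [ha, ha] at this
      exact hl.le_iff_le.1 this
    have hlev : ∀ b : Fin d, level l b = (l b).val := fun b => by simp [level]
    have hterm : ∀ j ∈ Finset.range (d - 1), (level l (j + 1) - level l j) * ∏ i, h j (y i) =
        if j < a i₀ then level l (j + 1) - level l j else 0 := by
      intro j hj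
      have hj := Finset.mem_range.1 hj
      have e : ∀ i, h j (y i) = if j < a i then 1 else 0 := by
        intro i
        simp only [hh, Set.indicator_apply, Set.mem_Ici, Pi.one_apply]
        have e1 : level l (j + 1) = (l ⟨j + 1, by omega⟩).val := hlev ⟨j + 1, by omega⟩
        rw [e1, ha]
        simp only [hl.le_iff_le (a := ⟨j + 1, by omega⟩), Fin.le_def, Nat.succ_le_iff]
      split_ifs with hlt
      · rw [Finset.prod_eq_one, mul_one]
        intro i _
        rw [e, if_pos (lt_of_lt_of_le hlt (hmin i))]
      · rw [Finset.prod_eq_zero (Finset.mem_univ i₀), mul_zero]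
        rw [e, if_neg hlt]
    rw [Finset.sum_congr rfl hterm, ← hi₀, ha, ← hlev, ← Finset.sum_filter]
    have : Finset.filter (fun j => j < (a i₀ : ℕ)) (Finset.range (d - 1)) =
        Finset.range (a i₀) := by
      ext j
      simp only [Finset.mem_filter, Finset.mem_range]
      have := (a i₀).2
      omega
    rw [this, Finset.sum_range_sub]
    ring
  rw [expMin, integral_congr_ae hae, integral_add (integrable_const _)
    (integrable_finsetSum _ fun j _ => (hprod j).const_mul _), integral_const,
    integral_finsetSum _ fun j _ => (hprod j).const_mul _]
  simp only [probReal_univ, one_smul]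
  congr 1
  refine Finset.sum_congr rfl fun j hj => ?_
  have hj := Finset.mem_range.1 hj
  rw [integral_const_mul, integral_fintype_prod_eq_prod (f := fun _ => h j)]
  congr 1
  refine Finset.prod_congr rfl fun i _ => ?_
  have e1 : level l (j + 1) = (l ⟨j + 1, by omega⟩).val := by
    rw [level, dif_pos]
  simp only [hh, e1]
  exact (Y i).integral_indicator_law hd hl ⟨j + 1, by omega⟩

/-! ### The rounding error -/

/-- The accumulated rounding error, bounded by Bernoulli's inequality. -/
theorem pow_le_one_add {n q : ℕ} (hn : 0 < n) {ε : ℝ} (hε : 0 < ε) (hq : 1 / ε ≤ q) {m : ℕ}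
    (hm : m = 2 * n * q) : (((m : ℝ) + 1) / m) ^ n ≤ 1 + ε := by
  have hq0 : 0 < q := by
    rw [← Nat.cast_pos (α := ℝ)]
    exact (one_div_pos.2 hε).trans_le hq
  have hn' : (1 : ℝ) ≤ n := by exact_mod_cast hn
  have hq' : (1 : ℝ) ≤ q := by exact_mod_cast hq0
  have hmr : (m : ℝ) = 2 * n * q := by rw [hm]; push_cast; ring
  have hm1 : 2 * (n : ℝ) ≤ m := by rw [hmr]; nlinarith
  have hm2 : 2 * (n : ℝ) ≤ ε * m := by
    rw [div_le_iff₀ hε] at hq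
    rw [hmr]
    nlinarith
  have hm0 : (0 : ℝ) < m := by linarith
  have hb := one_add_mul_le_pow (a := -(1 / ((m : ℝ) + 1))) (by
    have : 1 / ((m : ℝ) + 1) ≤ 1 := by rw [div_le_one (by positivity)]; linarith
    linarith) n
  have e1 : 1 + -(1 / ((m : ℝ) + 1)) = (((m : ℝ) + 1) / m)⁻¹ := by
    field_simp
    ring
  rw [e1, inv_pow] at hb
  have hP : 0 < (((m : ℝ) + 1) / m) ^ n := by positivity
  set P := (((m : ℝ) + 1) / m) ^ n
  have h2 : P * (1 + n * -(1 / ((m : ℝ) + 1))) ≤ 1 := by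
    calc _ ≤ P * P⁻¹ := mul_le_mul_of_nonneg_left hb hP.le
      _ = 1 := mul_inv_cancel₀ hP.ne'
  have e2 : P * (1 + n * -(1 / ((m : ℝ) + 1))) = P * ((m + 1 - n) / (m + 1)) := by
    field_simp
    ring
  rw [e2, ← mul_div_assoc, div_le_one (by positivity)] at h2
  have h3 : (m : ℝ) + 1 ≤ (1 + ε) * (m + 1 - n) := by nlinarith
  exact le_of_mul_le_mul_right (h2.trans h3) (by linarith)

namespace Data

variable (I : Data)

/-- The factor number `x`. -/
noncomputable def prob (x : ℕ) : ℝ := (I.num x : ℝ) / I.den x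

/-- The product number `j` for the decisions `χ`. -/
noncomputable def probProd (χ : ℕ → ℕ) (j : ℕ) : ℝ :=
  ∏ i ∈ Finset.range I.n, I.prob ((2 * i + χ i) * I.D + j)

/-- The factors are probabilities. -/
structure Valid : Prop where
  m_pos : 0 < I.m
  den_pos : ∀ x < 2 * I.n * I.D, 0 < I.den x
  num_le_den : ∀ x < 2 * I.n * I.D, I.num x ≤ I.den x

variable {I}

theorem idx_lt {χ : ℕ → ℕ} (hχ : ∀ i, χ i < 2) {i j : ℕ} (hi : i < I.n) (hj : j < I.D) :
    (2 * i + χ i) * I.D + j < 2 * I.n * I.D := by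
  have := hχ i
  calc (2 * i + χ i) * I.D + j < (2 * i + χ i + 1) * I.D := by rw [add_mul _ 1]; omega
    _ ≤ _ := Nat.mul_le_mul_right _ (by omega)

theorem prob_nonneg (x : ℕ) : 0 ≤ I.prob x := by
  unfold prob
  positivity

theorem probProd_nonneg (χ : ℕ → ℕ) (j : ℕ) : 0 ≤ I.probProd χ j :=
  Finset.prod_nonneg fun _ _ => prob_nonneg _

theorem prob_le_pow (hI : I.Valid) {x : ℕ} (hx : x < 2 * I.n * I.D) :
    I.prob x ≤ ((I.m : ℝ) / (I.m + 1)) ^ I.wt x := by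
  have hd : (0 : ℝ) < I.den x := by exact_mod_cast hI.den_pos x hx
  have key : I.num x * (I.m + 1) ^ I.wt x ≤ I.den x * I.m ^ I.wt x := by
    rcases h : I.wt x with _ | w
    · simpa using hI.num_le_den x hx
    · exact (of_lt_weight (h.symm ▸ Nat.lt_succ_self w : w < I.wt x)).2
  rw [prob, div_pow, div_le_div_iff₀ hd (by positivity), mul_comm _ (I.den x : ℝ)]
  exact_mod_cast key

theorem pow_le_prob (hI : I.Valid) {x : ℕ} (hx : x < 2 * I.n * I.D) (h0 : I.num x ≠ 0) :
    ((I.m : ℝ) / (I.m + 1)) ^ I.wt x ≤ I.prob x * (((I.m : ℝ) + 1) / I.m) := by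
  have hd : (0 : ℝ) < I.den x := by exact_mod_cast hI.den_pos x hx
  have hm : (0 : ℝ) < I.m := by exact_mod_cast hI.m_pos
  have key : I.den x * I.m ^ (I.wt x + 1) ≤ I.num x * (I.m + 1) ^ (I.wt x + 1) := by
    have := weight_not hI.m_pos (I.num x) (I.den x)
    rw [not_and, not_le] at this
    exact (this (by positivity)).le
  rw [prob, div_pow, div_mul_div_comm, div_le_div_iff₀ (by positivity) (by positivity)]
  have key' : (I.den x : ℝ) * I.m ^ (I.wt x + 1) ≤ I.num x * ((I.m : ℝ) + 1) ^ (I.wt x + 1) := by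
    exact_mod_cast key
  rw [pow_succ, pow_succ] at key'
  linarith

theorem sum_wt_le {χ : ℕ → ℕ} (hχ : ∀ i, χ i < 2) {j : ℕ} (hj : j < I.D) :
    ∑ i ∈ Finset.range I.n, I.wt ((2 * i + χ i) * I.D + j) ≤ I.W := by
  have hinj : Set.InjOn (fun i => (2 * i + χ i) * I.D + j) (Finset.range I.n) := by
    intro i _ i' _ h
    have h1 := Nat.eq_of_mul_eq_mul_right (by omega) (Nat.add_right_cancel h)
    have := hχ i
    have := hχ i'
    omega
  rw [← Finset.sum_image (f := I.wt) hinj]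
  refine Finset.sum_le_sum_of_subset ?_
  intro x hx
  obtain ⟨i, hi, rfl⟩ := Finset.mem_image.1 hx
  exact Finset.mem_range.2 (idx_lt hχ (Finset.mem_range.1 hi) hj)

/-- The rounded product is at least the true one, and exceeds it at most by the factor
`(1 + 1 / m) ^ n`. -/
theorem rounding (hI : I.Valid) {χ : ℕ → ℕ} (hχ : ∀ i, χ i < 2) {j : ℕ} (hj : j < I.D) :
    I.probProd χ j * ((I.m : ℝ) + 1) ^ I.W ≤
      ((I.gpow (I.expo χ I.n j) * I.hpow (I.W - I.expo χ I.n j) : ℕ) : ℝ) ∧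
    ((I.gpow (I.expo χ I.n j) * I.hpow (I.W - I.expo χ I.n j) : ℕ) : ℝ) ≤
      (((I.m : ℝ) + 1) / I.m) ^ I.n * I.probProd χ j * ((I.m : ℝ) + 1) ^ I.W := by
  -- A zero factor makes both sides vanish; otherwise the exponent has not been cut off.
  by_cases hz : ∃ i < I.n, I.num ((2 * i + χ i) * I.D + j) = 0
  · obtain ⟨i, hi, h0⟩ := hz
    have h1 : I.probProd χ j = 0 :=
      Finset.prod_eq_zero (Finset.mem_range.2 hi) (by simp [prob, h0])
    have h2 : I.expo χ I.n j = I.W + 1 := by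
      refine min_eq_right ?_
      refine le_trans ?_ (Finset.single_le_sum (fun _ _ => Nat.zero_le _) (Finset.mem_range.2 hi))
      rw [wz, if_pos h0]
      omega
    have h3 : I.gpow (I.W + 1) = 0 := if_neg (by omega)
    rw [h1, h2, h3]
    simp
  · push Not at hz
    have h1 : I.expo χ I.n j = ∑ i ∈ Finset.range I.n, I.wt ((2 * i + χ i) * I.D + j) := by
      have : ∑ i ∈ Finset.range I.n, I.wz ((2 * i + χ i) * I.D + j) =
          ∑ i ∈ Finset.range I.n, I.wt ((2 * i + χ i) * I.D + j) := by
        refine Finset.sum_congr rfl fun i hi => ?_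
        rw [wz, if_neg (hz i (Finset.mem_range.1 hi)), zero_mul, add_zero]
      rw [expo, this]
      exact min_eq_left ((sum_wt_le hχ hj).trans (Nat.le_succ _))
    have h2 : I.expo χ I.n j ≤ I.W := h1 ▸ sum_wt_le hχ hj
    have h3 : ((I.gpow (I.expo χ I.n j) * I.hpow (I.W - I.expo χ I.n j) : ℕ) : ℝ) =
        (∏ i ∈ Finset.range I.n, ((I.m : ℝ) / (I.m + 1)) ^ I.wt ((2 * i + χ i) * I.D + j)) *
          ((I.m : ℝ) + 1) ^ I.W := by
      rw [Finset.prod_pow_eq_pow_sum, ← h1, gpow, if_pos h2, hpow, if_pos (Nat.sub_le _ _),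
        div_pow, div_mul_eq_mul_div, eq_div_iff (by positivity)]
      push_cast
      rw [mul_assoc, ← pow_add, Nat.sub_add_cancel h2]
    rw [h3]
    refine ⟨?_, ?_⟩
    · gcongr
      exact Finset.prod_le_prod (fun _ _ => prob_nonneg _)
        fun i hi => prob_le_pow hI (idx_lt hχ (Finset.mem_range.1 hi) hj)
    · gcongr
      calc _ ≤ ∏ i ∈ Finset.range I.n,
            I.prob ((2 * i + χ i) * I.D + j) * (((I.m : ℝ) + 1) / I.m) :=
            Finset.prod_le_prod (fun _ _ => by positivity) fun i hi =>
              pow_le_prob hI (idx_lt hχ (Finset.mem_range.1 hi) hj) (hz i (Finset.mem_range.1 hi))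
        _ = _ := by
            rw [Finset.prod_mul_distrib, Finset.prod_const, Finset.card_range, mul_comm]
            rfl

/-- Decisions whose rounded cost is not larger are nearly as good for the true cost. -/
theorem approx (hI : I.Valid) {ε base scale : ℝ} {gap : ℕ → ℝ}
    (hε : (((I.m : ℝ) + 1) / I.m) ^ I.n ≤ 1 + ε) (hε0 : 0 ≤ ε) (hbase : 0 ≤ base)
    (hscale : 0 < scale) (hgap : ∀ j < I.D, (I.coef j : ℝ) = scale * gap j)
    {χ χ' : ℕ → ℕ} (hχ : ∀ i, χ i < 2) (hχ' : ∀ i, χ' i < 2) (h : I.selCost χ ≤ I.selCost χ') :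
    base + ∑ j ∈ Finset.range I.D, gap j * I.probProd χ j ≤
      (1 + ε) * (base + ∑ j ∈ Finset.range I.D, gap j * I.probProd χ' j) := by
  have hw : (0 : ℝ) < ((I.m : ℝ) + 1) ^ I.W := by positivity
  have lower : (scale * ∑ j ∈ Finset.range I.D, gap j * I.probProd χ j) * ((I.m : ℝ) + 1) ^ I.W ≤
      I.selCost χ := by
    rw [Finset.mul_sum, Finset.sum_mul, selCost, Nat.cast_sum]
    refine Finset.sum_le_sum fun j hj => ?_
    have hj := Finset.mem_range.1 hj
    rw [Nat.cast_mul, ← mul_assoc, ← hgap j hj, mul_assoc]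
    exact mul_le_mul_of_nonneg_left (rounding hI hχ hj).1 (Nat.cast_nonneg _)
  have upper : (I.selCost χ' : ℝ) ≤ (1 + ε) *
      ((scale * ∑ j ∈ Finset.range I.D, gap j * I.probProd χ' j) * ((I.m : ℝ) + 1) ^ I.W) := by
    rw [Finset.mul_sum, Finset.sum_mul, Finset.mul_sum, selCost, Nat.cast_sum]
    refine Finset.sum_le_sum fun j hj => ?_
    have hj := Finset.mem_range.1 hj
    rw [Nat.cast_mul, ← mul_assoc scale, ← hgap j hj]
    calc (I.coef j : ℝ) * _ ≤ I.coef j * ((1 + ε) * I.probProd χ' j * ((I.m : ℝ) + 1) ^ I.W) := by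
          refine mul_le_mul_of_nonneg_left ((rounding hI hχ' hj).2.trans ?_) (Nat.cast_nonneg _)
          have := probProd_nonneg (I := I) χ' j
          gcongr
      _ = _ := by ring
  have h' : (I.selCost χ : ℝ) ≤ I.selCost χ' := by exact_mod_cast h
  have key := lower.trans (h'.trans upper)
  set a := ∑ j ∈ Finset.range I.D, gap j * I.probProd χ j
  set b := ∑ j ∈ Finset.range I.D, gap j * I.probProd χ' j
  have : scale * ((I.m : ℝ) + 1) ^ I.W * a ≤ scale * ((I.m : ℝ) + 1) ^ I.W * ((1 + ε) * b) := by
    linarith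
  have := le_of_mul_le_mul_left this (by positivity)
  nlinarith

end Data

/-! ### Bounds in terms of the input size -/

theorem sum_map_eq_sum_range (f : ℕ → ℕ) (l : List ℕ) :
    (l.map f).sum = ∑ i ∈ Finset.range l.length, f (l.getD i 0) := by
  induction l with
  | nil => simp
  | cons a l ih =>
    rw [List.map_cons, List.sum_cons, List.length_cons, Finset.sum_range_succ', ih, add_comm]
    simp

theorem sum_digits_le_of_injOn (l : List ℕ) {X : ℕ} {h : ℕ → ℕ}
    (hinj : Set.InjOn h (Finset.range X)) (hlt : ∀ x < X, h x < l.length) :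
    ∑ x ∈ Finset.range X, digits (l.getD (h x) 0) ≤ (l.map digits).sum := by
  rw [sum_map_eq_sum_range, ← Finset.sum_image (f := fun i => digits (l.getD i 0)) hinj]
  refine Finset.sum_le_sum_of_subset ?_
  intro y hy
  obtain ⟨x, hx, rfl⟩ := Finset.mem_image.1 hy
  exact Finset.mem_range.2 (hlt x (Finset.mem_range.1 hx))

theorem getD_lt_two_pow (l : List ℕ) (i : ℕ) : l.getD i 0 < 2 ^ (l.map digits).sum := by
  by_cases hi : i < l.length
  · rw [← Nat.size_le]
    calc Nat.size (l.getD i 0) ≤ digits (l.getD i 0) := le_max_right _ _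
      _ ≤ _ := by
        rw [sum_map_eq_sum_range]
        exact Finset.single_le_sum (f := fun i => digits (l.getD i 0)) (fun _ _ => Nat.zero_le _)
          (Finset.mem_range.2 hi)
  · rw [List.getD_eq_default _ _ (not_lt.1 hi)]
    positivity

theorem length_le_sum_digits (l : List ℕ) : l.length ≤ (l.map digits).sum := by
  rw [sum_map_eq_sum_range]
  calc l.length = ∑ i ∈ Finset.range l.length, 1 := by simp
    _ ≤ _ := Finset.sum_le_sum fun i _ => le_max_left _ _

namespace Data

/-- The data come from an input with `N` bits and from an accuracy with `⌊1 / ε⌋ + 1 = q`. -/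
structure Sized (I : Data) (N q : ℕ) : Prop where
  n_pos : 0 < I.n
  n_le : I.n ≤ N
  D_le : I.D ≤ N
  cap_le : I.cap ≤ N
  q_pos : 0 < q
  m_eq : I.m = 2 * I.n * q
  num_lt : ∀ x < 2 * I.n * I.D, I.num x < 2 ^ N
  den_lt : ∀ x < 2 * I.n * I.D, I.den x < 2 ^ N
  coef_lt : ∀ j < I.D, I.coef j < 2 ^ ((I.D + 2) * N)

/-- A bound for the number of digits of all numbers that occur in a run. -/
noncomputable def bitBound (I : Data) (N : ℕ) : ℕ :=
  (I.D + 3) * N + 2 * I.m * (I.W + 1) + (2 * ((I.n + 2) * I.S) + 2) + 2 * I.n * I.D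

variable {I : Data} {N q : ℕ}

theorem Sized.m_pos (h : I.Sized N q) : 0 < I.m := by
  rw [h.m_eq]
  have := h.n_pos
  have := h.q_pos
  positivity

theorem Sized.fits (h : I.Sized N q) {M : ℕ} (hM : I.bitBound N ≤ M) :
    I.Fits M (2 ^ ((I.D + 3) * N)) where
  m_pos := h.m_pos
  one_le := Nat.one_le_two_pow
  num_le x hx := (h.num_lt x hx).le.trans (Nat.pow_le_pow_right (by norm_num) (by nlinarith))
  den_le x hx := (h.den_lt x hx).le.trans (Nat.pow_le_pow_right (by norm_num) (by nlinarith))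
  coef_le := by
    calc ∑ j ∈ Finset.range I.D, I.coef j ≤ ∑ j ∈ Finset.range I.D, 2 ^ ((I.D + 2) * N) :=
          Finset.sum_le_sum fun j hj => (h.coef_lt j (Finset.mem_range.1 hj)).le
      _ = I.D * 2 ^ ((I.D + 2) * N) := by simp
      _ ≤ 2 ^ N * 2 ^ ((I.D + 2) * N) :=
          Nat.mul_le_mul_right _ (h.D_le.trans Nat.lt_two_pow_self.le)
      _ = 2 ^ ((I.D + 3) * N) := by rw [← pow_add]; congr 1; ring
  pow_le := by
    have h1 : (I.m + 1) ^ (I.W + 1) ≤ 2 ^ (I.m * (I.W + 1)) := by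
      rw [pow_mul]
      exact Nat.pow_le_pow_left (Nat.succ_le_of_lt Nat.lt_two_pow_self) _
    calc _ ≤ 2 ^ ((I.D + 3) * N) * (2 ^ (I.m * (I.W + 1)) * 2 ^ (I.m * (I.W + 1))) :=
          Nat.mul_le_mul_left _ (Nat.mul_le_mul h1 h1)
      _ = 2 ^ ((I.D + 3) * N + 2 * I.m * (I.W + 1)) := by
          rw [← pow_add, ← pow_add]; congr 1; ring
      _ ≤ _ := Nat.pow_le_pow_right (by norm_num) (by unfold bitBound at hM; omega)
  size_le := Nat.lt_two_pow_self.le.trans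
    (Nat.pow_le_pow_right (by norm_num) (by unfold bitBound at hM; omega))
  len_le := Nat.lt_two_pow_self.le.trans
    (Nat.pow_le_pow_right (by norm_num) (by unfold bitBound at hM; omega))

/-- A nonzero probability is at least `2 ^ (-s)`, where `s` is the number of digits of its
denominator, so its weight is at most `m s`. -/
theorem W_le (hm : 0 < I.m) : I.W ≤
    I.m * ∑ x ∈ Finset.range (2 * I.n * I.D), digits (I.den x) := by
  rw [W, Finset.mul_sum]
  exact Finset.sum_le_sum fun x _ => (weight_le hm _ _).trans
    (Nat.mul_le_mul_left _ (le_max_right _ _))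

/-- The number of steps, up to a constant factor. -/
noncomputable def volume (I : Data) : ℕ :=
  1 + 2 * I.n * I.D + I.W + I.n * I.S + I.S + I.n

theorem Sized.W_le_pow (h : I.Sized N q) (hN : 0 < N) {Q : ℕ} (hQ : N + q + 1 ≤ Q) :
    I.m ≤ Q ^ 3 ∧ I.W ≤ Q ^ 7 := by
  have hq := h.q_pos
  have hn := h.n_le
  have hD := h.D_le
  have hm : I.m ≤ Q ^ 3 := by
    rw [h.m_eq]
    calc 2 * I.n * q ≤ Q * Q * Q := by gcongr <;> omega
      _ = Q ^ 3 := by ring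
  refine ⟨hm, ?_⟩
  calc I.W ≤ ∑ x ∈ Finset.range (2 * I.n * I.D), I.m * N := by
        refine Finset.sum_le_sum fun x hx => (weight_le h.m_pos _ _).trans
          (Nat.mul_le_mul_left _ ?_)
        exact Nat.size_le.2 (h.den_lt x (Finset.mem_range.1 hx))
    _ = 2 * I.n * I.D * (I.m * N) := by simp
    _ ≤ Q * Q * Q * (Q ^ 3 * Q) := by gcongr <;> omega
    _ = Q ^ 7 := by ring

theorem Sized.S_le_pow (h : I.Sized N q) (hN : 0 < N) {Q : ℕ} (hQ : N + q + 1 ≤ Q) :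
    I.S ≤ Q ^ (8 * I.D + 1) := by
  have hW := (h.W_le_pow hN hQ).2
  have hcap := h.cap_le
  have hq := h.q_pos
  have h7 : 2 ≤ Q ^ 7 := (show 2 ≤ Q by omega).trans (Nat.le_self_pow (by norm_num) Q)
  calc I.S = (I.cap + 1) * (I.W + 2) ^ I.D := rfl
    _ ≤ Q * (2 * Q ^ 7) ^ I.D := by gcongr <;> omega
    _ ≤ Q * (Q * Q ^ 7) ^ I.D := by gcongr; omega
    _ = Q ^ (8 * I.D + 1) := by rw [← pow_succ', ← pow_mul, ← pow_succ']

theorem Sized.volume_le_pow (h : I.Sized N q) (hN : 0 < N) {Q : ℕ} (hQ : N + q + 1 ≤ Q) :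
    I.volume ≤ Q ^ (8 * I.D + 11) := by
  have hW := (h.W_le_pow hN hQ).2
  have hS := h.S_le_pow hN hQ
  have hq := h.q_pos
  have hn := h.n_le
  have hD := h.D_le
  have hQ2 : 2 ≤ Q := by omega
  have mono : ∀ {a b : ℕ}, a ≤ b → Q ^ a ≤ Q ^ b := fun h => Nat.pow_le_pow_right (by omega) h
  have h1 : 1 ≤ Q ^ (8 * I.D + 8) := Nat.one_le_pow _ _ (by omega)
  have h2 : 2 * I.n * I.D ≤ Q ^ (8 * I.D + 8) := by
    calc 2 * I.n * I.D ≤ Q * Q * Q := by gcongr <;> omega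
      _ = Q ^ 3 := by ring
      _ ≤ _ := mono (by omega)
  have h3 : I.n * I.S ≤ Q ^ (8 * I.D + 8) := by
    calc I.n * I.S ≤ Q * Q ^ (8 * I.D + 1) := by gcongr; omega
      _ = Q ^ (8 * I.D + 2) := by ring
      _ ≤ _ := mono (by omega)
  have h4 : I.n ≤ Q ^ (8 * I.D + 8) :=
    (show I.n ≤ Q by omega).trans (Nat.le_self_pow (by omega) Q)
  have h5 := hW.trans (mono (show 7 ≤ 8 * I.D + 8 by omega))
  have h6 := hS.trans (mono (show 8 * I.D + 1 ≤ 8 * I.D + 8 by omega))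
  calc I.volume ≤ 2 * 2 * 2 * Q ^ (8 * I.D + 8) := by unfold volume; omega
    _ ≤ Q * Q * Q * Q ^ (8 * I.D + 8) := by gcongr
    _ = _ := by ring

theorem Sized.bitBound_le_pow (h : I.Sized N q) (hN : 0 < N) {Q : ℕ} (hQ : N + q + 1 ≤ Q) :
    I.bitBound N ≤ Q ^ (8 * I.D + 15) := by
  obtain ⟨hm, hW⟩ := h.W_le_pow hN hQ
  have hS := h.S_le_pow hN hQ
  have hq := h.q_pos
  have hn := h.n_le
  have hD := h.D_le
  have hQ2 : 2 ≤ Q := by omega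
  have mono : ∀ {a b : ℕ}, a ≤ b → Q ^ a ≤ Q ^ b := fun h => Nat.pow_le_pow_right (by omega) h
  have h7 : 1 ≤ Q ^ 7 := Nat.one_le_pow _ _ (by omega)
  have h0 : 2 ≤ Q ^ (8 * I.D + 12) := hQ2.trans (Nat.le_self_pow (by omega) Q)
  have h1 : (I.D + 3) * N ≤ Q ^ (8 * I.D + 12) := by
    calc (I.D + 3) * N ≤ (2 * Q) * Q := by gcongr <;> omega
      _ ≤ (Q * Q) * Q := by gcongr
      _ = Q ^ 3 := by ring
      _ ≤ _ := mono (by omega)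
  have h2 : 2 * I.m * (I.W + 1) ≤ Q ^ (8 * I.D + 12) := by
    calc 2 * I.m * (I.W + 1) ≤ Q * Q ^ 3 * (2 * Q ^ 7) := by gcongr; omega
      _ ≤ Q * Q ^ 3 * (Q * Q ^ 7) := by gcongr
      _ = Q ^ 12 := by ring
      _ ≤ _ := mono (by omega)
  have h3 : 2 * ((I.n + 2) * I.S) ≤ Q ^ (8 * I.D + 12) := by
    calc 2 * ((I.n + 2) * I.S) ≤ Q * ((2 * Q) * Q ^ (8 * I.D + 1)) := by gcongr; omega
      _ ≤ Q * ((Q * Q) * Q ^ (8 * I.D + 1)) := by gcongr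
      _ = Q ^ (8 * I.D + 4) := by ring
      _ ≤ _ := mono (by omega)
  have h4 : 2 * I.n * I.D ≤ Q ^ (8 * I.D + 12) := by
    calc 2 * I.n * I.D ≤ Q * Q * Q := by gcongr <;> omega
      _ = Q ^ 3 := by ring
      _ ≤ _ := mono (by omega)
  calc I.bitBound N ≤ 2 * 2 * 2 * Q ^ (8 * I.D + 12) := by unfold bitBound; omega
    _ ≤ Q * Q * Q * Q ^ (8 * I.D + 12) := by gcongr
    _ = _ := by ring

end Data

/-- The data `J` describe the instance `I`: solutions correspond to decisions, and the cost is
`base + ∑ j, gap j * probProd j`, where the `gap j` are the coefficients divided by `scale`. -/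
structure Represents {P : MinProblem} (I : P.Inst) (J : Data) (base scale : ℝ) (gap : ℕ → ℝ) :
    Prop where
  base_nonneg : 0 ≤ base
  scale_pos : 0 < scale
  coef_eq : ∀ j < J.D, (J.coef j : ℝ) = scale * gap j
  valid : J.Valid
  nonempty : Nonempty (P.Sol I)
  decode : ∀ χ : ℕ → ℕ, (∀ i, χ i < 2) → J.count χ J.n = J.tgt → ∃ s : P.Sol I,
    (∀ σ : Mem, (∀ i < J.n, σ 1 i = χ i) → HasOutput σ (P.encodeSol I s)) ∧
    P.cost I s = base + ∑ j ∈ Finset.range J.D, gap j * J.probProd χ j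
  encode : ∀ s : P.Sol I, ∃ χ : ℕ → ℕ, (∀ i, χ i < 2) ∧ J.count χ J.n = J.tgt ∧
    P.cost I s = base + ∑ j ∈ Finset.range J.D, gap j * J.probProd χ j

theorem one_div_val_le {ε : Ratio} (hε : 0 < ε.val) :
    1 / ε.val ≤ ((ε.den / ε.num + 1 : ℕ) : ℝ) ∧ ((ε.den / ε.num + 1 : ℕ) : ℝ) ≤ 1 / ε.val + 1 := by
  have hd : (0 : ℝ) < ε.den := by exact_mod_cast ε.den_pos
  have hn : 0 < ε.num := by
    rcases Nat.eq_zero_or_pos ε.num with h | h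
    · simp [Ratio.val, h] at hε
    · exact h
  have hn' : (0 : ℝ) < ε.num := by exact_mod_cast hn
  have e : 1 / ε.val = (ε.den : ℝ) / ε.num := by rw [Ratio.val, one_div_div]
  rw [e]
  refine ⟨?_, ?_⟩
  · rw [div_le_iff₀ hn']
    exact_mod_cast (Nat.lt_mul_of_div_lt (Nat.lt_succ_self _) hn).le
  · push_cast
    gcongr
    exact Nat.cast_div_le

/-- The program halts with a `(1 + ε)`-approximate solution, within `K * volume` steps and at
quadratically larger logarithmic cost. -/
theorem Layout.exists_exec (P : MinProblem) (L : Layout) : ∃ K : ℕ, ∀ (I : P.Inst) (ε : Ratio)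
    (J : Data) (base scale : ℝ) (gap : ℕ → ℝ), 0 < ε.val →
    L.Reads J (fun i => (P.input I ε).getD i 0) → Represents I J base scale gap →
    J.Sized (P.inputSize I ε) (ε.den / ε.num + 1) →
    ∃ (σ : Mem) (t b : ℕ) (s : P.Sol I),
      Exec L.program (inputMem (P.input I ε)) σ t b ∧
      HasOutput σ (P.encodeSol I s) ∧
      (∀ s' : P.Sol I, P.cost I s ≤ (1 + ε.val) * P.cost I s') ∧
      t ≤ K * J.volume ∧
      b ≤ 2 * (J.bitBound (P.inputSize I ε) + K + 1) * t ^ 2 := by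
  obtain ⟨K, hK⟩ := L.exists_program_runs
  refine ⟨K + L.program.maxLit, fun I ε J base scale gap hε hL hR hS => ?_⟩
  set N := P.inputSize I ε with hN
  set M := J.bitBound N + (K + L.program.maxLit) with hM
  have hF := hS.fits (M := M) (by omega)
  have hB : Bdd M (inputMem (P.input I ε)) := by
    intro a i
    simp only [inputMem]
    split_ifs
    · refine (getD_lt_two_pow _ _).le.trans (Nat.pow_le_pow_right (by norm_num) ?_)
      change N ≤ M
      have : N ≤ (J.D + 3) * N := Nat.le_mul_of_pos_left _ (by omega)
      have : (J.D + 3) * N ≤ J.bitBound N := by unfold Data.bitBound; omega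
      omega
    · exact Nat.zero_le _
  obtain ⟨s₀⟩ := hR.nonempty
  obtain ⟨χ₀, hχ₀, hc₀, _⟩ := hR.encode s₀
  obtain ⟨σ, t, b, hx, ht, hb, _, χ, hχ, hout, hc, hopt⟩ := hK J _ M _ hL hF ⟨χ₀, hχ₀, hc₀⟩ hB
  obtain ⟨s, hs, hcost⟩ := hR.decode χ hχ hc
  refine ⟨σ, t, b, s, hx, hs σ hout, fun s' => ?_, ?_, ?_⟩
  · obtain ⟨χ', hχ', hc', hcost'⟩ := hR.encode s'
    rw [hcost, hcost']
    exact Data.approx hR.valid (pow_le_one_add hS.n_pos hε (one_div_val_le hε).1 hS.m_eq) hε.le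
      hR.base_nonneg hR.scale_pos hR.coef_eq hχ hχ' (hopt χ' hχ' hc')
  · exact ht.trans (Nat.mul_le_mul_right _ (by omega))
  · refine hb ?_
    calc L.program.maxLit ≤ M := by omega
      _ ≤ 2 ^ M := Nat.lt_two_pow_self.le

theorem add_add_one_le_mul {x y K : ℕ} (h : x ≤ y) (hy : 1 ≤ y) : x + K + 1 ≤ (K + 2) * y := by
  nlinarith

theorem Layout.isFPTAS {P : MinProblem} (L : Layout) (J : P.Inst → Ratio → Data)
    (base : P.Inst → ℝ)
    (scale : P.Inst → Ratio → ℝ) (gap : P.Inst → ℕ → ℝ)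
    (hL : ∀ I ε, L.Reads (J I ε) (fun i => (P.input I ε).getD i 0))
    (hR : ∀ I ε, Represents I (J I ε) (base I) (scale I ε) (gap I))
    (hS : ∀ I ε, 0 < ε.val → (J I ε).Sized (P.inputSize I ε) (ε.den / ε.num + 1)) :
    IsFPTAS P L.program := by
  obtain ⟨K, hK⟩ := L.exists_exec P
  obtain ⟨e, he⟩ : ∃ e, e = 8 * L.D + 15 + 2 * (8 * L.D + 11) := ⟨_, rfl⟩
  obtain ⟨C₀, hC₀⟩ : ∃ C₀, C₀ = 2 * (K + 2) * K ^ 2 := ⟨_, rfl⟩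
  refine ⟨C₀ * 4 ^ e + e, fun I ε hε => ?_⟩
  obtain ⟨σ, t, b, s, hx, ho, happ, ht, hb⟩ :=
    hK I ε (J I ε) _ _ _ hε (hL I ε) (hR I ε) (hS I ε hε)
  refine ⟨σ, t, b, s, hx, ho, happ, ?_⟩
  have hJ := hS I ε hε
  have hD : L.D = (J I ε).D := (hL I ε).D
  set N := P.inputSize I ε with hN
  set q := ε.den / ε.num + 1 with hq
  have hN1 : 0 < N := by
    have := length_le_sum_digits (P.input I ε)
    simp only [MinProblem.input, Ratio.encode, List.length_append, List.length_cons,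
      List.length_nil] at this
    have h2 : ((P.input I ε).map digits).sum = N := rfl
    simp only [MinProblem.input, Ratio.encode] at h2
    omega
  set Q := N + q + 1 with hQ
  have hvol := hJ.volume_le_pow hN1 (Q := Q) le_rfl
  have hbit := hJ.bitBound_le_pow hN1 (Q := Q) le_rfl
  rw [← hD] at hvol hbit
  have hQ1 : 1 ≤ Q := Nat.le_add_left _ _
  have hQr : (Q : ℝ) = N + q + 1 := by
    rw [hQ, Nat.cast_add, Nat.cast_add, Nat.cast_one]
  clear_value Q
  have hbQ : b ≤ C₀ * Q ^ e := by
    have h1 : 1 ≤ Q ^ (8 * L.D + 15) := Nat.one_le_pow _ _ hQ1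
    have h2 : (J I ε).bitBound N + K + 1 ≤ (K + 2) * Q ^ (8 * L.D + 15) :=
      add_add_one_le_mul hbit h1
    have h3 : t ≤ K * Q ^ (8 * L.D + 11) := ht.trans (Nat.mul_le_mul_left _ hvol)
    calc b ≤ 2 * ((J I ε).bitBound N + K + 1) * t ^ 2 := hb
      _ ≤ 2 * ((K + 2) * Q ^ (8 * L.D + 15)) * (K * Q ^ (8 * L.D + 11)) ^ 2 := by gcongr
      _ = C₀ * Q ^ e := by rw [hC₀, he]; ring
  have hN1' : (1 : ℝ) ≤ N := by exact_mod_cast hN1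
  have hεi : 0 < 1 / ε.val := one_div_pos.2 hε
  set y : ℝ := (N : ℝ) + 1 / ε.val with hy
  have hy1 : 1 ≤ y := by linarith
  have hQy : (Q : ℝ) ≤ 4 * y := by
    have := (one_div_val_le hε).2
    rw [← hq] at this
    rw [hQr]
    linarith
  calc (b : ℝ) ≤ C₀ * (Q : ℝ) ^ e := by exact_mod_cast hbQ
    _ ≤ C₀ * (4 * y) ^ e := by gcongr
    _ = (C₀ * 4 ^ e) * y ^ e := by rw [mul_pow, mul_assoc]
    _ ≤ ((C₀ * 4 ^ e + e : ℕ) : ℝ) * y ^ (C₀ * 4 ^ e + e) := by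
        push_cast
        gcongr
        · exact le_add_of_nonneg_right (Nat.cast_nonneg _)
        · exact Nat.le_add_left _ _

/-! ### Access to the input -/

theorem getD_append_add (l₁ l₂ : List ℕ) {m : ℕ} (h : l₁.length = m) (k : ℕ) :
    (l₁ ++ l₂).getD (m + k) 0 = l₂.getD k 0 := by
  rw [List.getD_append_right _ _ _ _ (by omega)]
  congr 1
  omega

theorem length_flatMap_finRange {n b : ℕ} {F : Fin n → List ℕ} (hF : ∀ i, (F i).length = b) :
    ((List.finRange n).flatMap F).length = n * b := by
  simp [List.length_flatMap, hF]

theorem getD_flatMap_finRange {n b : ℕ} {F : Fin n → List ℕ} (hF : ∀ i, (F i).length = b)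
    {i r : ℕ} (hi : i < n) (hr : r < b) :
    ((List.finRange n).flatMap F).getD (i * b + r) 0 = (F ⟨i, hi⟩).getD r 0 := by
  induction n generalizing i with
  | zero => omega
  | succ n ih =>
    rw [List.finRange_succ, List.flatMap_cons, List.flatMap_map]
    rcases i with _ | i
    · rw [List.getD_append _ _ _ _ (by rw [hF]; omega), zero_mul, zero_add]
      rfl
    · rw [show (i + 1) * b + r = b + (i * b + r) by ring, getD_append_add _ _ (hF 0)]
      exact ih (F := fun i => F i.succ) (fun i => hF i.succ) (Nat.lt_of_succ_lt_succ hi)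

theorem TailDist.length_encode {d : ℕ} (Y : TailDist d) :
    Y.encode.length = 2 * (d - 1) + 1 := by
  rw [TailDist.encode, List.length_append, length_flatMap_finRange (b := 2) (fun _ => rfl)]
  simp [mul_comm]

theorem TailDist.getD_encode {d : ℕ} (Y : TailDist d) {j : ℕ} (hj : j < d - 1) :
    Y.encode.getD (2 * j) 0 = (Y.tail ⟨j, hj⟩).num ∧
      Y.encode.getD (2 * j + 1) 0 = (Y.tail ⟨j, hj⟩).den := by
  have hlen : ((List.finRange (d - 1)).flatMap fun j => (Y.tail j).encode).length =
    (d - 1) * 2 := length_flatMap_finRange (b := 2) (fun _ => rfl)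
  rw [TailDist.encode, List.getD_append _ _ _ _ (by rw [hlen]; omega),
    List.getD_append _ _ _ _ (by rw [hlen]; omega), mul_comm 2 j]
  refine ⟨?_, ?_⟩
  · have := getD_flatMap_finRange (b := 2) (F := fun j => (Y.tail j).encode) (fun _ => rfl) hj
      (show 0 < 2 by norm_num)
    rwa [add_zero] at this
  · exact getD_flatMap_finRange (b := 2) (F := fun j => (Y.tail j).encode) (fun _ => rfl) hj
      (show 1 < 2 by norm_num)

/-- The difference `l_{j+1} - l_j`, multiplied by the product of all denominators of the `l_k`,
where the `l_k` are listed in `inp` from the position `o` on. -/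
def coefNat (inp : ℕ → ℕ) (o d j : ℕ) : ℕ :=
  inp (o + 2 * (j + 1)) * ((∏ k ∈ Finset.range d, inp (o + 2 * k + 1)) / inp (o + 2 * (j + 1) + 1))
    - inp (o + 2 * j) * ((∏ k ∈ Finset.range d, inp (o + 2 * k + 1)) / inp (o + 2 * j + 1))

/-- The expression for `coefNat`. -/
def coefE (o d j : ℕ) : Exp :=
  .read 0 (.lit (o + 2 * (j + 1))) *
      (Exp.prod d (fun k => .read 0 (.lit (o + 2 * k + 1))) / .read 0 (.lit (o + 2 * (j + 1) + 1)))
    - .read 0 (.lit (o + 2 * j)) *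
      (Exp.prod d (fun k => .read 0 (.lit (o + 2 * k + 1))) / .read 0 (.lit (o + 2 * j + 1)))

theorem eval_coefE (σ : Mem) (o d j : ℕ) : (coefE o d j).eval σ = coefNat (σ 0) o d j := by
  simp [coefE, coefNat]

/-- The product of all denominators of the `l_k`. -/
def scaleNat (inp : ℕ → ℕ) (o d : ℕ) : ℕ := ∏ k ∈ Finset.range d, inp (o + 2 * k + 1)

/-- The values `l` are listed in `inp` from the position `o` on. -/
structure LevelsAt {d : ℕ} (l : Fin d → Ratio) (inp : ℕ → ℕ) (o : ℕ) : Prop where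
  num : ∀ j : Fin d, inp (o + 2 * j) = (l j).num
  den : ∀ j : Fin d, inp (o + 2 * j + 1) = (l j).den

theorem LevelsAt.of_list {d : ℕ} (l : Fin d → Ratio) {L L₁ L₂ : List ℕ}
    (hL : L = L₁ ++ (List.finRange d).flatMap (fun j => (l j).encode) ++ L₂) :
    LevelsAt l (fun i => L.getD i 0) L₁.length := by
  have hlen : ((List.finRange d).flatMap fun j => (l j).encode).length = d * 2 :=
    length_flatMap_finRange (b := 2) (fun _ => rfl)
  have key : ∀ j : Fin d, ∀ r < 2, L.getD (L₁.length + (j * 2 + r)) 0 = (l j).encode.getD r 0 := by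
    intro j r hr
    have := j.2
    rw [hL, List.append_assoc, getD_append_add _ _ rfl,
      List.getD_append _ _ _ _ (by rw [hlen]; omega)]
    exact getD_flatMap_finRange (F := fun j => (l j).encode) (fun _ => rfl) j.2 hr
  refine ⟨fun j => ?_, fun j => ?_⟩
  · simpa [Ratio.encode, mul_comm] using key j 0 (by norm_num)
  · simpa [Ratio.encode, mul_comm, add_assoc] using key j 1 (by norm_num)

theorem LevelsAt.scale_pos {d : ℕ} {l : Fin d → Ratio} {inp : ℕ → ℕ} {o : ℕ}
    (h : LevelsAt l inp o) : 0 < scaleNat inp o d :=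
  Finset.prod_pos fun k hk => by
    rw [h.den ⟨k, Finset.mem_range.1 hk⟩]
    exact (l _).den_pos

theorem LevelsAt.cast_mul_div {d : ℕ} {l : Fin d → Ratio} {inp : ℕ → ℕ} {o : ℕ}
    (h : LevelsAt l inp o) {j : ℕ} (hj : j < d) :
    ((inp (o + 2 * j) * (scaleNat inp o d / inp (o + 2 * j + 1)) : ℕ) : ℝ) =
      scaleNat inp o d * level l j := by
  have hd : (inp (o + 2 * j + 1) : ℝ) ≠ 0 := by
    rw [h.den ⟨j, hj⟩]
    exact_mod_cast (l _).den_pos.ne'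
  have hdvd : inp (o + 2 * j + 1) ∣ scaleNat inp o d :=
    Finset.dvd_prod_of_mem (fun k => inp (o + 2 * k + 1)) (Finset.mem_range.2 hj)
  rw [Nat.cast_mul, Nat.cast_div hdvd hd, level, dif_pos hj, Ratio.val, ← h.num ⟨j, hj⟩,
    ← h.den ⟨j, hj⟩]
  ring

theorem LevelsAt.coef_eq {d : ℕ} {l : Fin d → Ratio} {inp : ℕ → ℕ} {o : ℕ}
    (h : LevelsAt l inp o) (hl : StrictMono fun j => (l j).val) {j : ℕ} (hj : j < d - 1) :
    (coefNat inp o d j : ℝ) = scaleNat inp o d * (level l (j + 1) - level l j) := by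
  have h1 := h.cast_mul_div (show j < d by omega)
  have h2 := h.cast_mul_div (show j + 1 < d by omega)
  have hle : level l j ≤ level l (j + 1) := by
    rw [level, level, dif_pos (by omega), dif_pos (by omega)]
    exact (hl (show (⟨j, by omega⟩ : Fin d) < ⟨j + 1, by omega⟩ by simp)).le
  rw [mul_sub, ← h1, ← h2, coefNat, Nat.cast_sub]
  · rfl
  · rw [← Nat.cast_le (α := ℝ)]
    refine (le_of_eq h1).trans (le_trans ?_ (le_of_eq h2.symm))
    exact mul_le_mul_of_nonneg_left hle (Nat.cast_nonneg _)

theorem coefNat_lt {inp : ℕ → ℕ} {N : ℕ} (h : ∀ i, inp i < 2 ^ N) (o : ℕ) {d : ℕ} (hd : 1 ≤ d)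
    (j : ℕ) : coefNat inp o d j < 2 ^ ((d - 1 + 2) * N) := by
  have h1 : scaleNat inp o d ≤ (2 ^ N) ^ d := by
    calc scaleNat inp o d ≤ ∏ k ∈ Finset.range d, 2 ^ N :=
          Finset.prod_le_prod' fun k _ => (h _).le
      _ = _ := by simp
  calc coefNat inp o d j
      ≤ inp (o + 2 * (j + 1)) * (scaleNat inp o d / inp (o + 2 * (j + 1) + 1)) := Nat.sub_le _ _
    _ ≤ inp (o + 2 * (j + 1)) * (2 ^ N) ^ d :=
        Nat.mul_le_mul_left _ ((Nat.div_le_self _ _).trans h1)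
    _ < 2 ^ N * (2 ^ N) ^ d := Nat.mul_lt_mul_of_pos_right (h _) (by positivity)
    _ = (2 ^ N) ^ (d + 1) := by rw [pow_succ']
    _ = 2 ^ ((d - 1 + 2) * N) := by
        rw [← pow_mul, mul_comm]
        congr 2
        omega

theorem Ratio.num_le_den {r : Ratio} (h : r.val ≤ 1) : r.num ≤ r.den := by
  have hd : (0 : ℝ) < r.den := by exact_mod_cast r.den_pos
  rw [Ratio.val, div_le_one hd] at h
  exact_mod_cast h

/-! ### Binary selection -/

/-- The parts of the program for binary selection. The counter is not used. -/
def binLayout (d : ℕ) : Layout where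
  D := d - 1
  n := .read 0 2
  num := .read 0 (.lit (3 + 2 * d) + .var rX / .lit (d - 1) * .lit (2 * (d - 1) + 1) +
    2 * (.var rX % .lit (d - 1)))
  den := .read 0 (.lit (3 + 2 * d) + .var rX / .lit (d - 1) * .lit (2 * (d - 1) + 1) +
    2 * (.var rX % .lit (d - 1)) + 1)
  cap := 0
  tgt := 0
  inc _ := 0
  coef := coefE 3 d

/-- The address of the numerator of the factor number `x`. -/
def binAddr (d x : ℕ) : ℕ := 3 + 2 * d + x / (d - 1) * (2 * (d - 1) + 1) + 2 * (x % (d - 1))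

/-- The data of the dynamic program read off the input `inp`. -/
def binData (d : ℕ) (inp : ℕ → ℕ) : Data where
  n := inp 2
  D := d - 1
  m := 2 * inp 2 * (inp 1 / inp 0 + 1)
  cap := 0
  tgt := 0
  num x := inp (binAddr d x)
  den x := inp (binAddr d x + 1)
  inc _ := 0
  coef := coefNat inp 3 d

theorem binLayout_reads (d : ℕ) (inp : ℕ → ℕ) : (binLayout d).Reads (binData d inp) inp where
  D := rfl
  n σ h := by rw [← h]; rfl
  m := rfl
  num σ h _ := by rw [← h]; rfl
  den σ h _ := by rw [← h]; rfl
  cap σ h := rfl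
  tgt σ h := rfl
  inc σ h s _ := rfl
  coef σ h j _ := by rw [← h]; exact eval_coefE σ 3 d j

namespace BinaryInstance

variable {d : ℕ} (I : BinaryInstance d)

theorem input_eq (ε : Ratio) : (minMinBinary d).input I ε = ε.encode ++ I.encode := rfl

theorem length_block (i : Fin I.n) :
    ((I.Y i 0).encode ++ (I.Y i 1).encode).length = 2 * (2 * (d - 1) + 1) := by
  rw [List.length_append, TailDist.length_encode, TailDist.length_encode]
  ring

theorem length_encode : I.encode.length = 1 + 2 * d + I.n * (2 * (2 * (d - 1) + 1)) := by
  rw [encode, List.length_append, List.length_append,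
    length_flatMap_finRange (b := 2) (fun _ => rfl), length_flatMap_finRange I.length_block]
  simp [mul_comm]

theorem getD_input (ε : Ratio) {i j : ℕ} (hi : i < I.n) (hj : j < d - 1) (s : Fin 2) :
    ((minMinBinary d).input I ε).getD (binAddr d ((2 * i + s) * (d - 1) + j)) 0 =
        ((I.Y ⟨i, hi⟩ s).tail ⟨j, hj⟩).num ∧
      ((minMinBinary d).input I ε).getD (binAddr d ((2 * i + s) * (d - 1) + j) + 1) 0 =
        ((I.Y ⟨i, hi⟩ s).tail ⟨j, hj⟩).den := by
  have h1 : ((2 * i + s) * (d - 1) + j) / (d - 1) = 2 * i + s := by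
    rw [mul_comm, Nat.mul_add_div (by omega), Nat.div_eq_of_lt hj, add_zero]
  have h2 : ((2 * i + s) * (d - 1) + j) % (d - 1) = j := by
    rw [mul_comm, Nat.mul_add_mod, Nat.mod_eq_of_lt hj]
  have hlen : (ε.encode ++ ([I.n] ++ (List.finRange d).flatMap (fun j => (I.l j).encode))).length
      = 3 + 2 * d := by
    rw [List.length_append, List.length_append,
      length_flatMap_finRange (b := 2) (fun _ => rfl)]
    simp [Ratio.encode]
    ring
  have key : ∀ r < 2 * (d - 1) + 1,
      ((minMinBinary d).input I ε).getD (3 + 2 * d + (2 * i + s) * (2 * (d - 1) + 1) + r) 0 =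
        (I.Y ⟨i, hi⟩ s).encode.getD r 0 := by
    intro r hr
    have e : (minMinBinary d).input I ε =
        (ε.encode ++ ([I.n] ++ (List.finRange d).flatMap (fun j => (I.l j).encode))) ++
          (List.finRange I.n).flatMap (fun i => (I.Y i 0).encode ++ (I.Y i 1).encode) := by
      rw [input_eq, encode, List.append_assoc, List.append_assoc, List.append_assoc]
    rw [e, add_assoc, getD_append_add _ _ hlen]
    have hs : (s : ℕ) = 0 ∨ (s : ℕ) = 1 := by omega
    rw [show (2 * i + (s : ℕ)) * (2 * (d - 1) + 1) + r =
      i * (2 * (2 * (d - 1) + 1)) + (s * (2 * (d - 1) + 1) + r) by ring,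
      getD_flatMap_finRange I.length_block hi (by rcases hs with hs | hs <;> rw [hs] <;> omega)]
    fin_cases s
    · rw [List.getD_append _ _ _ _ (by rw [TailDist.length_encode]; simpa using hr)]
      simp
    · simp only [Fin.mk_one, one_mul]
      rw [getD_append_add _ _ (TailDist.length_encode _)]
  rw [binAddr, h1, h2, add_assoc _ (2 * j), key _ (by omega), key _ (by omega)]
  exact (I.Y ⟨i, hi⟩ s).getD_encode hj

theorem levelsAt (ε : Ratio) :
    LevelsAt I.l (fun i => ((minMinBinary d).input I ε).getD i 0) 3 :=
  LevelsAt.of_list (L₁ := ε.encode ++ [I.n]) (L₂ := (List.finRange I.n).flatMap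
    (fun i => (I.Y i 0).encode ++ (I.Y i 1).encode)) I.l (by
      rw [input_eq, encode, List.append_assoc, List.append_assoc, List.append_assoc])

/-- The data of the dynamic program for an instance of binary selection. -/
noncomputable def data (ε : Ratio) : Data := binData d fun i => ((minMinBinary d).input I ε).getD i 0

theorem exists_of_lt {x : ℕ} (hx : x < 2 * I.n * (d - 1)) : ∃ i, ∃ _ : i < I.n, ∃ s : Fin 2,
    ∃ j, ∃ _ : j < d - 1, x = (2 * i + s) * (d - 1) + j := by
  have hd : 0 < d - 1 := by
    by_contra h
    rw [Nat.eq_zero_of_not_pos h] at hx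
    simp at hx
  have h1 : x / (d - 1) < 2 * I.n := Nat.div_lt_of_lt_mul (by rwa [mul_comm])
  refine ⟨x / (d - 1) / 2, by omega, ⟨x / (d - 1) % 2, Nat.mod_lt _ (by norm_num)⟩,
    x % (d - 1), Nat.mod_lt _ hd, ?_⟩
  rw [Nat.div_add_mod, Nat.div_add_mod']

theorem valid (ε : Ratio) : (I.data ε).Valid where
  m_pos := by
    have : 0 < I.n := I.n_pos
    exact Nat.mul_pos (Nat.mul_pos (by norm_num) this) (Nat.succ_pos _)
  den_pos x hx := by
    obtain ⟨i, hi, s, j, hj, rfl⟩ := I.exists_of_lt hx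
    exact (Ratio.den_pos _).trans_eq (I.getD_input ε hi hj s).2.symm
  num_le_den x hx := by
    obtain ⟨i, hi, s, j, hj, rfl⟩ := I.exists_of_lt hx
    obtain ⟨h1, h2⟩ := I.getD_input ε hi hj s
    exact (h1.le.trans (Ratio.num_le_den ((I.Y _ _).le_one _))).trans h2.ge

theorem bounds (ε : Ratio) (hd : 1 ≤ d) :
    I.n ≤ (minMinBinary d).inputSize I ε ∧ d - 1 ≤ (minMinBinary d).inputSize I ε := by
  have h1 := length_le_sum_digits ((minMinBinary d).input I ε)
  have h2 : ((minMinBinary d).input I ε).length = 2 + I.encode.length := by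
    rw [input_eq, List.length_append]
    rfl
  rw [h2, I.length_encode] at h1
  change _ ≤ (minMinBinary d).inputSize I ε at h1
  have : I.n ≤ I.n * (2 * (2 * (d - 1) + 1)) := Nat.le_mul_of_pos_right _ (by omega)
  omega

theorem sized (hd : 1 ≤ d) (ε : Ratio) :
    (I.data ε).Sized ((minMinBinary d).inputSize I ε) (ε.den / ε.num + 1) where
  n_pos := I.n_pos
  n_le := (I.bounds ε hd).1
  D_le := (I.bounds ε hd).2
  cap_le := Nat.zero_le _
  q_pos := Nat.succ_pos _
  m_eq := rfl
  num_lt _ _ := getD_lt_two_pow _ _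
  den_lt _ _ := getD_lt_two_pow _ _
  coef_lt j _ := coefNat_lt (getD_lt_two_pow _) 3 hd j

theorem prob_data (ε : Ratio) {i j : ℕ} (hi : i < I.n) (hj : j < d - 1) (s : Fin 2) :
    (I.data ε).prob ((2 * i + s) * (d - 1) + j) = (I.Y ⟨i, hi⟩ s).prGE (j + 1) := by
  obtain ⟨h1, h2⟩ := I.getD_input ε hi hj s
  rw [TailDist.prGE_succ _ hj, Ratio.val, ← h1, ← h2]
  rfl

theorem cost_eq (hd : 1 ≤ d) (ε : Ratio) {χ : ℕ → ℕ} {s : Fin I.n → Fin 2}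
    (h : ∀ i : Fin I.n, χ i = s i) : (minMinBinary d).cost I s = level I.l 0 +
      ∑ j ∈ Finset.range (I.data ε).D, (level I.l (j + 1) - level I.l j) *
        (I.data ε).probProd χ j := by
  have : Nonempty (Fin I.n) := ⟨⟨0, I.n_pos⟩⟩
  have e : (minMinBinary d).cost I s = expMin I.l fun i => I.Y i (s i) := rfl
  rw [e, expMin_eq hd I.l_strictMono]
  congr 1
  refine Finset.sum_congr rfl fun j hj => ?_
  congr 1
  have hp : (I.data ε).probProd χ j = ∏ i ∈ Finset.range I.n,
      (I.data ε).prob ((2 * i + χ i) * (d - 1) + j) := rfl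
  rw [hp, Finset.prod_range]
  refine Finset.prod_congr rfl fun i _ => ?_
  rw [h]
  exact (I.prob_data ε i.2 (Finset.mem_range.1 hj) (s i)).symm

theorem represents (hd : 1 ≤ d) (ε : Ratio) :
    Represents (P := minMinBinary d) I (I.data ε) (level I.l 0)
      (scaleNat (fun i => ((minMinBinary d).input I ε).getD i 0) 3 d)
      (fun j => level I.l (j + 1) - level I.l j) where
  base_nonneg := level_zero_nonneg _
  scale_pos := by
    have := (I.levelsAt ε).scale_pos
    exact Nat.cast_pos.2 this
  coef_eq j hj := (I.levelsAt ε).coef_eq I.l_strictMono hj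
  valid := I.valid ε
  nonempty := ⟨fun _ => 0⟩
  decode χ hχ _ := by
    refine ⟨fun i => ⟨χ i, hχ i⟩, fun σ hσ => ?_, I.cost_eq hd ε fun i => rfl⟩
    intro i hi
    simp only [minMinBinary, List.length_ofFn] at hi
    rw [hσ i hi]
    simp [minMinBinary]
  encode s := by
    refine ⟨fun i => if h : i < I.n then s ⟨i, h⟩ else 0, fun i => ?_, ?_, ?_⟩
    · beta_reduce
      split_ifs
      · exact Fin.is_lt _
      · norm_num
    · exact Nat.min_zero _
    · exact I.cost_eq hd ε fun i => by simp

end BinaryInstance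

/-! ### The number of steps for binary selection -/

theorem mul_add_injective {k a a' r r' : ℕ} (hr : r < k) (hr' : r' < k)
    (h : k * a + r = k * a' + r') : a = a' ∧ r = r' := by
  have hk : 0 < k := by omega
  have h1 := congrArg (· / k) h
  have h2 := congrArg (· % k) h
  simpa only [Nat.mul_add_div hk, Nat.div_eq_of_lt hr, Nat.div_eq_of_lt hr', add_zero] using
    And.intro h1 (by simpa only [Nat.mul_add_mod, Nat.mod_eq_of_lt hr, Nat.mod_eq_of_lt hr'] using h2)

namespace BinaryInstance

variable {d : ℕ} (I : BinaryInstance d)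

/-- The denominators stand at different places of the instance. -/
theorem sum_digits_den_le (ε : Ratio) :
    ∑ x ∈ Finset.range (2 * I.n * (d - 1)), digits ((I.data ε).den x) ≤
      (minMinBinary d).size I := by
  set h : ℕ → ℕ := fun x => 2 + 2 * d + x / (d - 1) * (2 * (d - 1) + 1) + 2 * (x % (d - 1)) with hh
  have e : ∀ x, (I.data ε).den x = I.encode.getD (h x) 0 := by
    intro x
    change ((minMinBinary d).input I ε).getD (binAddr d x + 1) 0 = _
    rw [input_eq, show binAddr d x + 1 = 2 + h x by simp only [binAddr, hh]; omega]
    exact getD_append_add _ _ rfl _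
  simp only [e]
  refine sum_digits_le_of_injOn _ (fun x hx y hy hxy => ?_) fun x hx => ?_
  · have hd : 0 < d - 1 := by
      by_contra h0
      rw [Nat.eq_zero_of_not_pos h0] at hx
      simp at hx
    have hx' := Nat.mod_lt x hd
    have hy' := Nat.mod_lt y hd
    have h1 : (2 * (d - 1) + 1) * (x / (d - 1)) + 2 * (x % (d - 1)) =
        (2 * (d - 1) + 1) * (y / (d - 1)) + 2 * (y % (d - 1)) := by
      simp only [hh] at hxy
      linarith
    obtain ⟨h2, h3⟩ := mul_add_injective (by omega) (by omega) h1
    rw [← Nat.div_add_mod x (d - 1), ← Nat.div_add_mod y (d - 1), h2,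
      show x % (d - 1) = y % (d - 1) by omega]
  · obtain ⟨i, hi, s, j, hj, rfl⟩ := I.exists_of_lt hx
    have h1 : ((2 * i + s) * (d - 1) + j) / (d - 1) = 2 * i + s := by
      rw [mul_comm, Nat.mul_add_div (by omega), Nat.div_eq_of_lt hj, add_zero]
    have h2 : ((2 * i + s) * (d - 1) + j) % (d - 1) = j := by
      rw [mul_comm, Nat.mul_add_mod, Nat.mod_eq_of_lt hj]
    simp only [hh]
    rw [h1, h2, I.length_encode]
    have : (2 * i + s + 1) * (2 * (d - 1) + 1) ≤ (2 * I.n) * (2 * (d - 1) + 1) :=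
      Nat.mul_le_mul_right _ (by omega)
    calc 2 + 2 * d + (2 * i + s) * (2 * (d - 1) + 1) + 2 * j
        < 1 + 2 * d + (2 * i + s + 1) * (2 * (d - 1) + 1) := by
          rw [add_mul _ 1]
          omega
      _ ≤ 1 + 2 * d + 2 * I.n * (2 * (d - 1) + 1) := by omega
      _ = _ := by ring

/-- There are `O((n N / ε) ^ (d - 1))` codes in each of the `n` layers, and this dominates all other
terms of the number of steps. -/
theorem volume_le (ε : Ratio) (hε : 0 < ε.val) (hε1 : ε.val ≤ 1) :
    ((I.data ε).volume : ℝ) ≤ ((2 * (d - 1) + 5) * 6 ^ (d - 1) : ℕ) *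
      (I.n * (I.n * (minMinBinary d).size I / ε.val) ^ (d - 1)) := by
  set J := I.data ε with hJ
  set D := d - 1 with hD
  set N := (minMinBinary d).size I with hN
  have hn : 0 < I.n := I.n_pos
  have hJn : J.n = I.n := rfl
  have hJD : J.D = D := rfl
  have hW : J.W ≤ J.m * N := (Data.W_le (I.valid ε).m_pos).trans
    (Nat.mul_le_mul_left _ (I.sum_digits_den_le ε))
  have hS : J.S = (J.W + 2) ^ D := by
    change (0 + 1) * (J.W + 2) ^ D = _
    rw [zero_add, one_mul]
  -- For `d = 1` there are no weights and just one code.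
  have hWS : J.W ≤ J.S := by
    rw [hS]
    rcases Nat.eq_zero_or_pos D with h | h
    · have : J.W = 0 := by
        rw [Data.W, hJD, h]
        simp
      omega
    · exact (Nat.le_add_right _ 2).trans (Nat.le_self_pow h.ne' _)
  have hvol : J.volume ≤ (2 * D + 5) * (I.n * J.S) := by
    have h1 : 0 < J.S := J.S_pos
    have h2 : I.n ≤ I.n * J.S := Nat.le_mul_of_pos_right _ h1
    have h3 : J.S ≤ I.n * J.S := Nat.le_mul_of_pos_left _ hn
    have h4 : I.n * D ≤ I.n * J.S * D := Nat.mul_le_mul_right _ h2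
    rw [Data.volume, hJn, hJD]
    nlinarith
  have hN1 : 1 ≤ N := by
    have := length_le_sum_digits I.encode
    rw [I.length_encode] at this
    change _ ≤ N at this
    omega
  have hNr : (1 : ℝ) ≤ N := by exact_mod_cast hN1
  have hnr : (1 : ℝ) ≤ I.n := by exact_mod_cast hn
  have hi : 1 ≤ 1 / ε.val := by rwa [le_div_iff₀ hε, one_mul]
  have hm : (J.m : ℝ) ≤ 4 * I.n * (1 / ε.val) := by
    have h1 : J.m = 2 * I.n * (ε.den / ε.num + 1) := rfl
    have h2 := (one_div_val_le hε).2
    rw [h1]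
    calc ((2 * I.n * (ε.den / ε.num + 1) : ℕ) : ℝ) = 2 * I.n * ((ε.den / ε.num + 1 : ℕ) : ℝ) := by
          push_cast
          ring
      _ ≤ 2 * I.n * (1 / ε.val + 1 / ε.val) := by
          gcongr
          linarith
      _ = _ := by ring
  have hB : ((J.W + 2 : ℕ) : ℝ) ≤ 6 * (I.n * N / ε.val) := by
    have hW' : (J.W : ℝ) ≤ J.m * N := by exact_mod_cast hW
    have h5 : (1 : ℝ) ≤ I.n * N * (1 / ε.val) := one_le_mul_of_one_le_of_one_le
      (one_le_mul_of_one_le_of_one_le hnr hNr) hi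
    calc ((J.W + 2 : ℕ) : ℝ) ≤ J.m * N + 2 := by push_cast; linarith
      _ ≤ 4 * I.n * (1 / ε.val) * N + 2 * (I.n * N * (1 / ε.val)) := by
          have := mul_le_mul_of_nonneg_right hm (zero_le_one.trans hNr)
          linarith
      _ = _ := by ring
  calc (J.volume : ℝ) ≤ (((2 * D + 5) * (I.n * J.S) : ℕ) : ℝ) := by exact_mod_cast hvol
    _ = (2 * D + 5 : ℕ) * (I.n * ((J.W + 2 : ℕ) : ℝ) ^ D) := by
        rw [hS]
        push_cast
        ring
    _ ≤ (2 * D + 5 : ℕ) * (I.n * (6 * (I.n * N / ε.val)) ^ D) := by gcongr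
    _ = _ := by
        rw [mul_pow]
        push_cast
        ring

end BinaryInstance

/-! ### Subset selection -/

/-- The parts of the program for subset selection: the decision `1` selects a variable, and the
decision `0` contributes the factors `1`. The counter is the number of selected variables. -/
def subLayout (d : ℕ) : Layout where
  D := d - 1
  n := .read 0 2
  num := .var rX / .lit (d - 1) % 2 *
      .read 0 (.lit (4 + 2 * d) + .var rX / .lit (d - 1) / 2 * .lit (2 * (d - 1) + 1) +
        2 * (.var rX % .lit (d - 1))) + (1 - .var rX / .lit (d - 1) % 2)
  den := .var rX / .lit (d - 1) % 2 *
      .read 0 (.lit (4 + 2 * d) + .var rX / .lit (d - 1) / 2 * .lit (2 * (d - 1) + 1) +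
        2 * (.var rX % .lit (d - 1)) + 1) + (1 - .var rX / .lit (d - 1) % 2)
  cap := .read 0 2
  tgt := .read 0 3
  inc s := .lit s
  coef := coefE 4 d

/-- The address of the numerator of the factor number `x`, if the variable is selected. -/
def subAddr (d x : ℕ) : ℕ := 4 + 2 * d + x / (d - 1) / 2 * (2 * (d - 1) + 1) + 2 * (x % (d - 1))

/-- The data of the dynamic program read off the input `inp`. -/
def subData (d : ℕ) (inp : ℕ → ℕ) : Data where
  n := inp 2
  D := d - 1
  m := 2 * inp 2 * (inp 1 / inp 0 + 1)
  cap := inp 2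
  tgt := inp 3
  num x := x / (d - 1) % 2 * inp (subAddr d x) + (1 - x / (d - 1) % 2)
  den x := x / (d - 1) % 2 * inp (subAddr d x + 1) + (1 - x / (d - 1) % 2)
  inc s := s
  coef := coefNat inp 4 d

theorem subLayout_reads (d : ℕ) (inp : ℕ → ℕ) : (subLayout d).Reads (subData d inp) inp where
  D := rfl
  n σ h := by rw [← h]; rfl
  m := rfl
  num σ h _ := by rw [← h]; rfl
  den σ h _ := by rw [← h]; rfl
  cap σ h := by rw [← h]; rfl
  tgt σ h := by rw [← h]; rfl
  inc σ h s _ := rfl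
  coef σ h j _ := by rw [← h]; exact eval_coefE σ 4 d j

namespace SubsetInstance

variable {d : ℕ} (I : SubsetInstance d)

theorem input_eq (ε : Ratio) : (minMinSubset d).input I ε = ε.encode ++ I.encode := rfl

theorem length_encode : I.encode.length = 2 + 2 * d + I.n * (2 * (d - 1) + 1) := by
  rw [encode, List.length_append, List.length_append,
    length_flatMap_finRange (b := 2) (fun _ => rfl),
    length_flatMap_finRange fun i => (I.Y i).length_encode]
  simp [mul_comm]

theorem getD_input (ε : Ratio) {i j : ℕ} (hi : i < I.n) (hj : j < d - 1) :
    ((minMinSubset d).input I ε).getD (4 + 2 * d + i * (2 * (d - 1) + 1) + 2 * j) 0 =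
        ((I.Y ⟨i, hi⟩).tail ⟨j, hj⟩).num ∧
      ((minMinSubset d).input I ε).getD (4 + 2 * d + i * (2 * (d - 1) + 1) + 2 * j + 1) 0 =
        ((I.Y ⟨i, hi⟩).tail ⟨j, hj⟩).den := by
  have hlen : (ε.encode ++ ([I.n, I.k] ++
      (List.finRange d).flatMap (fun j => (I.l j).encode))).length = 4 + 2 * d := by
    rw [List.length_append, List.length_append,
      length_flatMap_finRange (b := 2) (fun _ => rfl)]
    simp [Ratio.encode]
    ring
  have key : ∀ r < 2 * (d - 1) + 1,
      ((minMinSubset d).input I ε).getD (4 + 2 * d + i * (2 * (d - 1) + 1) + r) 0 =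
        (I.Y ⟨i, hi⟩).encode.getD r 0 := by
    intro r hr
    have e : (minMinSubset d).input I ε =
        (ε.encode ++ ([I.n, I.k] ++ (List.finRange d).flatMap (fun j => (I.l j).encode))) ++
          (List.finRange I.n).flatMap (fun i => (I.Y i).encode) := by
      rw [input_eq, encode, List.append_assoc, List.append_assoc, List.append_assoc]
    rw [e, add_assoc, getD_append_add _ _ hlen]
    exact getD_flatMap_finRange (fun i => (I.Y i).length_encode) hi hr
  rw [add_assoc _ (2 * j), key _ (by omega), key _ (by omega)]
  exact (I.Y ⟨i, hi⟩).getD_encode hj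

theorem levelsAt (ε : Ratio) :
    LevelsAt I.l (fun i => ((minMinSubset d).input I ε).getD i 0) 4 :=
  LevelsAt.of_list (L₁ := ε.encode ++ [I.n, I.k])
    (L₂ := (List.finRange I.n).flatMap (fun i => (I.Y i).encode)) I.l (by
      rw [input_eq, encode, List.append_assoc, List.append_assoc, List.append_assoc])

/-- The data of the dynamic program for an instance of subset selection. -/
noncomputable def data (ε : Ratio) : Data :=
  subData d fun i => ((minMinSubset d).input I ε).getD i 0

theorem data_num_den (ε : Ratio) {i j s : ℕ} (hi : i < I.n) (hj : j < d - 1) (hs : s < 2) :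
    (I.data ε).num ((2 * i + s) * (d - 1) + j) =
        (if s = 1 then ((I.Y ⟨i, hi⟩).tail ⟨j, hj⟩).num else 1) ∧
      (I.data ε).den ((2 * i + s) * (d - 1) + j) =
        (if s = 1 then ((I.Y ⟨i, hi⟩).tail ⟨j, hj⟩).den else 1) := by
  have h1 : ((2 * i + s) * (d - 1) + j) / (d - 1) = 2 * i + s := by
    rw [mul_comm, Nat.mul_add_div (by omega), Nat.div_eq_of_lt hj, add_zero]
  have h2 : ((2 * i + s) * (d - 1) + j) % (d - 1) = j := by
    rw [mul_comm, Nat.mul_add_mod, Nat.mod_eq_of_lt hj]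
  have h3 : (2 * i + s) / 2 = i := by omega
  have h4 : (2 * i + s) % 2 = s := by omega
  simp only [data, subData, subAddr, h1, h2, h3, h4]
  rw [(I.getD_input ε hi hj).1, (I.getD_input ε hi hj).2]
  interval_cases s <;> simp

theorem exists_of_lt {x : ℕ} (hx : x < 2 * I.n * (d - 1)) : ∃ i, ∃ _ : i < I.n, ∃ s < 2,
    ∃ j, ∃ _ : j < d - 1, x = (2 * i + s) * (d - 1) + j := by
  have hd : 0 < d - 1 := by
    by_contra h
    rw [Nat.eq_zero_of_not_pos h] at hx
    simp at hx
  have h1 : x / (d - 1) < 2 * I.n := Nat.div_lt_of_lt_mul (by rwa [mul_comm])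
  refine ⟨x / (d - 1) / 2, by omega, x / (d - 1) % 2, Nat.mod_lt _ (by norm_num),
    x % (d - 1), Nat.mod_lt _ hd, ?_⟩
  rw [Nat.div_add_mod, Nat.div_add_mod']

theorem n_pos : 0 < I.n := I.k_pos.trans_le I.k_le

theorem valid (ε : Ratio) : (I.data ε).Valid where
  m_pos := Nat.mul_pos (Nat.mul_pos (by norm_num) I.n_pos) (Nat.succ_pos _)
  den_pos x hx := by
    obtain ⟨i, hi, s, hs, j, hj, rfl⟩ := I.exists_of_lt hx
    rw [(I.data_num_den ε hi hj hs).2]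
    split_ifs
    exacts [Ratio.den_pos _, one_pos]
  num_le_den x hx := by
    obtain ⟨i, hi, s, hs, j, hj, rfl⟩ := I.exists_of_lt hx
    rw [(I.data_num_den ε hi hj hs).1, (I.data_num_den ε hi hj hs).2]
    split_ifs
    exacts [Ratio.num_le_den ((I.Y _).le_one _), le_rfl]

theorem bounds (ε : Ratio) (hd : 1 ≤ d) :
    I.n ≤ (minMinSubset d).inputSize I ε ∧ d ≤ (minMinSubset d).inputSize I ε := by
  have h1 := length_le_sum_digits ((minMinSubset d).input I ε)
  have h2 : ((minMinSubset d).input I ε).length = 2 + I.encode.length := by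
    rw [input_eq, List.length_append]
    rfl
  rw [h2, I.length_encode] at h1
  change _ ≤ (minMinSubset d).inputSize I ε at h1
  have : I.n ≤ I.n * (2 * (d - 1) + 1) := Nat.le_mul_of_pos_right _ (by omega)
  omega

theorem sized (hd : 1 ≤ d) (ε : Ratio) :
    (I.data ε).Sized ((minMinSubset d).inputSize I ε) (ε.den / ε.num + 1) where
  n_pos := I.n_pos
  n_le := (I.bounds ε hd).1
  D_le := (Nat.sub_le _ _).trans (I.bounds ε hd).2
  cap_le := (I.bounds ε hd).1
  q_pos := Nat.succ_pos _
  m_eq := rfl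
  num_lt x hx := by
    have h1 : 1 < 2 ^ (minMinSubset d).inputSize I ε :=
      Nat.one_lt_two_pow (by have := (I.bounds ε hd).2; omega)
    obtain ⟨i, hi, s, hs, j, hj, rfl⟩ := I.exists_of_lt hx
    rw [(I.data_num_den ε hi hj hs).1, ← (I.getD_input ε hi hj).1]
    split_ifs
    exacts [getD_lt_two_pow _ _, h1]
  den_lt x hx := by
    have h1 : 1 < 2 ^ (minMinSubset d).inputSize I ε :=
      Nat.one_lt_two_pow (by have := (I.bounds ε hd).2; omega)
    obtain ⟨i, hi, s, hs, j, hj, rfl⟩ := I.exists_of_lt hx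
    rw [(I.data_num_den ε hi hj hs).2, ← (I.getD_input ε hi hj).2]
    split_ifs
    exacts [getD_lt_two_pow _ _, h1]
  coef_lt j _ := coefNat_lt (getD_lt_two_pow _) 4 hd j

theorem prob_data (ε : Ratio) {i j s : ℕ} (hi : i < I.n) (hj : j < d - 1) (hs : s < 2) :
    (I.data ε).prob ((2 * i + s) * (d - 1) + j) =
      if s = 1 then (I.Y ⟨i, hi⟩).prGE (j + 1) else 1 := by
  rw [Data.prob, (I.data_num_den ε hi hj hs).1, (I.data_num_den ε hi hj hs).2,
    TailDist.prGE_succ _ hj, Ratio.val]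
  split_ifs <;> simp

theorem cost_eq (hd : 1 ≤ d) (ε : Ratio) {χ : ℕ → ℕ} (hχ : ∀ i, χ i < 2)
    (S : (minMinSubset d).Sol I) (h : ∀ i : Fin I.n, χ i = 1 ↔ i ∈ S.1) :
    (minMinSubset d).cost I S = level I.l 0 +
      ∑ j ∈ Finset.range (I.data ε).D, (level I.l (j + 1) - level I.l j) *
        (I.data ε).probProd χ j := by
  have hne : S.1.Nonempty := Finset.card_pos.1 (S.2.symm ▸ I.k_pos)
  have : Nonempty {i // i ∈ S.1} := hne.to_subtype
  have e : (minMinSubset d).cost I S = expMin I.l fun i : {i // i ∈ S.1} => I.Y i.1 := rfl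
  rw [e, expMin_eq hd I.l_strictMono]
  congr 1
  refine Finset.sum_congr rfl fun j hj => ?_
  congr 1
  have hp : (I.data ε).probProd χ j = ∏ i ∈ Finset.range I.n,
      (I.data ε).prob ((2 * i + χ i) * (d - 1) + j) := rfl
  rw [hp, Finset.prod_range, Finset.prod_coe_sort S.1 fun i => (I.Y i).prGE (j + 1),
    Finset.prod_congr rfl fun (i : Fin I.n) _ =>
      I.prob_data ε i.2 (Finset.mem_range.1 hj) (hχ i)]
  simp only [h, Finset.prod_ite_mem, Finset.univ_inter]

theorem count_data (ε : Ratio) {χ : ℕ → ℕ} (hχ : ∀ i, χ i < 2) :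
    (I.data ε).count χ I.n = (Finset.univ.filter fun i : Fin I.n => χ i = 1).card := by
  have h1 : (I.data ε).count χ I.n = min (∑ i ∈ Finset.range I.n, χ i) I.n := rfl
  have h2 : ∑ i ∈ Finset.range I.n, χ i =
      (Finset.univ.filter fun i : Fin I.n => χ i = 1).card := by
    rw [Finset.sum_range, Finset.card_filter]
    refine Finset.sum_congr rfl fun i _ => ?_
    have := hχ i
    split_ifs <;> omega
  rw [h1, h2]
  refine min_eq_left ((Finset.card_le_univ _).trans_eq (Fintype.card_fin _))

theorem represents (hd : 1 ≤ d) (ε : Ratio) :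
    Represents (P := minMinSubset d) I (I.data ε) (level I.l 0)
      (scaleNat (fun i => ((minMinSubset d).input I ε).getD i 0) 4 d)
      (fun j => level I.l (j + 1) - level I.l j) where
  base_nonneg := level_zero_nonneg _
  scale_pos := Nat.cast_pos.2 (I.levelsAt ε).scale_pos
  coef_eq j hj := (I.levelsAt ε).coef_eq I.l_strictMono hj
  valid := I.valid ε
  nonempty := by
    obtain ⟨S, _, hS⟩ := Finset.exists_subset_card_eq
      (show I.k ≤ (Finset.univ : Finset (Fin I.n)).card by simpa using I.k_le)
    exact ⟨⟨S, hS⟩⟩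
  decode χ hχ hc := by
    have hcard : (Finset.univ.filter fun i : Fin I.n => χ i = 1).card = I.k :=
      (I.count_data ε hχ).symm.trans hc
    refine ⟨⟨_, hcard⟩, fun σ hσ => ?_, I.cost_eq hd ε hχ _ fun i => by simp⟩
    intro i hi
    simp only [minMinSubset, List.length_ofFn] at hi
    rw [hσ i hi]
    have := hχ i
    simp only [minMinSubset, List.getElem_ofFn, Finset.mem_filter, Finset.mem_univ, true_and]
    split_ifs <;> omega
  encode S := by
    set χ : ℕ → ℕ := fun i => if h : i < I.n then (if ⟨i, h⟩ ∈ S.1 then 1 else 0) else 0 with hχd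
    have hχ : ∀ i, χ i < 2 := by
      intro i
      simp only [hχd]
      split_ifs <;> norm_num
    have hmem : ∀ i : Fin I.n, χ i = 1 ↔ i ∈ S.1 := by
      intro i
      simp [hχd]
    refine ⟨χ, hχ, ?_, I.cost_eq hd ε hχ S hmem⟩
    refine (I.count_data ε hχ).trans ?_
    simp only [hmem, Finset.filter_univ_mem]
    exact S.2

end SubsetInstance

end MinExp

theorem theorem2 (d : ℕ) (hd : 1 ≤ d) :
    (∃ c : MinExp.Cmd, MinExp.IsFPTAS (MinExp.minMinBinary d) c ∧
      ∃ C : ℝ, ∀ (I : MinExp.BinaryInstance d) (ε : MinExp.Ratio),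
        0 < ε.val → ε.val ≤ 1 →
        ∀ (σ : MinExp.Mem) (t b : ℕ),
          MinExp.Exec c (MinExp.inputMem ((MinExp.minMinBinary d).input I ε)) σ t b →
          (t : ℝ) ≤ C * (I.n * (I.n * (MinExp.minMinBinary d).size I / ε.val) ^ (d - 1))) ∧
    (∃ c : MinExp.Cmd, MinExp.IsFPTAS (MinExp.minMinSubset d) c) := by
  refine ⟨⟨(MinExp.binLayout d).program, ?_, ?_⟩, (MinExp.subLayout d).program, ?_⟩
  · exact (MinExp.binLayout d).isFPTAS (P := MinExp.minMinBinary d) (fun I ε => I.data ε) _ _ _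
      (fun I ε => MinExp.binLayout_reads d _) (fun I ε => I.represents hd ε)
      fun I ε _ => I.sized hd ε
  · obtain ⟨K, hK⟩ := (MinExp.binLayout d).exists_exec (MinExp.minMinBinary d)
    refine ⟨K * ((2 * (d - 1) + 5) * 6 ^ (d - 1) : ℕ), fun I ε hε hε1 σ t b hx => ?_⟩
    obtain ⟨σ', t', b', s, hx', _, _, ht', _⟩ := hK I ε (I.data ε) _ _ _ hε
      (MinExp.binLayout_reads d _) (I.represents hd ε) (I.sized hd ε)
    obtain ⟨-, rfl, -⟩ := hx.det hx'
    calc (t : ℝ) ≤ K * ((I.data ε).volume : ℝ) := by exact_mod_cast ht'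
      _ ≤ _ := by
          rw [mul_assoc]
          exact mul_le_mul_of_nonneg_left (I.volume_le ε hε hε1) (Nat.cast_nonneg _)
  · exact (MinExp.subLayout d).isFPTAS (P := MinExp.minMinSubset d) (fun I ε => I.data ε) _ _ _
      (fun I ε => MinExp.subLayout_reads d _) (fun I ε => I.represents hd ε)
      fun I ε _ => I.sized hd ε
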